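/- Let $k$ be a field of characteristic zero and let $\mathrm{Tame}(k^3)$ be the subgroup of the polynomial automorphism group of $k^3$ generated by the affine automorphisms and the automorphisms $(x_1+P(x_2,x_3),x_2,x_3)$, $P\in k[x_2,x_3]$. *The space.* Let $\nabla$ be the projectivisation of $\mathbb{R}_{>0}^3$, with the Euclidean metric pulled back by $[\alpha]\mapsto(\log\alpha_1,\log\alpha_2,\log\alpha_3)$, where $\alpha_1\alpha_2\alpha_3=1$, and let $\nabla^+=\{[\alpha]\in\nabla:\alpha_1\ge\alpha_2\ge\alpha_3\}$. Let $\nu_{\mathrm{id},\alpha}$ be the valuation on $k[x_1,x_2,x_3]$ whose value at $P$ is the minimum of $-\sum_i\alpha_im_i$ over the monomials $x_1^{m_1}x_2^{m_2}x_3^{m_3}$ appearing in $P$. For $f\in\mathrm{Tame}(k^3)$ let $\nu_{f,\alpha}(P)=\nu_{\mathrm{id},\alpha}(P\circ f)$, and let $\nu_{f,[\alpha]}$ be its class up to positive scalars. Let $\mathbf X$ be the set of all $\nu_{f,[\alpha]}$, and let $\mathbf E_f=\{\nu_{f,[\alpha]}:[\alpha]\in\nabla\}$ (apartments) and $\mathbf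 E_f^+=\{\nu_{f,[\alpha]}:[\alpha]\in\nabla^+\}$ (chambers). Each chamber carries the Euclidean metric of $\nabla^+$, and $\mathbf X$ carries the quotient metric: the infimum of the lengths of finite chains of consecutive points lying in common chambers. *The cells.* The admissible lines are the subsets of $\nabla^+$ given by $\alpha_i=p\alpha_j+q\alpha_l$ with $\{i,j,l\}=\{1,2,3\}$ and $p,q\in\mathbb{N}$ (including $0$). The vertices of $\nabla^+$ are the intersection points of distinct admissible lines, its open edges are the connected components of the complement of the vertices in the admissible lines, and its open $2$-cells are the connected components of the complement of the admissible lines. The open cells of $\mathbf X$ are the copies of the cells of $\nabla^+$ in all the chambers. *The links.* The link of a vertex $\nu$ of $\mathbf X$ is the metric graph whose vertices correspond to the edges of $\mathbf X$ containing $\nu$ in their closure and whose edges correspond to the corners at $\nu$ of the $2$-cells of $\mathbf X$; the length of an edge is the angle in $\mathbf X$ at the corresponding corner. If $\nu\in\mathbf E_f$, then the link $\Gamma_f$ of $\nu$ in $\mathbf E_f$ is the subgraph formed by the edges and corners contained in $\mathbf E_f$. **Proposition.** There is $\varepsilon_0>0$ such that for every integer $m\ge2$ and every vertex $\nu$ of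 $\mathbf X$ of weight $[m,1,1]$ (that is, $\nu=\nu_{h,[m,1,1]}$ for some $h\in\mathrm{Tame}(k^3)$), each simple cycle $\gamma$ of length $<2\pi+\varepsilon_0$ in the link of $\nu$ * equals $\Gamma_f$ for some $f\in\mathrm{Tame}(k^3)$ with $\nu_{f,[m,1,1]}=\nu$, or * is the closure of $(\Gamma_f\cup\Gamma_g)\setminus(\Gamma_f\cap\Gamma_g)$ for some $f,g\in\mathrm{Tame}(k^3)$ with $\nu_{f,[m,1,1]}=\nu_{g,[m,1,1]}=\nu$. -/

import Mathlib

namespace TameX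

open Filter Topology

noncomputable section

/-! ### The weight space -/

/-- The open positive octant of `ℝ³`; coordinates are indexed by `0, 1, 2` instead of `1, 2, 3`. -/
abbrev PosTriple : Type := {α : Fin 3 → ℝ // ∀ i, 0 < α i}

/-- Proportionality of positive triples. -/
instance weightSetoid : Setoid PosTriple where
  r α β := ∃ c : ℝ, 0 < c ∧ ∀ i, β.1 i = c * α.1 i
  iseqv :=
    { refl := fun _ => ⟨1, one_pos, fun _ => (one_mul _).symm⟩
      symm := by
        rintro α β ⟨c, hc, h⟩
        refine ⟨c⁻¹, inv_pos.2 hc, fun i => ?_⟩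
        rw [h i, inv_mul_cancel_left₀ hc.ne']
      trans := by
        rintro α β γ ⟨c, hc, h⟩ ⟨d, hd, h'⟩
        exact ⟨d * c, mul_pos hd hc, fun i => by rw [h' i, h i, mul_assoc]⟩ }

/-- The weight space `∇`: the projectivisation of the positive octant. -/
def WeightSpace : Type := Quotient weightSetoid

/-- The class `[α]` of a positive triple. -/
def WeightSpace.mk (α : PosTriple) : WeightSpace := Quotient.mk weightSetoid α

/-- `(log β₁, log β₂, log β₃)` for the multiple `β` of `α` with `β₁ β₂ β₃ = 1`. -/
def logTriple (α : PosTriple) : EuclideanSpace ℝ (Fin 3) :=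
  WithLp.toLp 2 fun i => Real.log (α.1 i) - (∑ j, Real.log (α.1 j)) / 3

theorem logTriple_eq_iff (α β : PosTriple) : logTriple α = logTriple β ↔ α ≈ β := by
  constructor
  · intro h
    have h1 : ∀ i, Real.log (α.1 i) - (∑ j, Real.log (α.1 j)) / 3
        = Real.log (β.1 i) - (∑ j, Real.log (β.1 j)) / 3 := fun i => congrArg (fun v => v i) h
    refine ⟨Real.exp ((∑ j, Real.log (β.1 j)) / 3 - (∑ j, Real.log (α.1 j)) / 3),
      Real.exp_pos _, fun i => ?_⟩
    have h2 := h1 i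
    conv_rhs => rw [← Real.exp_log (α.2 i)]
    rw [← Real.exp_add, ← Real.exp_log (β.2 i)]
    congr 1
    linarith
  · rintro ⟨c, hc, h⟩
    have h1 : ∀ i, Real.log (β.1 i) = Real.log c + Real.log (α.1 i) := fun i => by
      rw [h i, Real.log_mul hc.ne' (α.2 i).ne']
    ext i
    simp only [logTriple, h1, Fin.sum_univ_three]
    ring

/-- The embedding of `∇` in the Euclidean plane `t₁ + t₂ + t₃ = 0` of `ℝ³`. -/
def WeightSpace.log : WeightSpace → EuclideanSpace ℝ (Fin 3) :=
  Quotient.lift logTriple fun α β h => (logTriple_eq_iff α β).2 h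

theorem WeightSpace.log_injective : Function.Injective WeightSpace.log := by
  intro a b
  induction a using Quotient.inductionOn
  induction b using Quotient.inductionOn
  intro h
  exact Quotient.sound ((logTriple_eq_iff _ _).1 h)

/-- The Euclidean metric (and its topology) on `∇`. -/
instance : MetricSpace WeightSpace :=
  MetricSpace.induced WeightSpace.log WeightSpace.log_injective inferInstance

/-- The Weyl chamber `∇⁺` of all `[α]` with `α₁ ≥ α₂ ≥ α₃`. -/
def nablaPlus : Set WeightSpace :=
  {a | ∃ α : PosTriple, WeightSpace.mk α = a ∧ α.1 1 ≤ α.1 0 ∧ α.1 2 ≤ α.1 1}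

/-- The admissible lines in `∇⁺`: subsets given by `α_i = p α_j + q α_l`, where `p, q` are
natural numbers and `i, j, l` are the three indices in any order. -/
def admissibleLines : Set (Set WeightSpace) :=
  {L | ∃ (σ : Equiv.Perm (Fin 3)) (p q : ℕ),
    L = {a | a ∈ nablaPlus ∧ ∃ α : PosTriple, WeightSpace.mk α = a ∧
      α.1 (σ 0) = p * α.1 (σ 1) + q * α.1 (σ 2)}}

/-- The vertices of `∇⁺`: the intersection points of distinct admissible lines. -/
def nablaVertices : Set WeightSpace :=
  {a | ∃ L ∈ admissibleLines, ∃ L' ∈ admissibleLines, L ≠ L' ∧ a ∈ L ∧ a ∈ L'}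

/-- The open edges of `∇⁺`: the connected components of the complement of the vertices in the
admissible lines. -/
def IsNablaEdge (E : Set WeightSpace) : Prop :=
  ∃ L ∈ admissibleLines, ∃ a ∈ L \ nablaVertices, E = connectedComponentIn (L \ nablaVertices) a

/-- The open `2`-cells of `∇⁺`: the connected components of the complement of the admissible
lines in `∇⁺`. -/
def IsNablaFace (C : Set WeightSpace) : Prop :=
  ∃ a ∈ nablaPlus \ ⋃₀ admissibleLines, C = connectedComponentIn (nablaPlus \ ⋃₀ admissibleLines) a

/-! ### Tame automorphisms and monomial valuations -/

variable (k : Type*) [Field k]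

/-- The polynomial ring `k[x₁, x₂, x₃]`. -/
abbrev Poly : Type _ := MvPolynomial (Fin 3) k

/-- The tame automorphism group of `k³`. A polynomial automorphism `f = (f₁, f₂, f₃)` is given by
the algebra automorphism `P ↦ P ∘ f` of `k[x₁, x₂, x₃]`, which sends `x_i` to `f_i`. The group is
generated by the affine automorphisms (all components of degree at most `1`) and the automorphisms
`(x₁ + P(x₂, x₃), x₂, x₃)`. (Passing to `P ↦ P ∘ f` reverses the order of composition, which does
not affect the subgroup generated by a set.) -/
def Tame : Subgroup (Poly k ≃ₐ[k] Poly k) :=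
  Subgroup.closure
    ({f | ∀ i, (f (MvPolynomial.X i)).totalDegree ≤ 1} ∪
      {f | ∃ P ∈ MvPolynomial.supported k ({1, 2} : Set (Fin 3)),
        f (MvPolynomial.X 0) = MvPolynomial.X 0 + P ∧
        f (MvPolynomial.X 1) = MvPolynomial.X 1 ∧ f (MvPolynomial.X 2) = MvPolynomial.X 2})

variable {k}

/-- The valuation `ν_{id,α}`: the minimum of `-∑ α_i m_i` over the monomials
`x₁^{m₁} x₂^{m₂} x₃^{m₃}` of `P`, and `+∞` at `P = 0`. -/
def nuId (α : PosTriple) (P : Poly k) : WithTop ℝ :=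
  P.support.inf fun m => ((-∑ i, α.1 i * (m i : ℝ) : ℝ) : WithTop ℝ)

/-- The monomial valuation `ν_{f,α}(P) = ν_{id,α}(P ∘ f)`. -/
def nu (f : Tame k) (α : PosTriple) : Poly k → WithTop ℝ := fun P => nuId α (f.1 P)

variable (k)

/-- Proportionality of functions `k[x₁, x₂, x₃] → ℝ ∪ {+∞}`, by a positive real factor. -/
instance valSetoid : Setoid (Poly k → WithTop ℝ) where
  r ν μ := ∃ c : ℝ, 0 < c ∧ ∀ P, μ P = (ν P).map (c * ·)
  iseqv :=
    { refl := fun ν => ⟨1, one_pos, fun P => by cases ν P <;> simp⟩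
      symm := by
        rintro ν μ ⟨c, hc, h⟩
        refine ⟨c⁻¹, inv_pos.2 hc, fun P => ?_⟩
        rw [h P, WithTop.map_map]
        have : (c⁻¹ * ·) ∘ (c * ·) = (id : ℝ → ℝ) :=
          funext fun x => inv_mul_cancel_left₀ hc.ne' x
        rw [this, WithTop.map_id, id]
      trans := by
        rintro ν μ ξ ⟨c, hc, h⟩ ⟨d, hd, h'⟩
        refine ⟨d * c, mul_pos hd hc, fun P => ?_⟩
        rw [h' P, h P, WithTop.map_map]
        congr 1
        exact funext fun x => (mul_assoc d c x).symm }

variable {k}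

theorem nu_smul (f : Tame k) (α β : PosTriple) (h : α ≈ β) : nu f α ≈ nu f β := by
  obtain ⟨c, hc, h⟩ := h
  refine ⟨c, hc, fun P => ?_⟩
  have hm : Monotone (WithTop.map (c * ·) : WithTop ℝ → WithTop ℝ) :=
    WithTop.monotone_map_iff.2 fun x y hxy => mul_le_mul_of_nonneg_left hxy hc.le
  simp only [nu, nuId]
  rw [Finset.apply_inf_eq_inf_comp (WithTop.map (c * ·)) (fun x y => hm.map_inf x y) rfl]
  refine Finset.inf_congr rfl fun m _ => ?_
  simp only [Function.comp, WithTop.map_coe, h]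
  congr 1
  rw [mul_neg, Finset.mul_sum]
  simp only [mul_assoc]

/-- The projective class `ν_{f,[α]}`, depending only on the class `[α]`. -/
def nuClass (f : Tame k) : WeightSpace → Quotient (valSetoid k) :=
  Quotient.map (nu f) fun α β h => nu_smul f α β h

variable (k)

/-- The space `𝐗` of projective classes of monomial valuations. -/
def X : Type _ := {x : Quotient (valSetoid k) // ∃ f a, x = nuClass f a}

variable {k}

/-- `ν_{f,[α]}` as a point of `𝐗`. -/
def pt (f : Tame k) (a : WeightSpace) : X k := ⟨nuClass f a, f, a, rfl⟩

/-- The apartment `𝐄_f`. -/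
def apartment (f : Tame k) : Set (X k) := Set.range (pt f)

/-! ### The metric of `𝐗` -/

/-- `ChainOfLength x y l`: there is a chain from `x` to `y` of length `l`, that is, a finite sequence
of pairs of points, each pair in a single chamber, such that the second point of each pair and the
first point of the next pair are equal in `𝐗`; the length is the sum of the Euclidean distances. -/
inductive ChainOfLength : X k → X k → ℝ → Prop
  | single (f : Tame k) (a b : WeightSpace) (ha : a ∈ nablaPlus) (hb : b ∈ nablaPlus) :
      ChainOfLength (pt f a) (pt f b) (dist a b)
  | cons (f : Tame k) (a b : WeightSpace) (ha : a ∈ nablaPlus) (hb : b ∈ nablaPlus)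
      (y : X k) (l : ℝ) (h : ChainOfLength (pt f b) y l) :
      ChainOfLength (pt f a) y (dist a b + l)

/-- The quotient metric `d_𝐗`: the infimum of the lengths of chains (any two points of `𝐗` are
joined by a chain). -/
def distX (x y : X k) : ℝ := sInf {l | ChainOfLength x y l}

/-- The comparison angle at `p` of the triple `(x, p, y)`. -/
def comparisonAngle (p x y : X k) : ℝ :=
  Real.arccos ((distX p x ^ 2 + distX p y ^ 2 - distX x y ^ 2) / (2 * distX p x * distX p y))

/-- The filter of the points of `e` that tend to `p` in `𝐗`. -/
def towards (p : X k) (e : Set (X k)) : Filter (X k) := comap (distX p) (𝓝 0) ⊓ 𝓟 e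

/-- The Alexandrov angle at `p` between two paths `e`, `e'` issuing from `p`: the upper limit of
the comparison angles of `(x, p, y)` for `x ∈ e` and `y ∈ e'` tending to `p`. -/
def angleX (p : X k) (e e' : Set (X k)) : ℝ :=
  limsup (fun z : X k × X k => comparisonAngle p z.1 z.2) (towards p e ×ˢ towards p e')

/-! ### The link of a vertex of `𝐗`

Every open cell of `𝐗` is the copy `pt f '' σ`, in some chamber, of an open cell `σ` of `∇⁺`;
the corresponding closed cell is `pt f '' closure σ`. -/

/-- The vertices of the link of `ν`: the open edges of `𝐗` that contain `ν` in their closure. -/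
def IsLinkVertex (ν : X k) (e : Set (X k)) : Prop :=
  ∃ (f : Tame k) (E : Set WeightSpace), IsNablaEdge E ∧ e = pt f '' E ∧ ν ∈ pt f '' closure E

/-- The edges of the link of `ν`: the corners at `ν` of `2`-cells of `𝐗`. A closed `2`-cell has at
most one corner at `ν`, so a corner is recorded by its open `2`-cell. -/
def IsLinkEdge (ν : X k) (c : Set (X k)) : Prop :=
  ∃ (f : Tame k) (C : Set WeightSpace), IsNablaFace C ∧ c = pt f '' C ∧ ν ∈ pt f '' closure C

/-- Incidence in the link of `ν`: `e` is one of the two sides of the corner of `c` at `ν`. -/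
def LinkInc (ν : X k) (c e : Set (X k)) : Prop :=
  ∃ (f : Tame k) (C E : Set WeightSpace), IsNablaFace C ∧ IsNablaEdge E ∧ E ⊆ closure C ∧
    c = pt f '' C ∧ e = pt f '' E ∧ ν ∈ pt f '' closure E

/-- A set of vertices together with a set of edges of a link. -/
@[ext]
structure SubLink (k : Type*) [Field k] where
  /-- the vertices -/
  verts : Set (Set (X k))
  /-- the edges -/
  edges : Set (Set (X k))

/-- The link `Γ_f` of `ν` in the apartment `𝐄_f`. -/
def apartmentLink (ν : X k) (f : Tame k) : SubLink k where
  verts := {e | IsLinkVertex ν e ∧ e ⊆ apartment f}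
  edges := {c | IsLinkEdge ν c ∧ c ⊆ apartment f}

/-- The closure, in the link of `ν`, of `(A ∪ B) ∖ (A ∩ B)`: the edges and the vertices that lie in
exactly one of `A`, `B`, together with the end-vertices of these edges. -/
def closureSymmDiff (ν : X k) (A B : SubLink k) : SubLink k where
  verts := {e | e ∈ (A.verts ∪ B.verts) \ (A.verts ∩ B.verts) ∨
    ∃ c ∈ (A.edges ∪ B.edges) \ (A.edges ∩ B.edges), LinkInc ν c e}
  edges := (A.edges ∪ B.edges) \ (A.edges ∩ B.edges)

/-- A (simple) cycle in the link of `ν`: cyclically ordered, pairwise distinct vertices and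
pairwise distinct edges, the `i`-th edge joining the `i`-th vertex to the next one. There are no
loops, so the number `n + 2` of edges is at least `2`. -/
structure LinkCycle (ν : X k) where
  /-- the number of edges, minus two -/
  n : ℕ
  /-- the vertices, in cyclic order -/
  vert : Fin (n + 2) → Set (X k)
  /-- the edges, in cyclic order -/
  edge : Fin (n + 2) → Set (X k)
  vert_injective : Function.Injective vert
  edge_injective : Function.Injective edge
  inc_left : ∀ i, LinkInc ν (edge i) (vert i)
  inc_right : ∀ i, LinkInc ν (edge i) (vert (i + 1))

/-- The length of a cycle: each edge of the link has the length of the angle in `𝐗` at the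
corresponding corner, between the two sides of the corner. -/
def LinkCycle.length {ν : X k} (γ : LinkCycle ν) : ℝ :=
  ∑ i, angleX ν (γ.vert i) (γ.vert (i + 1))

/-- A cycle as a set of vertices and edges. -/
def LinkCycle.toSubLink {ν : X k} (γ : LinkCycle ν) : SubLink k where
  verts := Set.range γ.vert
  edges := Set.range γ.edge

/-- The weight `[m, 1, 1]`. -/
def weightM11 (m : ℕ) (hm : 2 ≤ m) : WeightSpace :=
  WeightSpace.mk ⟨![(m : ℝ), 1, 1], by
    have : (0 : ℝ) < m := by exact_mod_cast (by omega : 0 < m)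
    intro i
    fin_cases i <;> simp [this]⟩

end

end TameX

/-! Normalise weights so that the last coordinate is 1. Admissible lines become straight lines in
the chart, and cells become sign classes of the forms `form σ p q`. With x = α₁ - m and y = α₂ - 1,
the forms vanishing at [m,1,1] are x - j·y (0 ≤ j ≤ m) and ±y. So a chamber at ν contributes to the
link a path with vertices of height 0, …, m+2 in the directions (-1,0), (j,1), (1,0), and with faces
0, …, m+1 between them.

An automorphism fixes ν_{id,α} iff each monomial of its i-th component is x_i itself or corresponds
to an admissible form that is nonnegative at α (`wt_le_iff`). Signs of forms thus control
stabilizers. A vertex of height 1 ≤ s ≤ m+1 has the same stabilizer as the face just above it, so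
exactly one edge leaves it upwards (`le_eq_of_lv_eq`). Two edges at a vertex of height 0 lie in a
common apartment, by the Bruhat decomposition of GL₂ acting on the last two coordinates
(`exists_apartment`).

Consequently a cycle has a vertex of height 0, and from there it is a concatenation of mountains:
climb from height 0 to a peak s, then descend to height 0 (`LinkWalk.exists_mountain`). One mountain
closes up only if its peak is m+2, and is then an apartment link. Two mountains with peaks below m+2
form the closed symmetric difference of the two apartments through the two valleys.

Everything else is long. A mountain has length at least twice the Euclidean angle between the
directions 0 and s, which is at least π/3, is π for s = m+2, and is at least arccos(2/5) once 6(s-1)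
≥ m. Four mountains, or a full mountain together with another one, give at least 8π/3. Three
mountains with peaks below m+2 satisfy s₁+s₂+s₃ ≥ m+2 (`add_two_le_sum_heights`): the degree-m parts
of the first components yield three binary forms with sum zero, each divisible by a high power of
one of three pairwise independent linear forms, and a Mason–Stothers argument in characteristic zero
bounds the exponents. Hence some peak has 6(s-1) ≥ m, and the length is at least 2π + 2(arccos(2/5)
- π/3). The excess over 2π is ε₀, which does not depend on m. -/

namespace TameX
open Filter Topology

/-! ### An affine chart of the weight space -/

/-- The coordinates of the representative of `a` whose last coordinate is `1`. -/
noncomputable def WeightSpace.rep (a : WeightSpace) (i : Fin 3) : ℝ :=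
  Real.exp (a.log i - a.log 2)

theorem rep_pos (a : WeightSpace) (i : Fin 3) : 0 < a.rep i := Real.exp_pos _

@[simp] theorem rep_two (a : WeightSpace) : a.rep 2 = 1 := by simp [WeightSpace.rep]

theorem rep_mk (α : PosTriple) (i : Fin 3) : (WeightSpace.mk α).rep i = α.1 i / α.1 2 := by
  change Real.exp ((logTriple α) i - (logTriple α) 2) = _
  simp only [logTriple, sub_sub_sub_cancel_right]
  rw [Real.exp_sub, Real.exp_log (α.2 i), Real.exp_log (α.2 2)]

/-- The representative with last coordinate `1`. -/
noncomputable def WeightSpace.triple (a : WeightSpace) : PosTriple := ⟨a.rep, rep_pos a⟩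

@[simp] theorem mk_triple (a : WeightSpace) : WeightSpace.mk a.triple = a := by
  induction a using Quotient.inductionOn with
  | h α =>
    refine Quotient.sound ⟨α.1 2, α.2 2, fun i => ?_⟩
    have := rep_mk α i
    change α.1 i = α.1 2 * (WeightSpace.mk α).rep i
    rw [this, mul_div_cancel₀ _ (α.2 2).ne']

theorem rep_injective {a b : WeightSpace} (h : ∀ i, a.rep i = b.rep i) : a = b := by
  rw [← mk_triple a, ← mk_triple b]
  congr 1
  exact Subtype.ext (funext h)

theorem isometry_log : Isometry WeightSpace.log := Isometry.of_dist_eq fun _ _ => rfl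

theorem continuous_rep (i : Fin 3) : Continuous fun a : WeightSpace => a.rep i := by
  have h (j : Fin 3) : Continuous fun a : WeightSpace => a.log j :=
    (EuclideanSpace.proj (𝕜 := ℝ) j).continuous.comp isometry_log.continuous
  exact Real.continuous_exp.comp ((h i).sub (h 2))

theorem continuous_mk_comp {ι : Type*} [TopologicalSpace ι] (x : ι → Fin 3 → ℝ)
    (hx : ∀ s i, 0 < x s i) (hc : ∀ i, Continuous fun s => x s i) :
    Continuous fun s => WeightSpace.mk ⟨x s, hx s⟩ := by
  rw [isometry_log.isEmbedding.continuous_iff]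
  change Continuous fun s => logTriple ⟨x s, hx s⟩
  have hl (i : Fin 3) : Continuous fun s => Real.log (x s i) :=
    (hc i).log fun s => (hx s i).ne'
  refine (PiLp.continuous_toLp 2 _).comp (continuous_pi fun i => ?_)
  exact (hl i).sub ((continuous_finsetSum _ fun j _ => hl j).div_const 3)

theorem mem_nablaPlus_iff (a : WeightSpace) :
    a ∈ nablaPlus ↔ a.rep 1 ≤ a.rep 0 ∧ 1 ≤ a.rep 1 := by
  constructor
  · rintro ⟨α, rfl, h1, h2⟩
    rw [rep_mk, rep_mk, one_le_div (α.2 2)]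
    exact ⟨div_le_div_of_nonneg_right h1 (α.2 2).le, h2⟩
  · rintro ⟨h1, h2⟩
    exact ⟨a.triple, mk_triple a, h1, by simpa [WeightSpace.triple] using h2⟩

/-- The affine form `α_i - (p α_j + q α_l)` in the chart, where `i, j, l` are the values of `σ`. -/
noncomputable def form (σ : Equiv.Perm (Fin 3)) (p q : ℕ) (a : WeightSpace) : ℝ :=
  a.rep (σ 0) - (p * a.rep (σ 1) + q * a.rep (σ 2))

theorem continuous_form (σ : Equiv.Perm (Fin 3)) (p q : ℕ) : Continuous (form σ p q) :=
  (continuous_rep _).sub (((continuous_rep _).const_mul _).add ((continuous_rep _).const_mul _))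

/-- The zero set of a form in the Weyl chamber. -/
def line (σ : Equiv.Perm (Fin 3)) (p q : ℕ) : Set WeightSpace :=
  {a | a ∈ nablaPlus ∧ form σ p q a = 0}

theorem mem_admissibleLines_iff (L : Set WeightSpace) :
    L ∈ admissibleLines ↔ ∃ σ p q, L = line σ p q := by
  suffices h : ∀ (σ : Equiv.Perm (Fin 3)) (p q : ℕ),
      {a | a ∈ nablaPlus ∧ ∃ α : PosTriple, WeightSpace.mk α = a ∧
        α.1 (σ 0) = p * α.1 (σ 1) + q * α.1 (σ 2)} = line σ p q by
    simp only [admissibleLines, h, Set.mem_ofPred_eq]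
  intro σ p q
  ext a
  refine and_congr_right fun _ => ⟨?_, fun h => ⟨a.triple, mk_triple a, sub_eq_zero.1 h⟩⟩
  rintro ⟨α, rfl, h⟩
  simp only [form, rep_mk, h]
  ring

theorem line_mem (σ : Equiv.Perm (Fin 3)) (p q : ℕ) : line σ p q ∈ admissibleLines :=
  (mem_admissibleLines_iff _).2 ⟨σ, p, q, rfl⟩

/-- The point of the segment from `a` to `b` in the chart with parameter `t`. -/
noncomputable def seg (a b : WeightSpace) (t : unitInterval) : WeightSpace :=
  WeightSpace.mk ⟨fun i => (1 - t) * a.rep i + t * b.rep i, fun i => by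
    have h0 := t.2.1
    have h1 := t.2.2
    rcases h0.eq_or_lt with h | h
    · simp [← h, rep_pos a i]
    · have := mul_pos h (rep_pos b i)
      have := mul_nonneg (sub_nonneg.2 h1) (rep_pos a i).le
      linarith⟩

theorem continuous_seg (a b : WeightSpace) : Continuous (seg a b) :=
  continuous_mk_comp _ _ fun i => by fun_prop

theorem rep_seg (a b : WeightSpace) (t : unitInterval) (i : Fin 3) :
    (seg a b t).rep i = (1 - t) * a.rep i + t * b.rep i := by
  simp [seg, rep_mk]

theorem form_seg (a b : WeightSpace) (t : unitInterval) (σ : Equiv.Perm (Fin 3)) (p q : ℕ) :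
    form σ p q (seg a b t) = (1 - t) * form σ p q a + t * form σ p q b := by
  simp only [form, rep_seg]
  ring

@[simp] theorem seg_zero (a b : WeightSpace) : seg a b 0 = a :=
  rep_injective fun i => by simp [rep_seg]

@[simp] theorem seg_one (a b : WeightSpace) : seg a b 1 = b :=
  rep_injective fun i => by simp [rep_seg]

theorem seg_mem_nablaPlus {a b : WeightSpace} (ha : a ∈ nablaPlus) (hb : b ∈ nablaPlus)
    (t : unitInterval) : seg a b t ∈ nablaPlus := by
  rw [mem_nablaPlus_iff] at *
  simp only [rep_seg]
  have h0 := t.2.1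
  have h1 := sub_nonneg.2 t.2.2
  constructor <;> nlinarith

/-! ### Cells as sign classes -/

/-- The set of the points of the Weyl chamber at which all forms have the same signs as at `a`. -/
def cell (a : WeightSpace) : Set WeightSpace :=
  {b | b ∈ nablaPlus ∧ ∀ σ p q, SignType.sign (form σ p q b) = SignType.sign (form σ p q a)}

theorem mem_cell_self {a : WeightSpace} (ha : a ∈ nablaPlus) : a ∈ cell a := ⟨ha, fun _ _ _ => rfl⟩

theorem cell_eq_of_mem {a b : WeightSpace} (h : b ∈ cell a) : cell b = cell a := by
  ext c
  simp only [cell, Set.mem_ofPred_eq, h.2]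

theorem sign_convex {x y t : ℝ} (h0 : 0 ≤ t) (h1 : t ≤ 1)
    (h : SignType.sign x = SignType.sign y) :
    SignType.sign ((1 - t) * x + t * y) = SignType.sign y := by
  rcases lt_trichotomy y 0 with hy | rfl | hy
  · rw [sign_neg hy] at h ⊢
    rw [sign_eq_neg_one_iff] at h ⊢
    exact convex_Iio (0 : ℝ) h hy (sub_nonneg.2 h1) h0 (sub_add_cancel 1 t)
  · rw [sign_zero] at h
    rw [sign_eq_zero_iff] at h
    simp [h]
  · rw [sign_pos hy] at h ⊢
    rw [sign_eq_one_iff] at h ⊢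
    exact convex_Ioi (0 : ℝ) h hy (sub_nonneg.2 h1) h0 (sub_add_cancel 1 t)

theorem isPreconnected_cell (a : WeightSpace) : IsPreconnected (cell a) := by
  refine isPreconnected_of_forall_pair fun b hb c hc =>
    ⟨seg b c '' Set.univ, ?_, ⟨0, trivial, by simp⟩, ⟨1, trivial, by simp⟩,
      isPreconnected_univ.image _ (continuous_seg b c).continuousOn⟩
  rintro _ ⟨t, -, rfl⟩
  refine ⟨seg_mem_nablaPlus hb.1 hc.1 t, fun σ p q => ?_⟩
  rw [form_seg, sign_convex t.2.1 t.2.2 ((hb.2 σ p q).trans (hc.2 σ p q).symm), hc.2]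

theorem sign_eq_of_isPreconnected {S : Set WeightSpace} (hS : IsPreconnected S)
    {F : WeightSpace → ℝ} (hF : Continuous F) (h0 : ∀ a ∈ S, F a ≠ 0) {a b : WeightSpace}
    (ha : a ∈ S) (hb : b ∈ S) : SignType.sign (F b) = SignType.sign (F a) := by
  have hp := hS.image F hF.continuousOn
  have hn : (0 : ℝ) ∉ F '' S := by
    rintro ⟨c, hc, h⟩
    exact h0 c hc h
  have ho := hp.ordConnected
  rcases (h0 a ha).lt_or_gt with h | h <;> rcases (h0 b hb).lt_or_gt with h' | h'
  · rw [sign_neg h, sign_neg h']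
  · exact (hn (ho.out ⟨a, ha, rfl⟩ ⟨b, hb, rfl⟩ ⟨h.le, h'.le⟩)).elim
  · exact (hn (ho.out ⟨b, hb, rfl⟩ ⟨a, ha, rfl⟩ ⟨h'.le, h.le⟩)).elim
  · rw [sign_pos h, sign_pos h']

/-- A sign class is convex in the chart, hence connected, and the class of such a point avoids all
lines. Conversely, a form without zeros on a connected set keeps its sign there. -/
theorem IsNablaFace.exists_cell {C : Set WeightSpace} (h : IsNablaFace C) :
    ∃ a ∈ nablaPlus, (∀ σ p q, form σ p q a ≠ 0) ∧ C = cell a := by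
  obtain ⟨a, ⟨ha, hn⟩, rfl⟩ := h
  have hz : ∀ b ∈ nablaPlus \ ⋃₀ admissibleLines, ∀ σ p q, form σ p q b ≠ 0 :=
    fun b hb σ p q h => hb.2 ⟨_, line_mem σ p q, hb.1, h⟩
  refine ⟨a, ha, hz a ⟨ha, hn⟩, Set.Subset.antisymm (fun b hb => ?_) ?_⟩
  · have hsub := connectedComponentIn_subset (nablaPlus \ ⋃₀ admissibleLines) a
    exact ⟨(hsub hb).1, fun σ p q => sign_eq_of_isPreconnected isPreconnected_connectedComponentIn
      (continuous_form σ p q) (fun c hc => hz c (hsub hc) σ p q)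
      (mem_connectedComponentIn ⟨ha, hn⟩) hb⟩
  · refine (isPreconnected_cell a).subset_connectedComponentIn (mem_cell_self ha) ?_
    refine fun b hb => ⟨hb.1, ?_⟩
    rintro ⟨L, hL, hbL⟩
    obtain ⟨σ, p, q, rfl⟩ := (mem_admissibleLines_iff L).1 hL
    have := hb.2 σ p q
    rw [hbL.2, sign_zero, eq_comm, sign_eq_zero_iff] at this
    exact hz a ⟨ha, hn⟩ σ p q this

/-- A point that is not a vertex lies on a single admissible line. So a form that vanishes at one
point of the component cuts out that very line and vanishes on all of the component, while every
other form has no zero there. -/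
theorem IsNablaEdge.exists_cell {E : Set WeightSpace} (h : IsNablaEdge E) :
    ∃ a ∈ nablaPlus, a ∉ nablaVertices ∧ (∃ σ p q, form σ p q a = 0) ∧ E = cell a := by
  obtain ⟨L, hL, a, ⟨haL, hav⟩, rfl⟩ := h
  have key : ∀ b ∈ L, b ∉ nablaVertices → ∀ L' ∈ admissibleLines, b ∈ L' → L' = L := by
    intro b hb hbv L' hL' hb'
    by_contra hne
    exact hbv ⟨L', hL', L, hL, hne, hb', hb⟩
  obtain ⟨σ₀, p₀, q₀, hL0⟩ := (mem_admissibleLines_iff L).1 hL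
  have hplus : ∀ b ∈ L, b ∈ nablaPlus := fun b hb => by rw [hL0] at hb; exact hb.1
  have ha := hplus a haL
  have hmema : a ∈ L \ nablaVertices := ⟨haL, hav⟩
  refine ⟨a, ha, hav, ⟨σ₀, p₀, q₀, by rw [hL0] at haL; exact haL.2⟩,
    Set.Subset.antisymm (fun b hb => ?_) ?_⟩
  · have hsub := connectedComponentIn_subset (L \ nablaVertices) a
    refine ⟨hplus b (hsub hb).1, fun σ p q => ?_⟩
    by_cases h0 : form σ p q a = 0
    · have hb' : b ∈ line σ p q := by
        rw [key a haL hav _ (line_mem σ p q) ⟨ha, h0⟩]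
        exact (hsub hb).1
      rw [h0, hb'.2]
    · refine sign_eq_of_isPreconnected isPreconnected_connectedComponentIn
        (continuous_form σ p q) (fun c hc hc0 => h0 ?_) (mem_connectedComponentIn hmema) hb
      have hl := key c (hsub hc).1 (hsub hc).2 _ (line_mem σ p q) ⟨hplus c (hsub hc).1, hc0⟩
      exact (hl.ge haL).2
  · refine (isPreconnected_cell a).subset_connectedComponentIn (mem_cell_self ha) ?_
    intro b hb
    have hmem : ∀ L' ∈ admissibleLines, b ∈ L' → a ∈ L' := by
      intro L' hL' hb'
      obtain ⟨σ, p, q, rfl⟩ := (mem_admissibleLines_iff L').1 hL'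
      have := hb.2 σ p q
      rw [hb'.2, sign_zero, eq_comm, sign_eq_zero_iff] at this
      exact ⟨ha, this⟩
    refine ⟨?_, ?_⟩
    · rw [hL0] at haL ⊢
      have := hb.2 σ₀ p₀ q₀
      rw [haL.2, sign_zero, sign_eq_zero_iff] at this
      exact ⟨hb.1, this⟩
    · rintro ⟨L₁, h1, L₂, h2, hne, hb1, hb2⟩
      exact hav ⟨L₁, h1, L₂, h2, hne, hmem L₁ h1 hb1, hmem L₂ h2 hb2⟩

theorem isClosed_nablaPlus : IsClosed nablaPlus := by
  have : nablaPlus = {a | a.rep 1 ≤ a.rep 0} ∩ {a | 1 ≤ a.rep 1} := by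
    ext a
    exact mem_nablaPlus_iff a
  rw [this]
  exact (isClosed_le (continuous_rep 1) (continuous_rep 0)).inter
    (isClosed_le continuous_const (continuous_rep 1))

theorem closure_cell_subset_nablaPlus (a : WeightSpace) : closure (cell a) ⊆ nablaPlus :=
  closure_minimal (fun _ h => h.1) isClosed_nablaPlus

theorem form_nonneg_of_mem_closure {a b : WeightSpace} (h : b ∈ closure (cell a))
    {σ : Equiv.Perm (Fin 3)} {p q : ℕ} (h0 : 0 ≤ form σ p q a) : 0 ≤ form σ p q b := by
  refine closure_minimal (fun c hc => ?_)
    (isClosed_le continuous_const (continuous_form σ p q)) h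
  have := hc.2 σ p q
  rw [Set.mem_ofPred_eq, ← sign_nonneg_iff, this, sign_nonneg_iff]
  exact h0

theorem form_nonpos_of_mem_closure {a b : WeightSpace} (h : b ∈ closure (cell a))
    {σ : Equiv.Perm (Fin 3)} {p q : ℕ} (h0 : form σ p q a ≤ 0) : form σ p q b ≤ 0 := by
  refine closure_minimal (fun c hc => ?_)
    (isClosed_le (continuous_form σ p q) continuous_const) h
  have := hc.2 σ p q
  rw [Set.mem_ofPred_eq, ← sign_nonpos_iff, this, sign_nonpos_iff]
  exact h0

end TameX

namespace TameX
open Filter Topology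

/-! ### Cells adjacent to the vertex `[m, 1, 1]` -/

theorem perm_fin_three_cases (σ : Equiv.Perm (Fin 3)) :
    (σ 0 = 0 ∧ σ 1 = 1 ∧ σ 2 = 2) ∨ (σ 0 = 0 ∧ σ 1 = 2 ∧ σ 2 = 1) ∨
    (σ 0 = 1 ∧ σ 1 = 0 ∧ σ 2 = 2) ∨ (σ 0 = 1 ∧ σ 1 = 2 ∧ σ 2 = 0) ∨
    (σ 0 = 2 ∧ σ 1 = 0 ∧ σ 2 = 1) ∨ (σ 0 = 2 ∧ σ 1 = 1 ∧ σ 2 = 0) := by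
  revert σ
  decide

theorem form_cases (σ : Equiv.Perm (Fin 3)) (p q : ℕ) :
    (∃ p' q' : ℕ, ∀ a, form σ p q a = a.rep 0 - (p' * a.rep 1 + q')) ∨
    (∃ p' q' : ℕ, ∀ a, form σ p q a = a.rep 1 - (p' * a.rep 0 + q')) ∨
    (∃ p' q' : ℕ, ∀ a, form σ p q a = 1 - (p' * a.rep 0 + q' * a.rep 1)) := by
  rcases perm_fin_three_cases σ with h | h | h | h | h | h <;> obtain ⟨h0, h1, h2⟩ := h
  · exact .inl ⟨p, q, fun a => by simp [form, h0, h1, h2]⟩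
  · exact .inl ⟨q, p, fun a => by simp [form, h0, h1, h2]; ring⟩
  · exact .inr (.inl ⟨p, q, fun a => by simp [form, h0, h1, h2]⟩)
  · exact .inr (.inl ⟨q, p, fun a => by simp [form, h0, h1, h2]; ring⟩)
  · exact .inr (.inr ⟨p, q, fun a => by simp [form, h0, h1, h2]⟩)
  · exact .inr (.inr ⟨q, p, fun a => by simp [form, h0, h1, h2]; ring⟩)

theorem form_one (p q : ℕ) (a : WeightSpace) :
    form 1 p q a = a.rep 0 - (p * a.rep 1 + q) := by simp [form]

theorem form_swap (p q : ℕ) (a : WeightSpace) :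
    form (Equiv.swap 0 1) p q a = a.rep 1 - (p * a.rep 0 + q) := by
  simp [form, Equiv.swap_apply_of_ne_of_ne]

variable (m : ℕ) (hm : 2 ≤ m)

theorem rep_weight_zero : (weightM11 m hm).rep 0 = m := by simp [weightM11, rep_mk]

theorem rep_weight_one : (weightM11 m hm).rep 1 = 1 := by simp [weightM11, rep_mk]

theorem weight_mem_nablaPlus : weightM11 m hm ∈ nablaPlus := by
  rw [mem_nablaPlus_iff, rep_weight_zero, rep_weight_one]
  exact ⟨by exact_mod_cast (by omega : 1 ≤ m), le_rfl⟩

/-- The points of the Weyl chamber at which all forms that do not vanish at `[m, 1, 1]` have the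
same sign as at `[m, 1, 1]`. -/
def Adjacent (a : WeightSpace) : Prop :=
  a ∈ nablaPlus ∧ ∀ σ p q, (0 < form σ p q (weightM11 m hm) → 0 < form σ p q a) ∧
    (form σ p q (weightM11 m hm) < 0 → form σ p q a < 0)

theorem adjacent_of_mem_closure {a : WeightSpace} (ha : a ∈ nablaPlus)
    (h : weightM11 m hm ∈ closure (cell a)) : Adjacent m hm a :=
  ⟨ha, fun _ _ _ =>
    ⟨fun h0 => lt_of_not_ge fun h1 => (form_nonpos_of_mem_closure h h1).not_gt h0,
      fun h0 => lt_of_not_ge fun h1 => (form_nonneg_of_mem_closure h h1).not_gt h0⟩⟩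

/-- The first coordinate in the chart, relative to `[m, 1, 1]`. -/
noncomputable def px (a : WeightSpace) : ℝ := a.rep 0 - m

/-- The second coordinate in the chart, relative to `[m, 1, 1]`. -/
noncomputable def py (a : WeightSpace) : ℝ := a.rep 1 - 1

theorem py_nonneg {a : WeightSpace} (ha : a ∈ nablaPlus) : 0 ≤ py a :=
  sub_nonneg.2 ((mem_nablaPlus_iff a).1 ha).2

include hm in
-- The values at [m,1,1] are the integers m - (p+q) and 1 - (pm+q). As m ≥ 2, the second kind
-- vanishes only for p = 0, q = 1.
theorem form_cases_of_eq_zero {σ : Equiv.Perm (Fin 3)} {p q : ℕ}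
    (h : form σ p q (weightM11 m hm) = 0) :
    (∃ j : ℕ, j ≤ m ∧ ∀ a, form σ p q a = px m a - j * py a) ∨
    (∀ a, form σ p q a = py a) ∨ (∀ a, form σ p q a = -py a) := by
  rcases form_cases σ p q with ⟨p, q, hf⟩ | ⟨p, q, hf⟩ | ⟨p, q, hf⟩ <;>
    rw [hf, rep_weight_zero, rep_weight_one] at h
  · have h' : m = p + q := by
      have : (m : ℝ) = p + q := by linarith
      exact_mod_cast this
    refine .inl ⟨p, by omega, fun a => ?_⟩
    rw [hf, px, py, h']
    push_cast
    ring
  · have h' : p * m + q = 1 := by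
      have : (p * m + q : ℝ) = 1 := by linarith
      exact_mod_cast this
    have hp : p = 0 := by
      by_contra h0
      have := Nat.mul_le_mul (Nat.one_le_iff_ne_zero.2 h0) hm
      omega
    subst hp
    have hq : q = 1 := by omega
    exact .inr (.inl fun a => by rw [hf, py, hq]; simp)
  · have h' : p * m + q = 1 := by
      have : (p * m + q : ℝ) = 1 := by linarith
      exact_mod_cast this
    have hp : p = 0 := by
      by_contra h0
      have := Nat.mul_le_mul (Nat.one_le_iff_ne_zero.2 h0) hm
      omega
    subst hp
    have hq : q = 1 := by omega
    exact .inr (.inr fun a => by rw [hf, py, hq]; simp)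

theorem form_one_eq {j : ℕ} (hj : j ≤ m) (a : WeightSpace) :
    form 1 j (m - j) a = px m a - j * py a := by
  rw [form_one, px, py, Nat.cast_sub hj]
  ring

theorem form_swap_eq (a : WeightSpace) : form (Equiv.swap 0 1) 0 1 a = py a := by
  simp [form_swap, py]

/-- Every form that is nonnegative at `a` is nonnegative at `b`. -/
def Spec (a b : WeightSpace) : Prop := ∀ σ p q, 0 ≤ form σ p q a → 0 ≤ form σ p q b

/-- Forms that do not vanish at [m,1,1] have the same sign at all adjacent points, so only the
finitely many functions x - j·y and ±y remain to be compared. The predicate `P` allows several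
source points because face 0 is controlled only by two edges jointly. -/
theorem form_nonneg_of_adjacent {P : WeightSpace → Prop} {b : WeightSpace} (hb : Adjacent m hm b)
    (ha : ∀ a, P a → Adjacent m hm a) (hne : ∃ a, P a)
    (hx : ∀ j : ℕ, j ≤ m → (∀ a, P a → 0 ≤ px m a - j * py a) → 0 ≤ px m b - j * py b)
    (hy : (∀ a, P a → py a = 0) → py b = 0) (σ : Equiv.Perm (Fin 3)) (p q : ℕ)
    (h : ∀ a, P a → 0 ≤ form σ p q a) : 0 ≤ form σ p q b := by
  rcases lt_trichotomy (form σ p q (weightM11 m hm)) 0 with h0 | h0 | h0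
  · obtain ⟨a, hPa⟩ := hne
    exact absurd (h a hPa) (((ha a hPa).2 σ p q).2 h0).not_ge
  · rcases form_cases_of_eq_zero m hm h0 with ⟨j, hj, hf⟩ | hf | hf
    · simp only [hf] at h ⊢
      exact hx j hj h
    · rw [hf]
      exact py_nonneg hb.1
    · simp only [hf] at h ⊢
      rw [hy fun a hPa => le_antisymm (by linarith [h a hPa]) (py_nonneg (ha a hPa).1), neg_zero]
  · exact ((hb.2 σ p q).1 h0).le

theorem spec_of_adjacent {a b : WeightSpace} (ha : Adjacent m hm a) (hb : Adjacent m hm b)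
    (hx : ∀ j : ℕ, j ≤ m → 0 ≤ px m a - j * py a → 0 ≤ px m b - j * py b)
    (hy : py a = 0 → py b = 0) : Spec a b := fun σ p q h =>
  form_nonneg_of_adjacent m hm (P := (· = a)) hb (by rintro _ rfl; exact ha) ⟨a, rfl⟩
    (fun j hj h => hx j hj (h a rfl)) (fun h => hy (h a rfl)) σ p q (by rintro _ rfl; exact h)

theorem spec_weight {a : WeightSpace} (ha : Adjacent m hm a) : Spec a (weightM11 m hm) :=
  fun σ p q h => le_of_not_gt fun h0 => (((ha.2 σ p q).2 h0).not_ge h)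

theorem mem_cell_of_adjacent {a b : WeightSpace} (ha : Adjacent m hm a) (hb : Adjacent m hm b)
    (hx : ∀ j : ℕ, j ≤ m → SignType.sign (px m b - j * py b) = SignType.sign (px m a - j * py a))
    (hy : SignType.sign (py b) = SignType.sign (py a)) : b ∈ cell a := by
  refine ⟨hb.1, fun σ p q => ?_⟩
  rcases lt_trichotomy (form σ p q (weightM11 m hm)) 0 with h0 | h0 | h0
  · rw [sign_neg ((ha.2 σ p q).2 h0), sign_neg ((hb.2 σ p q).2 h0)]
  · rcases form_cases_of_eq_zero m hm h0 with ⟨j, hj, hf⟩ | hf | hf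
    · rw [hf, hf, hx j hj]
    · rw [hf, hf, hy]
    · rw [hf, hf, Left.sign_neg, Left.sign_neg, hy]
  · rw [sign_pos ((ha.2 σ p q).1 h0), sign_pos ((hb.2 σ p q).1 h0)]

theorem sign_px_of_mem_cell {a b : WeightSpace} (h : b ∈ cell a) {j : ℕ} (hj : j ≤ m) :
    SignType.sign (px m b - j * py b) = SignType.sign (px m a - j * py a) := by
  rw [← form_one_eq m hj, ← form_one_eq m hj, h.2]

theorem sign_py_of_mem_cell {a b : WeightSpace} (h : b ∈ cell a) :
    SignType.sign (py b) = SignType.sign (py a) := by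
  rw [← form_swap_eq, ← form_swap_eq, h.2]

open Classical in
/-- The point of the chart with coordinates `x, y > 0`. -/
noncomputable def chart (x y : ℝ) : WeightSpace :=
  if h : 0 < x ∧ 0 < y then
    WeightSpace.mk ⟨![x, y, 1], by intro i; fin_cases i <;> simp [h.1, h.2]⟩
  else weightM11 2 le_rfl

theorem rep_chart_zero {x y : ℝ} (hx : 0 < x) (hy : 0 < y) : (chart x y).rep 0 = x := by
  simp [chart, hx, hy, rep_mk]

theorem rep_chart_one {x y : ℝ} (hx : 0 < x) (hy : 0 < y) : (chart x y).rep 1 = y := by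
  simp [chart, hx, hy, rep_mk]

/-- The point at time `t` on the ray that issues from `[m, 1, 1]` in direction `d`. -/
noncomputable def ray (d : ℝ × ℝ) (t : ℝ) : WeightSpace := chart (m + t * d.1) (1 + t * d.2)

/-- The admissible directions. -/
def IsDir (d : ℝ × ℝ) : Prop := -1 ≤ d.1 ∧ d.1 ≤ m + 1 ∧ 0 ≤ d.2 ∧ d.2 ≤ 1

/-- The times at which the rays are close to `[m, 1, 1]`. -/
def IsSmall (t : ℝ) : Prop := 0 < t ∧ t * (2 * m + 4) ≤ 1

/-! ### Signs of the admissible forms along short rays from the vertex -/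

section ray

variable {m} {d : ℝ × ℝ} {t : ℝ} (hd : IsDir m d) (ht : IsSmall m t)

include hd ht in
theorem ray_bounds : -t ≤ t * d.1 ∧ t * d.1 ≤ 1 / 2 ∧ 0 ≤ t * d.2 ∧ t * d.2 ≤ t ∧ t ≤ 1 / 4 ∧
    m * t ≤ 1 / 2 - 2 * t := by
  obtain ⟨h1, h2, h3, h4⟩ := hd
  obtain ⟨h0, ht⟩ := ht
  have hmt : 0 ≤ (m : ℝ) * t := by positivity
  have := mul_le_mul_of_nonneg_left h1 h0.le
  have := mul_le_mul_of_nonneg_left h2 h0.le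
  have := mul_le_mul_of_nonneg_left h4 h0.le
  refine ⟨by linarith, by nlinarith, by positivity, by linarith, by nlinarith, by nlinarith⟩

include hm hd ht in
theorem rep_ray_zero : (ray m d t).rep 0 = m + t * d.1 := by
  have h := ray_bounds hd ht
  have : (2 : ℝ) ≤ m := by exact_mod_cast hm
  exact rep_chart_zero (by linarith) (by linarith)

include hm hd ht in
theorem rep_ray_one : (ray m d t).rep 1 = 1 + t * d.2 := by
  have h := ray_bounds hd ht
  have : (2 : ℝ) ≤ m := by exact_mod_cast hm
  exact rep_chart_one (by linarith) (by linarith)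

include hm hd ht in
theorem px_ray : px m (ray m d t) = t * d.1 := by rw [px, rep_ray_zero hm hd ht]; ring

include hm hd ht in
theorem py_ray : py (ray m d t) = t * d.2 := by rw [py, rep_ray_one hm hd ht]; ring

include hd ht in
-- Infinitely many forms must keep their signs at once. Their values at [m,1,1] are integers, so a
-- nonzero one is at least 1 in absolute value. For α₁ - (pα₂ + q), positivity forces p + q < m, so
-- at most t + mt < 1 is lost, and a negative value gains at most 1/2. The other two kinds are
-- positive only for p = q = 0.
theorem adjacent_ray : Adjacent m hm (ray m d t) := by
  have h := ray_bounds hd ht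
  have h0 := ht.1
  have h2 : (2 : ℝ) ≤ m := by exact_mod_cast hm
  refine ⟨?_, fun σ p q => ?_⟩
  · rw [mem_nablaPlus_iff, rep_ray_zero hm hd ht, rep_ray_one hm hd ht]
    constructor <;> linarith
  · rcases form_cases σ p q with ⟨p, q, hf⟩ | ⟨p, q, hf⟩ | ⟨p, q, hf⟩ <;>
      rw [hf, hf, rep_weight_zero, rep_weight_one, rep_ray_zero hm hd ht, rep_ray_one hm hd ht]
    · have hp : 0 ≤ (p : ℝ) * (t * d.2) := mul_nonneg p.cast_nonneg h.2.2.1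
      constructor
      · intro hw
        have h1 : p + q + 1 ≤ m := by
          have : (p + q : ℝ) < m := by linarith
          have : p + q < m := by exact_mod_cast this
          omega
        have h1' : (p + q + 1 : ℝ) ≤ m := by exact_mod_cast h1
        have : (p : ℝ) * (t * d.2) ≤ m * t :=
          mul_le_mul (by linarith [(q.cast_nonneg : (0 : ℝ) ≤ q)]) h.2.2.2.1 h.2.2.1
            m.cast_nonneg
        linarith
      · intro hw
        have h1 : m + 1 ≤ p + q := by
          have : (m : ℝ) < p + q := by linarith
          have : m < p + q := by exact_mod_cast this
          omega
        have h1' : (m + 1 : ℝ) ≤ p + q := by exact_mod_cast h1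
        linarith
    · have hp : (p : ℝ) * 1 ≤ p * (m + t * d.1) :=
        mul_le_mul_of_nonneg_left (by linarith) p.cast_nonneg
      have hp' : (p : ℝ) * 1 ≤ p * m := mul_le_mul_of_nonneg_left (by linarith) p.cast_nonneg
      have hq : (0 : ℝ) ≤ q := q.cast_nonneg
      constructor
      · intro hw
        have hp0 : p = 0 := by
          have : (p : ℝ) < 1 := by linarith
          exact Nat.lt_one_iff.1 (by exact_mod_cast this)
        subst hp0
        have hq0 : q = 0 := by simpa using hw
        subst hq0
        simp
        linarith
      · intro hw
        rcases Nat.eq_zero_or_pos p with rfl | hp0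
        · have : (1 : ℝ) < q := by simp at hw; exact_mod_cast hw
          have : 2 ≤ q := by exact_mod_cast this
          have : (2 : ℝ) ≤ q := by exact_mod_cast this
          simp
          linarith
        · have h1 : (1 : ℝ) ≤ p := by exact_mod_cast hp0
          have : 1 * (m + t * d.1) ≤ p * (m + t * d.1) :=
            mul_le_mul_of_nonneg_right h1 (by linarith)
          linarith
    · have hp : (p : ℝ) * 1 ≤ p * (m + t * d.1) :=
        mul_le_mul_of_nonneg_left (by linarith) p.cast_nonneg
      have hp' : (p : ℝ) * 1 ≤ p * m := mul_le_mul_of_nonneg_left (by linarith) p.cast_nonneg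
      have hq : (0 : ℝ) ≤ q := q.cast_nonneg
      have hq' : (q : ℝ) * 1 ≤ q * (1 + t * d.2) :=
        mul_le_mul_of_nonneg_left (by linarith) q.cast_nonneg
      constructor
      · intro hw
        have hp0 : p = 0 := by
          have : (p : ℝ) < 1 := by linarith
          exact Nat.lt_one_iff.1 (by exact_mod_cast this)
        subst hp0
        have hq0 : q = 0 := by simpa using hw
        subst hq0
        simp
      · intro hw
        rcases Nat.eq_zero_or_pos p with rfl | hp0
        · have : (1 : ℝ) < q := by simp at hw; exact_mod_cast hw
          simp only [CharP.cast_eq_zero, zero_mul, zero_add]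
          linarith
        · have h1 : (1 : ℝ) ≤ p := by exact_mod_cast hp0
          have : 1 * (m + t * d.1) ≤ p * (m + t * d.1) :=
            mul_le_mul_of_nonneg_right h1 (by linarith)
          linarith

include hm hd ht in
theorem sign_px_ray (j : ℕ) : SignType.sign (px m (ray m d t) - j * py (ray m d t)) =
    SignType.sign (d.1 - j * d.2) := by
  rw [px_ray hm hd ht, py_ray hm hd ht,
    show t * d.1 - j * (t * d.2) = t * (d.1 - j * d.2) by ring, sign_mul, sign_pos ht.1, one_mul]

include hm hd ht in
theorem sign_py_ray : SignType.sign (py (ray m d t)) = SignType.sign d.2 := by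
  rw [py_ray hm hd ht, sign_mul, sign_pos ht.1, one_mul]

end ray

theorem isSmall_inv : IsSmall m (1 / (2 * m + 4)) := by
  have : (0 : ℝ) < 2 * m + 4 := by positivity
  exact ⟨by positivity, by rw [one_div, inv_mul_cancel₀ this.ne']⟩

/-- The directions at `[m, 1, 1]` of the edges of `∇⁺`. -/
noncomputable def edgeDir (s : ℕ) : ℝ × ℝ :=
  if s = 0 then (-1, 0) else if s = m + 2 then (1, 0) else (s - 1, 1)

/-- Directions at `[m, 1, 1]` inside the corners of the faces of `∇⁺`. -/
noncomputable def faceDir (s : ℕ) : ℝ × ℝ := (s - 1 / 2, 1)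

theorem edgeDir_zero : edgeDir m 0 = (-1, 0) := by simp [edgeDir]

theorem edgeDir_top : edgeDir m (m + 2) = (1, 0) := by simp [edgeDir]

theorem edgeDir_succ {j : ℕ} (h : j ≤ m) : edgeDir m (j + 1) = ((j : ℝ), 1) := by
  simp [edgeDir, show j ≠ m + 1 by omega]

theorem edgeDir_cases {s : ℕ} (hs : s ≤ m + 2) :
    s = 0 ∨ s = m + 2 ∨ ∃ j ≤ m, s = j + 1 := by
  rcases Nat.eq_zero_or_pos s with h | h
  · exact .inl h
  · by_cases h' : s = m + 2
    · exact .inr (.inl h')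
    · exact .inr (.inr ⟨s - 1, by omega, by omega⟩)

theorem isDir_edgeDir {s : ℕ} (hs : s ≤ m + 2) : IsDir m (edgeDir m s) := by
  have h0 : (0 : ℝ) ≤ m := m.cast_nonneg
  rcases edgeDir_cases m hs with rfl | rfl | ⟨j, hj, rfl⟩
  · rw [edgeDir_zero]
    exact ⟨le_rfl, by linarith, le_rfl, zero_le_one⟩
  · rw [edgeDir_top]
    exact ⟨by norm_num, by linarith, le_rfl, zero_le_one⟩
  · rw [edgeDir_succ m hj]
    have h1 : (0 : ℝ) ≤ j := j.cast_nonneg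
    have h2 : (j : ℝ) ≤ m := by exact_mod_cast hj
    exact ⟨by linarith, by linarith, zero_le_one, le_rfl⟩

theorem isDir_faceDir {s : ℕ} (hs : s ≤ m + 1) : IsDir m (faceDir s) := by
  have h1 : (0 : ℝ) ≤ s := s.cast_nonneg
  have h2 : (s : ℝ) ≤ m + 1 := by exact_mod_cast hs
  exact ⟨by simp only [faceDir]; linarith, by simp only [faceDir]; linarith, zero_le_one, le_rfl⟩

/-- A point on the edge with direction `edgeDir m s`. -/
noncomputable def edgePt (s : ℕ) : WeightSpace := ray m (edgeDir m s) (1 / (2 * m + 4))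

/-- A point in the face around the direction `faceDir s`. -/
noncomputable def facePt (s : ℕ) : WeightSpace := ray m (faceDir s) (1 / (2 * m + 4))

theorem adjacent_edgePt {s : ℕ} (hs : s ≤ m + 2) : Adjacent m hm (edgePt m s) :=
  adjacent_ray hm (isDir_edgeDir m hs) (isSmall_inv m)

theorem adjacent_facePt {s : ℕ} (hs : s ≤ m + 1) : Adjacent m hm (facePt m s) :=
  adjacent_ray hm (isDir_faceDir m hs) (isSmall_inv m)

include hm in
theorem ray_mem_cell_edgePt {s : ℕ} (hs : s ≤ m + 2) {t : ℝ} (ht : IsSmall m t) :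
    ray m (edgeDir m s) t ∈ cell (edgePt m s) := by
  have hd := isDir_edgeDir m hs
  refine mem_cell_of_adjacent m hm (adjacent_edgePt m hm hs) (adjacent_ray hm hd ht)
    (fun j _ => ?_) ?_
  · rw [edgePt, sign_px_ray hm hd ht, sign_px_ray hm hd (isSmall_inv m)]
  · rw [edgePt, sign_py_ray hm hd ht, sign_py_ray hm hd (isSmall_inv m)]

section signs

variable {m}

include hm in
theorem px_edgePt_nonneg_iff {s : ℕ} (hs : s ≤ m + 2) (j : ℕ) :
    0 ≤ px m (edgePt m s) - j * py (edgePt m s) ↔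
      0 ≤ (edgeDir m s).1 - j * (edgeDir m s).2 := by
  rw [← sign_nonneg_iff, edgePt, sign_px_ray hm (isDir_edgeDir m hs) (isSmall_inv m),
    sign_nonneg_iff]

include hm in
theorem px_facePt_nonneg_iff {s : ℕ} (hs : s ≤ m + 1) (j : ℕ) :
    0 ≤ px m (facePt m s) - j * py (facePt m s) ↔ j < s := by
  rw [← sign_nonneg_iff, facePt, sign_px_ray hm (isDir_faceDir m hs) (isSmall_inv m),
    sign_nonneg_iff, faceDir]
  constructor
  · intro h
    have : (j : ℝ) < s := by simp only [mul_one] at h; linarith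
    exact_mod_cast this
  · intro h
    have : (j + 1 : ℝ) ≤ s := by exact_mod_cast h
    simp only [mul_one]
    linarith

include hm in
theorem py_edgePt_eq_zero_iff {s : ℕ} (hs : s ≤ m + 2) :
    py (edgePt m s) = 0 ↔ s = 0 ∨ s = m + 2 := by
  rw [← sign_eq_zero_iff, edgePt, sign_py_ray hm (isDir_edgeDir m hs) (isSmall_inv m),
    sign_eq_zero_iff]
  rcases edgeDir_cases m hs with rfl | rfl | ⟨j, hj, rfl⟩
  · simp [edgeDir_zero]
  · simp [edgeDir_top]
  · simp [edgeDir_succ m hj]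
    omega

include hm in
theorem py_facePt_ne_zero {s : ℕ} (hs : s ≤ m + 1) : py (facePt m s) ≠ 0 := by
  rw [Ne, ← sign_eq_zero_iff, facePt, sign_py_ray hm (isDir_faceDir m hs) (isSmall_inv m),
    sign_eq_zero_iff]
  simp [faceDir]

include hm in
-- For s ≤ m+1 this is the same condition as for the face of index s in `px_facePt_nonneg_iff`; this
-- coincidence makes the edge s and the face s have equal stabilizers for s ≥ 1.
theorem px_edgePt_nonneg_iff' {s : ℕ} (hs : s ≤ m + 2) {j : ℕ} (hj : j ≤ m) :
    0 ≤ px m (edgePt m s) - j * py (edgePt m s) ↔ j < s := by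
  rw [px_edgePt_nonneg_iff hm hs]
  rcases edgeDir_cases m hs with rfl | rfl | ⟨i, hi, rfl⟩
  · simp [edgeDir_zero]
  · simp [edgeDir_top]
    omega
  · rw [edgeDir_succ m hi]
    simp

end signs

variable {m}

include hm in
theorem edgePt_mem_cell_iff {s t : ℕ} (hs : s ≤ m + 2) (ht : t ≤ m + 2)
    (h : edgePt m s ∈ cell (edgePt m t)) : s = t := by
  have hx (j : ℕ) (hj : j ≤ m) : j < s ↔ j < t := by
    rw [← px_edgePt_nonneg_iff' hm hs hj, ← px_edgePt_nonneg_iff' hm ht hj, ← sign_nonneg_iff,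
      sign_px_of_mem_cell m h hj, sign_nonneg_iff]
  have hy : (s = 0 ∨ s = m + 2) ↔ (t = 0 ∨ t = m + 2) := by
    rw [← py_edgePt_eq_zero_iff hm hs, ← py_edgePt_eq_zero_iff hm ht, ← sign_eq_zero_iff,
      sign_py_of_mem_cell h, sign_eq_zero_iff]
  have h0 := hx 0 m.zero_le
  by_contra hne
  rcases Nat.lt_or_gt_of_ne hne with hlt | hlt
  · have := hx s
    omega
  · have := hx t
    omega

include hm in
theorem facePt_mem_cell_iff {s t : ℕ} (hs : s ≤ m + 1) (ht : t ≤ m + 1)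
    (h : facePt m s ∈ cell (facePt m t)) : s = t := by
  have hx (j : ℕ) (hj : j ≤ m) : j < s ↔ j < t := by
    rw [← px_facePt_nonneg_iff hm hs, ← px_facePt_nonneg_iff hm ht, ← sign_nonneg_iff,
      sign_px_of_mem_cell m h hj, sign_nonneg_iff]
  by_contra hne
  rcases Nat.lt_or_gt_of_ne hne with hlt | hlt
  · have := hx s
    omega
  · have := hx t
    omega

include hm in
-- The case s = 0 is excluded because -y is nonnegative on edge 0 but negative in face 0.
theorem spec_edgePt_facePt {s : ℕ} (h1 : 1 ≤ s) (hs : s ≤ m + 1) :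
    Spec (edgePt m s) (facePt m s) := by
  refine spec_of_adjacent m hm (adjacent_edgePt m hm (by omega)) (adjacent_facePt m hm hs)
    (fun j hj => ?_) fun h => ?_
  · rw [px_edgePt_nonneg_iff' hm (by omega) hj, px_facePt_nonneg_iff hm hs]
    exact id
  · rw [py_edgePt_eq_zero_iff hm (by omega)] at h
    omega

include hm in
theorem spec_facePt_edgePt {s : ℕ} (hs : s ≤ m + 1) : Spec (facePt m s) (edgePt m s) := by
  refine spec_of_adjacent m hm (adjacent_facePt m hm hs) (adjacent_edgePt m hm (by omega))
    (fun j hj => ?_) fun h => absurd h (py_facePt_ne_zero hm hs)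
  rw [px_edgePt_nonneg_iff' hm (by omega) hj, px_facePt_nonneg_iff hm hs]
  exact id

include hm in
theorem spec_facePt_edgePt_succ {s : ℕ} (hs : s ≤ m + 1) :
    Spec (facePt m s) (edgePt m (s + 1)) := by
  refine spec_of_adjacent m hm (adjacent_facePt m hm hs) (adjacent_edgePt m hm (by omega))
    (fun j hj => ?_) fun h => absurd h (py_facePt_ne_zero hm hs)
  rw [px_edgePt_nonneg_iff' hm (by omega) hj, px_facePt_nonneg_iff hm hs]
  omega

include hm in
-- Edge 0 rules out every x - j·y, and edge m+1 rules out -y. Among the forms vanishing at the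
-- vertex only y survives both conditions.
theorem form_facePt_zero_nonneg (σ : Equiv.Perm (Fin 3)) (p q : ℕ)
    (h0 : 0 ≤ form σ p q (edgePt m 0)) (h1 : 0 ≤ form σ p q (edgePt m (m + 1))) :
    0 ≤ form σ p q (facePt m 0) := by
  refine form_nonneg_of_adjacent m hm (P := fun a => a = edgePt m 0 ∨ a = edgePt m (m + 1))
    (adjacent_facePt m hm (by omega)) ?_ ⟨_, .inl rfl⟩ (fun j hj h => ?_) (fun h => ?_) σ p q ?_
  · rintro _ (rfl | rfl)
    · exact adjacent_edgePt m hm (by omega)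
    · exact adjacent_edgePt m hm (by omega)
  · have := h _ (.inl rfl)
    rw [px_edgePt_nonneg_iff' hm (by omega) hj] at this
    omega
  · have := h _ (.inr rfl)
    rw [py_edgePt_eq_zero_iff hm (by omega)] at this
    omega
  · rintro _ (rfl | rfl)
    · exact h0
    · exact h1

/-- The vertex `[m, 1, 1]` lies on two admissible lines. -/
theorem weight_mem_nablaVertices : weightM11 m hm ∈ nablaVertices := by
  refine ⟨_, line_mem (Equiv.swap 0 1) 0 1, _, line_mem 1 0 m, fun h => ?_,
    ⟨weight_mem_nablaPlus m hm, ?_⟩, ⟨weight_mem_nablaPlus m hm, ?_⟩⟩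
  · have h2 : (0 : ℝ) < m + 1 := by positivity
    have hc : chart (m + 1) 1 ∈ line 1 0 m := by
      rw [← h]
      refine ⟨?_, ?_⟩
      · rw [mem_nablaPlus_iff, rep_chart_zero h2 one_pos, rep_chart_one h2 one_pos]
        exact ⟨by linarith [(m.cast_nonneg : (0 : ℝ) ≤ m)], le_rfl⟩
      · rw [form_swap_eq, py, rep_chart_one h2 one_pos, sub_self]
    have := hc.2
    rw [form_one, rep_chart_zero h2 one_pos] at this
    simp at this
  · rw [form_swap_eq, py, rep_weight_one, sub_self]
  · rw [form_one, rep_weight_zero]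
    simp

theorem eq_weight_of_px_py {a : WeightSpace} (hx : px m a = 0) (hy : py a = 0) :
    a = weightM11 m hm := by
  refine rep_injective fun i => ?_
  fin_cases i
  · exact (sub_eq_zero.1 hx).trans (rep_weight_zero m hm).symm
  · exact (sub_eq_zero.1 hy).trans (rep_weight_one m hm).symm
  · exact (rep_two _).trans (rep_two _).symm

theorem edgePt_mem_cell_of {a : WeightSpace} (ha : Adjacent m hm a) {s : ℕ} (hs : s ≤ m + 2)
    (hx : ∀ j : ℕ, j ≤ m → SignType.sign (px m a - j * py a) =
      SignType.sign ((edgeDir m s).1 - j * (edgeDir m s).2))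
    (hy : SignType.sign (py a) = SignType.sign (edgeDir m s).2) : cell a = cell (edgePt m s) := by
  refine cell_eq_of_mem (mem_cell_of_adjacent m hm (adjacent_edgePt m hm hs) ha (fun j hj => ?_) ?_)
  · rw [hx j hj, edgePt, sign_px_ray hm (isDir_edgeDir m hs) (isSmall_inv m)]
  · rw [hy, edgePt, sign_py_ray hm (isDir_edgeDir m hs) (isSmall_inv m)]

theorem IsNablaEdge.eq_cell_edgePt {E : Set WeightSpace} (h : IsNablaEdge E)
    (hw : weightM11 m hm ∈ closure E) : ∃ s ≤ m + 2, E = cell (edgePt m s) := by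
  obtain ⟨a, ha, hav, ⟨σ, p, q, h0⟩, rfl⟩ := h.exists_cell
  have had := adjacent_of_mem_closure m hm ha hw
  have hw0 : form σ p q (weightM11 m hm) = 0 := by
    rcases lt_trichotomy (form σ p q (weightM11 m hm)) 0 with h1 | h1 | h1
    · exact absurd h0 ((had.2 σ p q).2 h1).ne
    · exact h1
    · exact absurd h0 ((had.2 σ p q).1 h1).ne'
  rcases (py_nonneg ha).eq_or_lt with hy | hy
  · rcases lt_trichotomy (px m a) 0 with hx | hx | hx
    · refine ⟨0, by omega, edgePt_mem_cell_of hm had (by omega) (fun j _ => ?_) ?_⟩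
      · rw [← hy, edgeDir_zero]
        simp [hx]
      · rw [← hy, edgeDir_zero]
    · exact absurd (eq_weight_of_px_py hm hx hy.symm ▸ weight_mem_nablaVertices hm) hav
    · refine ⟨m + 2, le_rfl, edgePt_mem_cell_of hm had le_rfl (fun j _ => ?_) ?_⟩
      · rw [← hy, edgeDir_top]
        simp [hx]
      · rw [← hy, edgeDir_top]
  · rcases form_cases_of_eq_zero m hm hw0 with ⟨i, hi, hf⟩ | hf | hf
    · rw [hf, sub_eq_zero] at h0
      refine ⟨i + 1, by omega, edgePt_mem_cell_of hm had (by omega) (fun j _ => ?_) ?_⟩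
      · rw [h0, edgeDir_succ m hi, ← sub_mul, sign_mul, sign_pos hy]
        simp
      · rw [edgeDir_succ m hi, sign_pos hy, sign_one]
    · rw [hf] at h0
      exact absurd h0 hy.ne'
    · rw [hf, neg_eq_zero] at h0
      exact absurd h0 hy.ne'

theorem IsNablaFace.eq_cell_facePt {C : Set WeightSpace} (h : IsNablaFace C)
    (hw : weightM11 m hm ∈ closure C) : ∃ s ≤ m + 1, C = cell (facePt m s) := by
  obtain ⟨a, ha, h0, rfl⟩ := h.exists_cell
  have had := adjacent_of_mem_closure m hm ha hw
  have hy : 0 < py a := by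
    refine (py_nonneg ha).lt_of_ne fun h => h0 (Equiv.swap 0 1) 0 1 ?_
    rw [form_swap_eq, ← h]
  have hx (j : ℕ) (hj : j ≤ m) : px m a - j * py a ≠ 0 := by
    rw [← form_one_eq m hj]
    exact h0 _ _ _
  -- The index of the face is the first j with x - j·y < 0, and m+1 if there is none among 0, …, m.
  have hex : ∃ s : ℕ, s = m + 1 ∨ px m a - s * py a < 0 := ⟨m + 1, .inl rfl⟩
  classical
  have hs : Nat.find hex ≤ m + 1 := Nat.find_min' hex (.inl rfl)
  refine ⟨Nat.find hex, hs, cell_eq_of_mem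
    (mem_cell_of_adjacent m hm (adjacent_facePt m hm hs) had (fun j hj => ?_) ?_)⟩
  · have hiff : 0 ≤ px m a - j * py a ↔ j < Nat.find hex := by
      constructor
      · intro h
        by_contra hlt
        have hle : (Nat.find hex : ℝ) ≤ j := by exact_mod_cast not_lt.1 hlt
        rcases Nat.find_spec hex with h1 | h1
        · omega
        · have := mul_le_mul_of_nonneg_right hle hy.le
          linarith
      · intro h
        have := Nat.find_min hex h
        push Not at this
        exact this.2
    rw [← px_facePt_nonneg_iff hm hs] at hiff
    have hne : px m (facePt m (Nat.find hex)) - j * py (facePt m (Nat.find hex)) ≠ 0 := by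
      rw [Ne, ← sign_eq_zero_iff, facePt, sign_px_ray hm (isDir_faceDir m hs) (isSmall_inv m),
        sign_eq_zero_iff, faceDir]
      intro h
      have h' : (2 * Nat.find hex : ℝ) = 2 * j + 1 := by
        simp only [mul_one] at h
        linarith
      have : 2 * Nat.find hex = 2 * j + 1 := by exact_mod_cast h'
      omega
    rcases (hx j hj).lt_or_gt with h1 | h1
    · rw [sign_neg h1, sign_neg (lt_of_not_ge fun h2 => (hiff.2 h2).not_gt h1)]
    · rw [sign_pos h1, sign_pos ((hiff.1 h1.le).lt_of_ne' hne)]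
  · rw [sign_pos hy, sign_pos ((py_nonneg (adjacent_facePt m hm hs).1).lt_of_ne'
      (py_facePt_ne_zero hm hs))]

include hm in
theorem eq_or_eq_succ_of_cell_subset_closure {s t : ℕ} (hs : s ≤ m + 1) (ht : t ≤ m + 2)
    (h : cell (edgePt m t) ⊆ closure (cell (facePt m s))) : t = s ∨ t = s + 1 := by
  have hmem := h (mem_cell_self (adjacent_edgePt m hm ht).1)
  have h1 (j : ℕ) (hj : j ≤ m) (hjs : j < s) : j < t := by
    rw [← px_edgePt_nonneg_iff' hm ht hj, ← form_one_eq m hj]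
    refine form_nonneg_of_mem_closure hmem ?_
    rwa [form_one_eq m hj, px_facePt_nonneg_iff hm hs]
  have h2 (j : ℕ) (hj : j ≤ m) (hjs : s ≤ j) :
      (edgeDir m t).1 - j * (edgeDir m t).2 ≤ 0 := by
    rw [← sign_nonpos_iff, ← sign_px_ray hm (isDir_edgeDir m ht) (isSmall_inv m),
      sign_nonpos_iff, ← form_one_eq m hj]
    refine form_nonpos_of_mem_closure hmem ?_
    rw [form_one_eq m hj]
    exact le_of_not_ge fun h => hjs.not_gt ((px_facePt_nonneg_iff hm hs j).1 h)
  by_contra hne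
  rcases edgeDir_cases m ht with rfl | rfl | ⟨i, hi, rfl⟩
  · have := h1 0
    omega
  · have := h2 m le_rfl (by omega)
    rw [edgeDir_top] at this
    norm_num at this
  · rcases Nat.lt_or_ge (i + 1) s with hlt | hge
    · have := h1 (i + 1)
      omega
    · have := h2 (i - 1) (by omega) (by omega)
      rw [edgeDir_succ m hi, Nat.cast_sub (by omega)] at this
      norm_num at this

end TameX

namespace TameX
open Filter Topology MvPolynomial

/-! ### Monomial filtrations and the stabilizers of the points of `𝐗` -/

/-- The weight of a monomial. -/
def wt (α : Fin 3 → ℝ) (n : Fin 3 →₀ ℕ) : ℝ := ∑ i, α i * n i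

theorem wt_add (α : Fin 3 → ℝ) (n n' : Fin 3 →₀ ℕ) : wt α (n + n') = wt α n + wt α n' := by
  simp only [wt, ← Finset.sum_add_distrib, Finsupp.add_apply, Nat.cast_add, mul_add]

theorem wt_single (α : Fin 3 → ℝ) (i : Fin 3) (c : ℕ) : wt α (Finsupp.single i c) = α i * c := by
  classical
  rw [wt, Finset.sum_eq_single i]
  · simp
  · intro j _ hj
    simp [hj.symm]
  · simp

theorem le_wt {α : Fin 3 → ℝ} (hα : ∀ i, 0 < α i) (n : Fin 3 →₀ ℕ) (i : Fin 3) :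
    α i * n i ≤ wt α n :=
  Finset.single_le_sum (f := fun i => α i * (n i : ℝ))
    (fun j _ => mul_nonneg (hα j).le (n j).cast_nonneg) (Finset.mem_univ i)

variable (k : Type*) [Field k]

/-- The polynomials of weighted degree at most `t`. -/
noncomputable def filt (α : Fin 3 → ℝ) (t : ℝ) : Submodule k (Poly k) := restrictSupport k {n | wt α n ≤ t}

variable {k}

theorem mem_filt {α : Fin 3 → ℝ} {t : ℝ} {P : Poly k} :
    P ∈ filt k α t ↔ ∀ n ∈ P.support, wt α n ≤ t := Iff.rfl

theorem mem_filt_iff_nuId (α : PosTriple) (t : ℝ) (P : Poly k) :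
    P ∈ filt k α.1 t ↔ ((-t : ℝ) : WithTop ℝ) ≤ nuId α P := by
  simp only [mem_filt, nuId, Finset.le_inf_iff, WithTop.coe_le_coe, neg_le_neg_iff, wt]

theorem filt_mono {α : Fin 3 → ℝ} {s t : ℝ} (h : s ≤ t) : filt k α s ≤ filt k α t :=
  fun _ hP _ hn => (hP hn).trans h

theorem filt_mul {α : Fin 3 → ℝ} {s t : ℝ} {P Q : Poly k} (hP : P ∈ filt k α s)
    (hQ : Q ∈ filt k α t) : P * Q ∈ filt k α (s + t) := by
  classical
  intro n hn
  obtain ⟨a, ha, b, hb, rfl⟩ := Finset.mem_add.1 (support_mul P Q hn)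
  rw [Set.mem_ofPred_eq, wt_add]
  exact add_le_add (hP ha) (hQ hb)

theorem monomial_mem_filt {α : Fin 3 → ℝ} {t : ℝ} {n : Fin 3 →₀ ℕ} (h : wt α n ≤ t) (c : k) :
    monomial n c ∈ filt k α t := (monomial_mem_restrictSupport _).2 (.inl h)

theorem C_mem_filt (α : Fin 3 → ℝ) (c : k) : C c ∈ filt k α 0 :=
  monomial_mem_filt (by simp [wt]) c

theorem X_mem_filt_iff {α : Fin 3 → ℝ} {t : ℝ} (i : Fin 3) :
    (MvPolynomial.X i : Poly k) ∈ filt k α t ↔ α i ≤ t := by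
  rw [mem_filt, support_X]
  simp [wt_single]

theorem filt_pow {α : Fin 3 → ℝ} {s : ℝ} {P : Poly k} (hP : P ∈ filt k α s) (n : ℕ) :
    P ^ n ∈ filt k α (s * n) := by
  induction n with
  | zero =>
    rw [pow_zero, Nat.cast_zero, mul_zero, ← C_1]
    exact C_mem_filt α 1
  | succ n ih =>
    rw [pow_succ, Nat.cast_succ, mul_add, mul_one]
    exact filt_mul ih hP

theorem algEquiv_monomial (u : Poly k ≃ₐ[k] Poly k) (n : Fin 3 →₀ ℕ) (c : k) :
    u (monomial n c) = C c * ∏ i, u (MvPolynomial.X i) ^ n i := by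
  rw [monomial_eq, map_mul, map_finsuppProd]
  congr 1
  · exact u.commutes c
  · rw [Finsupp.prod_fintype _ _ fun i => by simp]
    simp only [map_pow]

theorem map_mem_filt {α : Fin 3 → ℝ} {u : Poly k ≃ₐ[k] Poly k}
    (hu : ∀ i, u (MvPolynomial.X i) ∈ filt k α (α i)) {t : ℝ} {P : Poly k} (hP : P ∈ filt k α t) :
    u P ∈ filt k α t := by
  rw [P.as_sum, map_sum]
  refine Submodule.sum_mem _ fun n hn => ?_
  rw [algEquiv_monomial, Fin.prod_univ_three]
  refine filt_mono (hP hn) ?_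
  have := filt_mul (C_mem_filt α (coeff n P)) (filt_mul (filt_mul (filt_pow (hu 0) (n 0))
    (filt_pow (hu 1) (n 1))) (filt_pow (hu 2) (n 2)))
  rwa [zero_add, ← Fin.sum_univ_three (f := fun i => α i * (n i : ℝ))] at this

theorem finiteDimensional_filt {α : Fin 3 → ℝ} (hα : ∀ i, 0 < α i) (t : ℝ) :
    FiniteDimensional k (filt k α t) := by
  have hfin : {n : Fin 3 →₀ ℕ | wt α n ≤ t}.Finite := by
    obtain ⟨N, hN⟩ : ∃ N : ℕ, ∀ i, t / α i ≤ N := by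
      refine ⟨⌈∑ i, |t / α i|⌉₊, fun i => ?_⟩
      exact (le_abs_self _).trans ((Finset.single_le_sum (f := fun i => |t / α i|)
        (fun j _ => abs_nonneg _) (Finset.mem_univ i)).trans (Nat.le_ceil _))
    refine (Set.finite_Iic (Finsupp.equivFunOnFinite.symm fun _ => N)).subset fun n hn i => ?_
    have h1 := (le_wt hα n i).trans hn
    rw [mul_comm, ← le_div_iff₀ (hα i)] at h1
    exact_mod_cast h1.trans (hN i)
  have := hfin.to_subtype
  exact Module.Finite.of_basis (basisRestrictSupport k {n : Fin 3 →₀ ℕ | wt α n ≤ t})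

/-- Positive weights make each step of the filtration finite-dimensional, so the injective map `u`
of a step into itself is onto. Nothing has to be known about the components of the inverse. -/
theorem map_mem_filt_iff {α : Fin 3 → ℝ} (hα : ∀ i, 0 < α i) {u : Poly k ≃ₐ[k] Poly k}
    (hu : ∀ i, u (MvPolynomial.X i) ∈ filt k α (α i)) {t : ℝ} {P : Poly k} :
    u P ∈ filt k α t ↔ P ∈ filt k α t := by
  refine ⟨fun h => ?_, map_mem_filt hu⟩
  have := finiteDimensional_filt (k := k) hα t
  let φ : filt k α t →ₗ[k] filt k α t :=
    u.toLinearMap.restrict fun P hP => map_mem_filt hu hP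
  have hφ : Function.Injective φ := fun P Q hPQ =>
    Subtype.ext (u.injective (congrArg Subtype.val hPQ))
  obtain ⟨Q, hQ⟩ := LinearMap.injective_iff_surjective.1 hφ ⟨u P, h⟩
  have : u Q.1 = u P := congrArg Subtype.val hQ
  rw [← u.injective this]
  exact Q.2

/-- A monomial of β-weight at most α_i < β_i cannot involve x_j for j ≤ i, since β_j ≥ β_i there; on
the remaining variables both weights agree. The variable x_i makes the inclusion strict. Starting
from the smallest weight, this recovers a decreasing weight from the dimensions of its filtration.
-/
theorem filt_lt_of_lt {α β : Fin 3 → ℝ} (hβ : ∀ i, 0 < β i) {i : Fin 3}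
    (heq : ∀ j, i < j → α j = β j) (hlt : α i < β i) (hle : ∀ j < i, β i ≤ β j) :
    filt k β (α i) < filt k α (α i) := by
  refine lt_of_le_of_ne (fun P hP n hn => ?_) fun h => ?_
  · have hn' : wt β n ≤ α i := hP hn
    have h0 (j : Fin 3) (hj : j ≤ i) : n j = 0 := by
      by_contra h0
      have h1 : (1 : ℝ) ≤ n j := by exact_mod_cast Nat.one_le_iff_ne_zero.2 h0
      have h2 : β i ≤ β j := by
        rcases hj.eq_or_lt with rfl | hj
        · exact le_rfl
        · exact hle j hj
      have h3 := le_wt hβ n j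
      have h4 := mul_le_mul_of_nonneg_left h1 (hβ j).le
      linarith
    have : wt α n = wt β n := Finset.sum_congr rfl fun j _ => by
      rcases lt_or_ge i j with hj | hj
      · rw [heq j hj]
      · simp [h0 j hj]
    rw [Set.mem_ofPred_eq, this]
    exact hn'
  · have := (X_mem_filt_iff (k := k) (α := α) i).2 le_rfl
    rw [← h, X_mem_filt_iff] at this
    exact hlt.not_ge this

theorem eq_of_finrank_filt_eq {α β : Fin 3 → ℝ} (hα : ∀ i, 0 < α i) (hβ : ∀ i, 0 < β i)
    (hα' : Antitone α) (hβ' : Antitone β)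
    (h : ∀ t, Module.finrank k (filt k α t) = Module.finrank k (filt k β t)) : α = β := by
  have key : ∀ (i : Fin 3), (∀ j, i < j → α j = β j) → α i = β i := by
    intro i hi
    rcases lt_trichotomy (α i) (β i) with hlt | heq | hlt
    · have := finiteDimensional_filt (k := k) hα (α i)
      exact absurd (h (α i)) (Submodule.finrank_lt_finrank_of_lt
        (filt_lt_of_lt hβ hi hlt fun j hj => hβ' hj.le)).ne'
    · exact heq
    · have := finiteDimensional_filt (k := k) hβ (β i)
      exact absurd (h (β i)) (Submodule.finrank_lt_finrank_of_lt
        (filt_lt_of_lt hα (fun j hj => (hi j hj).symm) hlt fun j hj => hα' hj.le)).ne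
  have h2 := key 2 fun j hj => by omega
  have h1 := key 1 fun j hj => by
    obtain rfl : j = 2 := by omega
    exact h2
  have h0 := key 0 fun j hj => by
    obtain rfl | rfl : j = 1 ∨ j = 2 := by omega
    · exact h1
    · exact h2
  funext j
  fin_cases j
  · exact h0
  · exact h1
  · exact h2

theorem antitone_rep {a : WeightSpace} (ha : a ∈ nablaPlus) : Antitone a.rep := by
  rw [mem_nablaPlus_iff] at ha
  refine Fin.antitone_iff_succ_le.2 fun i => ?_
  fin_cases i
  · exact ha.1
  · simpa using ha.2

theorem filt_mul_left {α : Fin 3 → ℝ} {c : ℝ} (hc : 0 < c) (t : ℝ) :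
    filt k (fun i => c * α i) (c * t) = filt k α t := by
  ext P
  simp only [mem_filt]
  refine forall₂_congr fun n _ => ?_
  have : wt (fun i => c * α i) n = c * wt α n := by
    simp only [wt, Finset.mul_sum, mul_assoc]
  rw [this, mul_le_mul_iff_right₀ hc]

theorem pt_eq_pt_iff_exists (f g : Tame k) (a b : WeightSpace) :
    pt f a = pt g b ↔ ∃ c : ℝ, 0 < c ∧ ∀ P, nuId b.triple (g.1 P) =
      (nuId a.triple (f.1 P)).map (c * ·) := by
  conv_lhs => rw [← mk_triple a, ← mk_triple b]
  exact Subtype.ext_iff.trans (Quotient.eq (r := valSetoid k))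

theorem neg_coe_le_map_iff {c : ℝ} (hc : 0 < c) (t : ℝ) (x : WithTop ℝ) :
    ((-(c * t) : ℝ) : WithTop ℝ) ≤ x.map (c * ·) ↔ ((-t : ℝ) : WithTop ℝ) ≤ x := by
  cases x with
  | top => simp
  | coe x =>
    rw [WithTop.map_coe, WithTop.coe_le_coe, WithTop.coe_le_coe, ← mul_neg,
      mul_le_mul_iff_right₀ hc]

/-- This makes the folding map from 𝐗 to ∇⁺ well defined. The automorphism `f.1.symm.trans g.1`
carries the filtration of `a` onto that of `b`, up to the scaling `c`, so the dimensions agree and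
determine the weights; the last coordinate 1 on both sides forces `c = 1`. -/
theorem eq_of_pt_eq_pt {f g : Tame k} {a b : WeightSpace} (ha : a ∈ nablaPlus)
    (hb : b ∈ nablaPlus) (h : pt f a = pt g b) :
    a = b ∧ ∀ P t, f.1 P ∈ filt k a.rep t ↔ g.1 P ∈ filt k a.rep t := by
  obtain ⟨c, hc, h⟩ := (pt_eq_pt_iff_exists f g a b).1 h
  have hP (P : Poly k) (t : ℝ) : f.1 P ∈ filt k a.rep t ↔ g.1 P ∈ filt k b.rep (c * t) := by
    rw [← show a.triple.1 = a.rep from rfl, ← show b.triple.1 = b.rep from rfl,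
      mem_filt_iff_nuId, mem_filt_iff_nuId, h, neg_coe_le_map_iff hc]
  have hrank (t : ℝ) : Module.finrank k (filt k (fun i => c * a.rep i) t) =
      Module.finrank k (filt k b.rep t) := by
    obtain ⟨s, rfl⟩ : ∃ s, t = c * s := ⟨c⁻¹ * t, by rw [mul_inv_cancel_left₀ hc.ne']⟩
    rw [filt_mul_left hc]
    have hmap : (filt k a.rep s).map ((f.1.symm.trans g.1).toLinearEquiv : Poly k →ₗ[k] Poly k) =
        filt k b.rep (c * s) := by
      ext Q
      constructor
      · rintro ⟨P, hPs, rfl⟩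
        refine (hP (f.1.symm P) s).1 ?_
        simpa using hPs
      · intro hQ
        refine ⟨f.1 (g.1.symm Q), (hP _ _).2 (by simpa using hQ), by simp⟩
    rw [← hmap]
    exact ((f.1.symm.trans g.1).toLinearEquiv.submoduleMap (filt k a.rep s)).finrank_eq
  have heq := eq_of_finrank_filt_eq (fun i => mul_pos hc (rep_pos a i)) (rep_pos b)
    (fun i j hij => mul_le_mul_of_nonneg_left (antitone_rep ha hij) hc.le) (antitone_rep hb) hrank
  have hc1 : c = 1 := by simpa using congrFun heq 2
  subst hc1
  have hab : a = b := rep_injective fun i => by simpa using congrFun heq i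
  subst hab
  exact ⟨rfl, fun P t => by simpa using hP P t⟩

/-- The condition on the components of `u` that describes the stabilizer of `ν_{id,a}`. -/
def Fixes (u : Tame k) (a : WeightSpace) : Prop := ∀ i, u.1 (MvPolynomial.X i) ∈ filt k a.rep (a.rep i)

theorem pt_eq_pt_iff {f g : Tame k} {a : WeightSpace} (ha : a ∈ nablaPlus) :
    pt f a = pt g a ↔ Fixes (g * f⁻¹) a := by
  constructor
  · intro h i
    obtain ⟨-, h⟩ := eq_of_pt_eq_pt ha ha h
    have := (h (f.1⁻¹ (MvPolynomial.X i)) (a.rep i)).1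
    refine this ?_
    rw [← AlgEquiv.mul_apply, mul_inv_cancel, AlgEquiv.one_apply]
    exact (X_mem_filt_iff i).2 le_rfl
  · intro h
    refine (pt_eq_pt_iff_exists f g a a).2 ⟨1, one_pos, fun P => ?_⟩
    have hfg (t : ℝ) : g.1 P ∈ filt k a.rep t ↔ f.1 P ∈ filt k a.rep t := by
      have := map_mem_filt_iff (t := t) (P := f.1 P) (rep_pos a) h
      simpa using this
    have hle (t : ℝ) : ((t : ℝ) : WithTop ℝ) ≤ nuId a.triple (g.1 P) ↔
        (t : WithTop ℝ) ≤ nuId a.triple (f.1 P) := by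
      have := hfg (-t)
      rwa [← show a.triple.1 = a.rep from rfl, mem_filt_iff_nuId, mem_filt_iff_nuId,
        neg_neg] at this
    have hid : ((1 : ℝ) * ·) = (id : ℝ → ℝ) := funext one_mul
    rw [hid, WithTop.map_id, id]
    generalize nuId a.triple (g.1 P) = x at hle
    generalize nuId a.triple (f.1 P) = y at hle
    exact WithTop.eq_of_forall_coe_le_iff hle

theorem Fixes.mul {u v : Tame k} {a : WeightSpace} (hu : Fixes u a) (hv : Fixes v a) :
    Fixes (u * v) a := fun i => map_mem_filt hu (hv i)

/-- The bridge from geometry to algebra: the exponents of a monomial free of x_i are the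
coefficients p, q of an admissible form. A monomial that involves x_i and is not x_i itself is
already too heavy. -/
theorem wt_le_iff (a : WeightSpace) (i : Fin 3) (n : Fin 3 →₀ ℕ) :
    wt a.rep n ≤ a.rep i ↔ n = Finsupp.single i 1 ∨ n i = 0 ∧
      0 ≤ form (Equiv.swap 0 i) (n (Equiv.swap 0 i 1)) (n (Equiv.swap 0 i 2)) a := by
  have hsum : wt a.rep n = a.rep i * n i + (a.rep (Equiv.swap 0 i 1) * n (Equiv.swap 0 i 1) +
      a.rep (Equiv.swap 0 i 2) * n (Equiv.swap 0 i 2)) := by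
    rw [wt, ← Equiv.sum_comp (Equiv.swap 0 i), Fin.sum_univ_three, Equiv.swap_apply_left, add_assoc]
  have h1 := rep_pos a (Equiv.swap 0 i 1)
  have h2 := rep_pos a (Equiv.swap 0 i 2)
  have hi := rep_pos a i
  have hform : form (Equiv.swap 0 i) (n (Equiv.swap 0 i 1)) (n (Equiv.swap 0 i 2)) a =
      a.rep i * (1 + n i) - wt a.rep n := by
    rw [hsum, form, Equiv.swap_apply_left]
    ring
  rw [hform]
  constructor
  · intro h
    rcases Nat.eq_zero_or_pos (n i) with h0 | h0
    · right
      refine ⟨h0, ?_⟩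
      rw [h0, Nat.cast_zero, add_zero, mul_one]
      linarith
    · left
      have hn1 : (1 : ℝ) ≤ n i := by exact_mod_cast h0
      have := mul_le_mul_of_nonneg_left hn1 hi.le
      have e1 : 0 ≤ a.rep (Equiv.swap 0 i 1) * n (Equiv.swap 0 i 1) := by positivity
      have e2 : 0 ≤ a.rep (Equiv.swap 0 i 2) * n (Equiv.swap 0 i 2) := by positivity
      have z1 : n (Equiv.swap 0 i 1) = 0 := by
        have : a.rep (Equiv.swap 0 i 1) * n (Equiv.swap 0 i 1) = 0 := by linarith
        simpa [h1.ne'] using this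
      have z2 : n (Equiv.swap 0 i 2) = 0 := by
        have : a.rep (Equiv.swap 0 i 2) * n (Equiv.swap 0 i 2) = 0 := by linarith
        simpa [h2.ne'] using this
      have z0 : n i = 1 := by
        have : a.rep i * n i ≤ a.rep i * 1 := by linarith
        have : (n i : ℝ) ≤ 1 := le_of_mul_le_mul_left this hi
        have : n i ≤ 1 := by exact_mod_cast this
        omega
      ext j
      obtain ⟨j, rfl⟩ := (Equiv.swap 0 i).surjective j
      fin_cases j
      · simp [Equiv.swap_apply_left, z0]
      · change n (Equiv.swap 0 i 1) = _
        rw [z1, eq_comm, Finsupp.single_apply, if_neg]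
        intro h
        have := (Equiv.swap 0 i).injective ((Equiv.swap_apply_left 0 i).trans h)
        simp at this
      · change n (Equiv.swap 0 i 2) = _
        rw [z2, eq_comm, Finsupp.single_apply, if_neg]
        intro h
        have := (Equiv.swap 0 i).injective ((Equiv.swap_apply_left 0 i).trans h)
        simp at this
  · rintro (rfl | ⟨h0, h⟩)
    · simp [wt_single]
    · rw [h0, Nat.cast_zero, add_zero, mul_one] at h
      linarith

theorem Fixes.of_forms {u : Tame k} {P : WeightSpace → Prop} {b : WeightSpace} {a₀ : WeightSpace}
    (ha₀ : P a₀) (hu : ∀ a, P a → Fixes u a)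
    (h : ∀ σ p q, (∀ a, P a → 0 ≤ form σ p q a) → 0 ≤ form σ p q b) : Fixes u b := by
  intro i n hn
  have hmem (a : WeightSpace) (ha : P a) := (wt_le_iff a i n).1 (hu a ha i hn)
  refine (wt_le_iff b i n).2 ?_
  by_cases hs : n = Finsupp.single i 1
  · exact .inl hs
  · have hP (a : WeightSpace) (ha : P a) := (hmem a ha).resolve_left hs
    exact .inr ⟨(hP a₀ ha₀).1, h _ _ _ fun a ha => (hP a ha).2⟩

theorem Fixes.of_spec {u : Tame k} {a b : WeightSpace} (hu : Fixes u a) (h : Spec a b) :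
    Fixes u b :=
  Fixes.of_forms (P := (· = a)) rfl (by rintro _ rfl; exact hu) fun σ p q h0 => h σ p q (h0 a rfl)

theorem pt_eq_pt_of_spec {f g : Tame k} {a b : WeightSpace} (ha : a ∈ nablaPlus)
    (hb : b ∈ nablaPlus) (hs : Spec a b) (h : pt f a = pt g a) : pt f b = pt g b :=
  (pt_eq_pt_iff hb).2 (((pt_eq_pt_iff ha).1 h).of_spec hs)

theorem spec_of_mem_cell {a b : WeightSpace} (h : b ∈ cell a) : Spec a b := fun σ p q h0 => by
  rwa [← sign_nonneg_iff, h.2, sign_nonneg_iff]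

/-- Stabilizers are constant along a cell, so the copy of a cell in 𝐗 is determined by any one of
its points. -/
theorem image_cell_eq_iff {f g : Tame k} {a b : WeightSpace} (ha : a ∈ nablaPlus) :
    pt f '' cell a = pt g '' cell b ↔ a ∈ cell b ∧ pt f a = pt g a := by
  constructor
  · intro h
    obtain ⟨c, hc, hca⟩ := h.subset ⟨a, mem_cell_self ha, rfl⟩
    obtain ⟨rfl, -⟩ := eq_of_pt_eq_pt hc.1 ha hca
    exact ⟨hc, hca.symm⟩
  · rintro ⟨hab, h⟩
    rw [← cell_eq_of_mem hab]
    exact Set.image_congr fun c hc => pt_eq_pt_of_spec ha hc.1 (spec_of_mem_cell hc) h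

end TameX

namespace TameX
open Filter Topology

/-! ### Distances and angles in `𝐗` -/

section

variable {k : Type*} [Field k]

/-- Folding a chain into ∇⁺ keeps the length of each of its links, and the triangle inequality in ∇⁺
does the rest. -/
theorem dist_le_of_chain {x y : X k} {l : ℝ} (h : ChainOfLength x y l) :
    ∀ {f g : Tame k} {a b : WeightSpace}, a ∈ nablaPlus → b ∈ nablaPlus →
      x = pt f a → y = pt g b → dist a b ≤ l := by
  induction h with
  | single f a b ha hb =>
    intro f' g' a' b' ha' hb' hx hy
    rw [(eq_of_pt_eq_pt ha ha' hx).1, (eq_of_pt_eq_pt hb hb' hy).1]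
  | cons f a b ha hb y l h ih =>
    intro f' g' a' b' ha' hb' hx hy
    rw [← (eq_of_pt_eq_pt ha ha' hx).1]
    exact (dist_triangle a b b').trans (by gcongr; exact ih hb hb' rfl hy)

theorem distX_pt (f : Tame k) {a b : WeightSpace} (ha : a ∈ nablaPlus) (hb : b ∈ nablaPlus) :
    distX (pt f a) (pt f b) = dist a b := by
  have hmem : dist a b ∈ {l | ChainOfLength (pt f a) (pt f b) l} := .single f a b ha hb
  have hlow : ∀ l ∈ {l | ChainOfLength (pt f a) (pt f b) l}, dist a b ≤ l :=
    fun l hl => dist_le_of_chain hl ha hb rfl rfl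
  exact le_antisymm (csInf_le ⟨_, hlow⟩ hmem) (le_csInf ⟨_, hmem⟩ hlow)

theorem comparisonAngle_pt (f : Tame k) {p a b : WeightSpace} (hp : p ∈ nablaPlus)
    (ha : a ∈ nablaPlus) (hb : b ∈ nablaPlus) :
    comparisonAngle (pt f p) (pt f a) (pt f b) =
      InnerProductGeometry.angle (a.log - p.log) (b.log - p.log) := by
  rw [comparisonAngle, distX_pt f hp ha, distX_pt f hp hb, distX_pt f ha hb,
    InnerProductGeometry.angle,
    real_inner_eq_norm_mul_self_add_norm_mul_self_sub_norm_sub_mul_self_div_two,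
    sub_sub_sub_cancel_right, ← isometry_log.dist_eq, ← isometry_log.dist_eq,
    ← isometry_log.dist_eq, dist_comm p.log, dist_comm p.log, dist_eq_norm, dist_eq_norm,
    dist_eq_norm, div_div, ← sq, ← sq, ← sq]
  congr 2
  ring

end

/-- The orthogonal projection of the first basis vector to the plane `t₁ + t₂ + t₃ = 0`. -/
noncomputable def vec0 : EuclideanSpace ℝ (Fin 3) := !₂[2 / 3, -1 / 3, -1 / 3]

/-- The orthogonal projection of the second basis vector to the plane `t₁ + t₂ + t₃ = 0`. -/
noncomputable def vec1 : EuclideanSpace ℝ (Fin 3) := !₂[-1 / 3, 2 / 3, -1 / 3]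

theorem inner_comb (x y x' y' : ℝ) :
    inner ℝ (x • vec0 + y • vec1) (x' • vec0 + y' • vec1) =
      (2 * x * x' - x * y' - y * x' + 2 * y * y') / 3 := by
  simp [vec0, vec1, PiLp.inner_apply, Fin.sum_univ_three]
  ring

theorem log_eq_comb (a : WeightSpace) :
    a.log = Real.log (a.rep 0) • vec0 + Real.log (a.rep 1) • vec1 := by
  conv_lhs => rw [← mk_triple a]
  change logTriple a.triple = _
  ext i
  fin_cases i <;>
    simp [logTriple, vec0, vec1, Fin.sum_univ_three, WeightSpace.triple] <;> ring

theorem comb_ne_zero {x y : ℝ} (h : x ≠ 0 ∨ y ≠ 0) : x • vec0 + y • vec1 ≠ 0 := by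
  intro h0
  have := inner_comb x y x y
  rw [h0, inner_zero_left] at this
  have hx : x = 0 := by nlinarith [sq_nonneg (x - y), sq_nonneg x, sq_nonneg y]
  have hy : y = 0 := by nlinarith [sq_nonneg (x - y), sq_nonneg x, sq_nonneg y]
  tauto

variable (m : ℕ) (hm : 2 ≤ m)

/-- The tangent vector at `[m, 1, 1]` of an edge of `∇⁺`. -/
noncomputable def tangent (s : ℕ) : EuclideanSpace ℝ (Fin 3) :=
  ((edgeDir m s).1 / m) • vec0 + (edgeDir m s).2 • vec1

include hm in
theorem tangent_ne_zero {s : ℕ} (hs : s ≤ m + 2) : tangent m s ≠ 0 := by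
  have : (m : ℝ) ≠ 0 := by
    have : m ≠ 0 := by omega
    exact_mod_cast this
  apply comb_ne_zero
  rcases edgeDir_cases m hs with rfl | rfl | ⟨j, hj, rfl⟩
  · left; simpa [edgeDir_zero]
  · left; simpa [edgeDir_top]
  · right; simp [edgeDir_succ m hj]

theorem eventually_isSmall : ∀ᶠ t in 𝓝[>] (0 : ℝ), IsSmall m t := by
  have h : (0 : ℝ) < 1 / (2 * m + 4) := by positivity
  filter_upwards [Ioo_mem_nhdsGT h] with t ht
  refine ⟨ht.1, ?_⟩
  have : (0 : ℝ) < 2 * m + 4 := by positivity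
  exact ((lt_div_iff₀ this).1 ht.2).le

include hm in
theorem tendsto_slope_log {s : ℕ} (hs : s ≤ m + 2) :
    Tendsto (fun t : ℝ => t⁻¹ • ((ray m (edgeDir m s) t).log - (weightM11 m hm).log)) (𝓝[>] 0)
      (𝓝 (tangent m s)) := by
  have hm0 : (m : ℝ) ≠ 0 := by
    have : m ≠ 0 := by omega
    exact_mod_cast this
  set d := edgeDir m s with hd
  have h0 : HasDerivAt (fun t : ℝ => Real.log (m + t * d.1) • vec0 +
      Real.log (1 + t * d.2) • vec1) (tangent m s) 0 := by
    have e0 : HasDerivAt (fun t : ℝ => Real.log (m + t * d.1)) (d.1 / m) 0 := by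
      have := (((hasDerivAt_id (0 : ℝ)).mul_const d.1).const_add (m : ℝ)).log (by simpa using hm0)
      simpa using this
    have e1 : HasDerivAt (fun t : ℝ => Real.log (1 + t * d.2)) d.2 0 := by
      have := (((hasDerivAt_id (0 : ℝ)).mul_const d.2).const_add (1 : ℝ)).log (by simp)
      simpa using this
    exact (e0.smul_const vec0).add (e1.smul_const vec1)
  have h1 := (hasDerivAt_iff_tendsto_slope.1 h0).mono_left
    (nhdsWithin_mono 0 fun t (ht : 0 < t) => ht.ne')
  refine h1.congr' ?_
  filter_upwards [eventually_isSmall m] with t ht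
  rw [slope_def_module, sub_zero, log_eq_comb, log_eq_comb, rep_weight_zero, rep_weight_one,
    rep_ray_zero hm (isDir_edgeDir m hs) ht, rep_ray_one hm (isDir_edgeDir m hs) ht]
  simp [hd]

theorem tendsto_ray {s : ℕ} (hs : s ≤ m + 2) :
    Tendsto (ray m (edgeDir m s)) (𝓝[>] 0) (𝓝 (weightM11 m hm)) := by
  rw [isometry_log.isEmbedding.tendsto_nhds_iff]
  have h := (tendsto_slope_log m hm hs)
  have ht : Tendsto (fun t : ℝ => t) (𝓝[>] 0) (𝓝 0) := tendsto_id.mono_left nhdsWithin_le_nhds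
  have h2 := (ht.smul h).add_const (weightM11 m hm).log
  rw [zero_smul, zero_add] at h2
  refine h2.congr' ?_
  filter_upwards [self_mem_nhdsWithin] with t (ht : 0 < t)
  rw [smul_inv_smul₀ ht.ne', sub_add_cancel]
  rfl

variable {k : Type*} [Field k]

theorem tendsto_pt_ray (f : Tame k) {s : ℕ} (hs : s ≤ m + 2) :
    Tendsto (fun t => pt f (ray m (edgeDir m s) t)) (𝓝[>] 0)
      (towards (pt f (weightM11 m hm)) (pt f '' cell (edgePt m s))) := by
  refine tendsto_inf.2 ⟨tendsto_comap_iff.2 ?_, tendsto_principal.2 ?_⟩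
  · have := (tendsto_const_nhds (x := weightM11 m hm)).dist (tendsto_ray m hm hs)
    rw [dist_self] at this
    refine this.congr' ?_
    filter_upwards [eventually_isSmall m] with t ht
    exact (distX_pt f (weight_mem_nablaPlus m hm)
      (adjacent_ray hm (isDir_edgeDir m hs) ht).1).symm
  · filter_upwards [eventually_isSmall m] with t ht
    exact ⟨_, ray_mem_cell_edgePt m hm hs ht, rfl⟩

/-- Only lower bounds for lengths are needed, so it is enough to test the upper limit along one pair
of rays. Both lie in one chamber, where comparison angles are Euclidean angles of secants and
converge to the angle of the tangents. -/
theorem angle_le_angleX (f : Tame k) {s t : ℕ} (hs : s ≤ m + 2) (ht : t ≤ m + 2) :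
    InnerProductGeometry.angle (tangent m s) (tangent m t) ≤
      angleX (pt f (weightM11 m hm)) (pt f '' cell (edgePt m s)) (pt f '' cell (edgePt m t)) := by
  set ν := pt f (weightM11 m hm) with hν
  have hpath := (tendsto_pt_ray m hm f hs).prodMk (tendsto_pt_ray m hm f ht)
  have hlim : Tendsto (fun r => comparisonAngle ν (pt f (ray m (edgeDir m s) r))
      (pt f (ray m (edgeDir m t) r))) (𝓝[>] 0)
      (𝓝 (InnerProductGeometry.angle (tangent m s) (tangent m t))) := by
    have h := ((InnerProductGeometry.continuousAt_angle
      (x := (tangent m s, tangent m t)) (tangent_ne_zero m hm hs)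
        (tangent_ne_zero m hm ht)).tendsto).comp
      ((tendsto_slope_log m hm hs).prodMk_nhds (tendsto_slope_log m hm ht))
    refine h.congr' ?_
    filter_upwards [eventually_isSmall m] with r hr
    rw [hν, comparisonAngle_pt f (weight_mem_nablaPlus m hm)
      (adjacent_ray hm (isDir_edgeDir m hs) hr).1 (adjacent_ray hm (isDir_edgeDir m ht) hr).1]
    exact InnerProductGeometry.angle_smul_smul (inv_ne_zero hr.1.ne') _ _
  refine le_of_forall_lt fun c hc => ?_
  obtain ⟨c', hcc', hc'⟩ := exists_between hc
  refine hcc'.trans_le (le_limsup_of_frequently_le ?_ ?_)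
  · refine hpath.frequently ?_
    exact ((hlim.eventually (lt_mem_nhds hc')).mono fun r hr => hr.le).frequently
  · exact isBoundedUnder_of ⟨Real.pi, fun z => Real.arccos_le_pi _⟩

theorem arccos_le_angle {x y : EuclideanSpace ℝ (Fin 3)} (hx : x ≠ 0) (hy : y ≠ 0) {c : ℝ}
    (h : inner ℝ x y ≤ c * (‖x‖ * ‖y‖)) : Real.arccos c ≤ InnerProductGeometry.angle x y :=
  Real.arccos_le_arccos ((div_le_iff₀ (mul_pos (norm_pos_iff.2 hx) (norm_pos_iff.2 hy))).2 h)

include hm in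
theorem angle_tangent_zero_top :
    InnerProductGeometry.angle (tangent m 0) (tangent m (m + 2)) = Real.pi := by
  have : tangent m 0 = -tangent m (m + 2) := by
    simp [tangent, edgeDir_zero, edgeDir_top, neg_div]
  rw [this, InnerProductGeometry.angle_neg_self_of_nonzero (tangent_ne_zero m hm le_rfl)]

include hm in
-- With x = j/m the cosine of this angle is (1-2x) / (2√(x²-x+1)); the hypothesis says, after
-- squaring, that it is at most `c`.
theorem arccos_le_angle_tangent {j : ℕ} (hj : j ≤ m) {c : ℝ} (hc : 0 < c)
    (h : (1 - 2 * (j / m : ℝ)) ≤ 0 ∨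
      (1 - 2 * (j / m : ℝ)) ^ 2 ≤ 4 * c ^ 2 * ((j / m : ℝ) ^ 2 - j / m + 1)) :
    Real.arccos c ≤ InnerProductGeometry.angle (tangent m 0) (tangent m (j + 1)) := by
  have hm0 : (0 : ℝ) < m := by
    have : 0 < m := by omega
    exact_mod_cast this
  set x : ℝ := j / m with hx
  have h0 : tangent m 0 = (m : ℝ)⁻¹ • ((-1 : ℝ) • vec0 + (0 : ℝ) • vec1) := by
    simp [tangent, edgeDir_zero, neg_div]
  have h1 : tangent m (j + 1) = x • vec0 + (1 : ℝ) • vec1 := by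
    simp [tangent, edgeDir_succ m hj, hx]
  rw [h0, h1, InnerProductGeometry.angle_smul_left_of_pos _ _ (inv_pos.2 hm0)]
  have hN : (‖(-1 : ℝ) • vec0 + (0 : ℝ) • vec1‖ * ‖x • vec0 + (1 : ℝ) • vec1‖) ^ 2 =
      4 / 9 * (x ^ 2 - x + 1) := by
    rw [mul_pow, ← real_inner_self_eq_norm_sq, ← real_inner_self_eq_norm_sq, inner_comb,
      inner_comb]
    ring
  refine arccos_le_angle (comb_ne_zero (.inl (by norm_num))) (comb_ne_zero (.inr one_ne_zero)) ?_
  rw [inner_comb]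
  set N := ‖(-1 : ℝ) • vec0 + (0 : ℝ) • vec1‖ * ‖x • vec0 + (1 : ℝ) • vec1‖
  have hN0 : 0 ≤ N := by positivity
  have hcN : 0 ≤ c * N := by positivity
  rcases h with h | h
  · linarith
  · refine (le_abs_self _).trans (abs_le_of_sq_le_sq ?_ hcN)
    rw [mul_pow, hN]
    linarith

theorem arccos_half : Real.arccos (1 / 2) = Real.pi / 3 := by
  rw [← Real.cos_pi_div_three, Real.arccos_cos (by positivity) (by linarith [Real.pi_pos])]

include hm in
theorem pi_div_three_le_angle {s : ℕ} (h1 : 1 ≤ s) (hs : s ≤ m + 2) :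
    Real.pi / 3 ≤ InnerProductGeometry.angle (tangent m 0) (tangent m s) := by
  rcases edgeDir_cases m hs with rfl | rfl | ⟨j, hj, rfl⟩
  · omega
  · rw [angle_tangent_zero_top m hm]
    linarith [Real.pi_pos]
  · rw [← arccos_half]
    refine arccos_le_angle_tangent m hm hj (by norm_num) (.inr ?_)
    have hm0 : (0 : ℝ) < m := by
      have : 0 < m := by omega
      exact_mod_cast this
    have e0 : (0 : ℝ) ≤ j / m := by positivity
    have e1 : (j / m : ℝ) ≤ 1 := (div_le_one hm0).2 (by exact_mod_cast hj)
    nlinarith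

include hm in
-- At j/m = 1/6 the cosine is 2/√31 < 2/5, and it decreases as j/m grows. The threshold 1/6 is
-- chosen because (m-1)/3 ≥ m/6 for all m ≥ 2, which is what the bound for three mountains provides.
theorem arccos_two_fifths_le_angle {j : ℕ} (h1 : m ≤ 6 * j) (hj : j ≤ m) :
    Real.arccos (2 / 5) ≤ InnerProductGeometry.angle (tangent m 0) (tangent m (j + 1)) := by
  have hm0 : (0 : ℝ) < m := by
    have : 0 < m := by omega
    exact_mod_cast this
  have e1 : (1 : ℝ) / 6 ≤ j / m := by
    rw [div_le_div_iff₀ (by norm_num) hm0]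
    have : (m : ℝ) ≤ 6 * j := by exact_mod_cast h1
    linarith
  refine arccos_le_angle_tangent m hm hj (by norm_num) ?_
  rcases le_or_gt (1 - 2 * (j / m : ℝ)) 0 with h | h
  · exact .inl h
  · right
    nlinarith

theorem pi_div_three_lt_arccos : Real.pi / 3 < Real.arccos (2 / 5) := by
  rw [← arccos_half]
  exact Real.arccos_lt_arccos (by norm_num) (by norm_num) (by norm_num)

end TameX

namespace TameX
open Filter Topology MvPolynomial

/-! ### Stabilizers of the points adjacent to `[m, 1, 1]` -/

section monomials

variable {m : ℕ} (hm : 2 ≤ m)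

theorem wt_le_zero_iff {a : WeightSpace} (ha : Adjacent m hm a) (n : Fin 3 →₀ ℕ) :
    wt a.rep n ≤ a.rep 0 ↔ (n 0 = 1 ∧ n 1 = 0 ∧ n 2 = 0) ∨ n 0 = 0 ∧ (n 1 + n 2 < m ∨
      n 1 + n 2 = m ∧ 0 ≤ px m a - n 1 * py a) := by
  have hs : n = Finsupp.single 0 1 ↔ n 0 = 1 ∧ n 1 = 0 ∧ n 2 = 0 := by
    rw [Finsupp.ext_iff, Fin.forall_fin_succ, Fin.forall_fin_succ, Fin.forall_fin_one]
    simp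
  rw [wt_le_iff, hs]
  refine or_congr_right (and_congr_right fun _ => ?_)
  rw [Equiv.swap_self, Equiv.refl_apply, Equiv.refl_apply]
  change 0 ≤ form 1 (n 1) (n 2) a ↔ _
  have hw : form 1 (n 1) (n 2) (weightM11 m hm) = m - (n 1 + n 2 : ℕ) := by
    rw [form_one, rep_weight_zero, rep_weight_one]
    push_cast
    ring
  rcases lt_trichotomy (n 1 + n 2) m with h | h | h
  · have : 0 < form 1 (n 1) (n 2) (weightM11 m hm) := by
      rw [hw, sub_pos]
      exact_mod_cast h
    exact ⟨fun _ => .inl h, fun _ => ((ha.2 _ _ _).1 this).le⟩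
  · have h2 : n 2 = m - n 1 := by omega
    rw [h2, form_one_eq m (by omega)]
    constructor
    · exact fun h' => .inr ⟨by omega, h'⟩
    · rintro (h' | h')
      · omega
      · exact h'.2
  · have : form 1 (n 1) (n 2) (weightM11 m hm) < 0 := by
      rw [hw, sub_neg]
      exact_mod_cast h
    have := (ha.2 _ _ _).2 this
    exact ⟨fun h' => absurd h' this.not_ge, fun h' => by omega⟩

theorem wt_le_one_iff {a : WeightSpace} (ha : Adjacent m hm a) (n : Fin 3 →₀ ℕ) :
    wt a.rep n ≤ a.rep 1 ↔ n 0 = 0 ∧ n 1 + n 2 ≤ 1 := by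
  have hs : n = Finsupp.single 1 1 ↔ n 0 = 0 ∧ n 1 = 1 ∧ n 2 = 0 := by
    rw [Finsupp.ext_iff, Fin.forall_fin_succ, Fin.forall_fin_succ, Fin.forall_fin_one]
    simp
  rw [wt_le_iff, hs, Equiv.swap_apply_right,
    Equiv.swap_apply_of_ne_of_ne (by decide) (by decide)]
  have hw : form (Equiv.swap 0 1) (n 0) (n 2) (weightM11 m hm) = 1 - (n 0 * m + n 2 : ℕ) := by
    rw [form_swap, rep_weight_zero, rep_weight_one]
    push_cast
    ring
  have hform : 0 ≤ form (Equiv.swap 0 1) (n 0) (n 2) a ↔ n 0 = 0 ∧ n 2 ≤ 1 := by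
    rcases lt_trichotomy (n 0 * m + n 2) 1 with h | h | h
    · have : 0 < form (Equiv.swap 0 1) (n 0) (n 2) (weightM11 m hm) := by
        rw [hw, sub_pos]
        exact_mod_cast h
      have h0 : n 0 = 0 := by
        by_contra h0
        have := Nat.mul_le_mul (Nat.one_le_iff_ne_zero.2 h0) hm
        omega
      exact ⟨fun _ => ⟨h0, by omega⟩, fun _ => ((ha.2 _ _ _).1 this).le⟩
    · have h0 : n 0 = 0 := by
        by_contra h0
        have := Nat.mul_le_mul (Nat.one_le_iff_ne_zero.2 h0) hm
        omega
      rw [h0, zero_mul, zero_add] at h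
      rw [h0, h, form_swap_eq]
      simp [py_nonneg ha.1]
    · have : form (Equiv.swap 0 1) (n 0) (n 2) (weightM11 m hm) < 0 := by
        rw [hw, sub_neg]
        exact_mod_cast h
      refine ⟨fun h' => absurd h' ((ha.2 _ _ _).2 this).not_ge, fun h' => ?_⟩
      rw [h'.1] at h
      omega
  rw [hform]
  omega

theorem wt_le_two_iff {a : WeightSpace} (ha : Adjacent m hm a) (n : Fin 3 →₀ ℕ) :
    wt a.rep n ≤ a.rep 2 ↔ n 0 = 0 ∧ n 1 + n 2 ≤ 1 ∧ (n 1 = 0 ∨ py a = 0) := by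
  have hy := py_nonneg ha.1
  have h12 : wt a.rep n ≤ a.rep 2 → wt a.rep n ≤ a.rep 1 := fun h =>
    h.trans (by rw [rep_two]; unfold py at hy; linarith)
  rw [wt_le_one_iff hm ha] at h12
  have hwt : wt a.rep n = a.rep 0 * n 0 + a.rep 1 * n 1 + n 2 := by
    simp [wt, Fin.sum_univ_three]
  constructor
  · intro h
    obtain ⟨h0, h1⟩ := h12 h
    refine ⟨h0, h1, ?_⟩
    by_contra hne
    push Not at hne
    have e1 : n 1 = 1 := by omega
    have e2 : n 2 = 0 := by omega
    rw [hwt, h0, e1, e2, rep_two] at h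
    simp at h
    exact hne.2 (le_antisymm (by rw [py]; linarith) hy)
  · rintro ⟨h0, h1, h2⟩
    rw [hwt, h0, rep_two]
    have h1' : (n 1 + n 2 : ℝ) ≤ 1 := by exact_mod_cast h1
    rcases h2 with h2 | h2
    · rw [h2] at h1' ⊢
      simpa using h1'
    · rw [py, sub_eq_zero] at h2
      rw [h2]
      simpa using h1'

variable {k : Type*} [Field k]

/-- Only two features depend on the direction: which monomials of degree m are allowed in the first
component, and whether the action on the last two coordinates must be triangular. The first
condition weakens as the height grows; the second disappears only where y = 0, that is, at heights 0
and m+2. -/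
theorem fixes_iff {u : Tame k} {a : WeightSpace} (ha : Adjacent m hm a) :
    Fixes u a ↔
      (∀ n ∈ (u.1 (MvPolynomial.X 0)).support, (n 0 = 1 ∧ n 1 = 0 ∧ n 2 = 0) ∨
        n 0 = 0 ∧ (n 1 + n 2 < m ∨ n 1 + n 2 = m ∧ 0 ≤ px m a - n 1 * py a)) ∧
      (∀ n ∈ (u.1 (MvPolynomial.X 1)).support, n 0 = 0 ∧ n 1 + n 2 ≤ 1) ∧
      (∀ n ∈ (u.1 (MvPolynomial.X 2)).support, n 0 = 0 ∧ n 1 + n 2 ≤ 1 ∧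
        (n 1 = 0 ∨ py a = 0)) := by
  rw [Fixes, Fin.forall_fin_succ, Fin.forall_fin_succ, Fin.forall_fin_one]
  simp only [mem_filt, ← wt_le_zero_iff hm ha, ← wt_le_one_iff hm ha, ← wt_le_two_iff hm ha]
  rfl

end monomials

/-! ### Permutations of the coordinates -/

section perm

variable {k : Type*} [Field k]

/-- The permutation of the coordinates by `σ`. -/
noncomputable def permTame (k : Type*) [Field k] (σ : Equiv.Perm (Fin 3)) : Tame k :=
  ⟨renameEquiv k σ, Subgroup.subset_closure (.inl fun i => by simp [totalDegree_X])⟩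

@[simp] theorem permTame_X (σ : Equiv.Perm (Fin 3)) (i : Fin 3) :
    (permTame k σ).1 (MvPolynomial.X i) = MvPolynomial.X (σ i) := by simp [permTame]

theorem permTame_one : permTame k 1 = 1 := by
  refine Subtype.ext (AlgEquiv.coe_toAlgHom_injective ?_)
  exact MvPolynomial.algHom_ext fun i => by
    change (permTame k 1).1 (MvPolynomial.X i) = MvPolynomial.X i
    simp

theorem nuId_permTame (σ : Equiv.Perm (Fin 3)) (α β : PosTriple) (h : ∀ i, α.1 i = β.1 (σ i))
    (P : Poly k) : nuId β ((permTame k σ).1 P) = nuId α P := by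
  classical
  have hs : ((permTame k σ).1 P).support = P.support.image (Finsupp.mapDomain σ) :=
    support_rename_of_injective σ.injective
  rw [nuId, hs, Finset.inf_image, nuId]
  refine Finset.inf_congr rfl fun n _ => ?_
  simp only [Function.comp]
  rw [← Equiv.sum_comp σ]
  simp only [h, Finsupp.mapDomain_apply σ.injective]

theorem pt_permTame (f : Tame k) (σ : Equiv.Perm (Fin 3)) (α β : PosTriple)
    (h : ∀ i, α.1 i = β.1 (σ i)) :
    pt (permTame k σ * f) (WeightSpace.mk β) = pt f (WeightSpace.mk α) := by
  refine Subtype.ext ?_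
  change (Quotient.mk _ (nu (permTame k σ * f) β) : Quotient (valSetoid k)) = Quotient.mk _ (nu f α)
  congr 1
  funext P
  exact nuId_permTame σ α β h (f.1 P)

theorem apartment_eq (f : Tame k) {x : X k} :
    x ∈ apartment f ↔ ∃ σ, ∃ a ∈ nablaPlus, x = pt (permTame k σ * f) a := by
  constructor
  · rintro ⟨b, rfl⟩
    induction b using Quotient.inductionOn with
    | h β =>
      set ρ := Tuple.sort (fun i => -β.1 i) with hρ
      have hmono := Tuple.monotone_sort (fun i => -β.1 i)
      refine ⟨ρ⁻¹, WeightSpace.mk ⟨β.1 ∘ ρ, fun i => β.2 _⟩,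
        ⟨_, rfl, neg_le_neg_iff.1 (hmono (by decide : (0 : Fin 3) ≤ 1)),
          neg_le_neg_iff.1 (hmono (by decide : (1 : Fin 3) ≤ 2))⟩, ?_⟩
      exact (pt_permTame f ρ⁻¹ β _ fun i => by simp).symm
  · rintro ⟨σ, a, -, rfl⟩
    rw [← mk_triple a]
    exact ⟨WeightSpace.mk ⟨a.triple.1 ∘ σ, fun i => a.triple.2 _⟩,
      (pt_permTame f σ ⟨a.triple.1 ∘ σ, fun i => a.triple.2 _⟩ a.triple fun i => rfl).symm⟩

variable (k) in
/-- The transposition of the last two coordinates. -/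
noncomputable def swapTame : Tame k := permTame k (Equiv.swap 1 2)

theorem swapTame_zero : (swapTame k).1 (MvPolynomial.X 0) = MvPolynomial.X 0 := by
  rw [swapTame, permTame_X, Equiv.swap_apply_of_ne_of_ne (by decide) (by decide)]

theorem swapTame_one : (swapTame k).1 (MvPolynomial.X 1) = MvPolynomial.X 2 := by
  rw [swapTame, permTame_X, Equiv.swap_apply_left]

theorem swapTame_two : (swapTame k).1 (MvPolynomial.X 2) = MvPolynomial.X 1 := by
  rw [swapTame, permTame_X, Equiv.swap_apply_right]

theorem swapTame_mul_self : swapTame k * swapTame k = 1 := by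
  refine Subtype.ext (AlgEquiv.coe_toAlgHom_injective (MvPolynomial.algHom_ext fun i => ?_))
  change (swapTame k).1 ((swapTame k).1 (MvPolynomial.X i)) = MvPolynomial.X i
  fin_cases i
  · exact (congrArg _ swapTame_zero).trans swapTame_zero
  · exact (congrArg _ swapTame_one).trans swapTame_two
  · exact (congrArg _ swapTame_two).trans swapTame_one

theorem fixes_swapTame_iff {a : WeightSpace} (ha : a ∈ nablaPlus) :
    Fixes (swapTame k) a ↔ py a = 0 := by
  have hy := py_nonneg ha
  rw [Fixes, Fin.forall_fin_succ, Fin.forall_fin_succ, Fin.forall_fin_one]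
  change (swapTame k).1 (MvPolynomial.X 0) ∈ _ ∧ (swapTame k).1 (MvPolynomial.X 1) ∈
    filt k a.rep (a.rep 1) ∧ (swapTame k).1 (MvPolynomial.X 2) ∈ filt k a.rep (a.rep 2) ↔ _
  rw [swapTame_zero, swapTame_one, swapTame_two, X_mem_filt_iff, X_mem_filt_iff, X_mem_filt_iff,
    rep_two]
  rw [py] at hy ⊢
  constructor
  · intro h
    linarith [h.2.2]
  · intro h
    exact ⟨le_rfl, by linarith, by linarith⟩

variable {m : ℕ} (hm : 2 ≤ m)

/-- A point of an apartment through `ν` that is adjacent to `ν` lies in one of two chambers. -/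
theorem pt_eq_or_of_mem_apartment {f g : Tame k} {a : WeightSpace} (ha : Adjacent m hm a)
    (hfg : pt f (weightM11 m hm) = pt g (weightM11 m hm)) (h : pt g a ∈ apartment f) :
    pt g a = pt f a ∨ pt g a = pt (swapTame k * f) a := by
  obtain ⟨σ, b, hb, h⟩ := (apartment_eq f).1 h
  obtain ⟨rfl, -⟩ := eq_of_pt_eq_pt ha.1 hb h
  have hw := weight_mem_nablaPlus m hm
  have h1 := pt_eq_pt_of_spec ha.1 hw (spec_weight m hm ha) h
  rw [← hfg, pt_eq_pt_iff hw, mul_inv_cancel_right] at h1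
  have h1' := h1 1
  have h2' := h1 2
  rw [permTame_X, X_mem_filt_iff, rep_weight_one] at h1'
  rw [permTame_X, X_mem_filt_iff, rep_two] at h2'
  -- The permutation must fix the weight [m,1,1]. Since m > 1, neither of the last two indices can
  -- go to the first, which leaves the identity and the transposition of the last two.
  have hne : ¬(weightM11 m hm).rep 0 ≤ 1 := by
    rw [rep_weight_zero]
    have : (2 : ℝ) ≤ m := by exact_mod_cast hm
    linarith
  have hσ : σ = 1 ∨ σ = Equiv.swap 1 2 := by
    have hz1 : σ 1 ≠ 0 := fun h0 => hne (h0 ▸ h1')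
    have hz2 : σ 2 ≠ 0 := fun h0 => hne (h0 ▸ h2')
    clear h1 h1' h2' h
    revert σ
    decide
  rcases hσ with rfl | rfl
  · rw [permTame_one, one_mul] at h
    exact .inl h
  · exact .inr h

end perm

/-! ### The link of `ν` -/

section link

variable {k : Type*} [Field k] {m : ℕ} (hm : 2 ≤ m)

variable (m) in
/-- The vertex of the link in the chamber of `f` with direction `edgeDir m s`. -/
noncomputable def lv (f : Tame k) (s : ℕ) : Set (X k) := pt f '' cell (edgePt m s)

variable (m) in
/-- The edge of the link in the chamber of `f` around the direction `faceDir s`. -/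
noncomputable def le (f : Tame k) (s : ℕ) : Set (X k) := pt f '' cell (facePt m s)

include hm in
theorem lv_eq_iff {f g : Tame k} {s t : ℕ} (hs : s ≤ m + 2) (ht : t ≤ m + 2) :
    lv m f s = lv m g t ↔ s = t ∧ pt f (edgePt m s) = pt g (edgePt m s) := by
  rw [lv, lv, image_cell_eq_iff (adjacent_edgePt m hm hs).1]
  refine and_congr_left fun _ => ⟨edgePt_mem_cell_iff hm hs ht, ?_⟩
  rintro rfl
  exact mem_cell_self (adjacent_edgePt m hm hs).1

include hm in
theorem le_eq_iff {f g : Tame k} {s t : ℕ} (hs : s ≤ m + 1) (ht : t ≤ m + 1) :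
    le m f s = le m g t ↔ s = t ∧ pt f (facePt m s) = pt g (facePt m s) := by
  rw [le, le, image_cell_eq_iff (adjacent_facePt m hm hs).1]
  refine and_congr_left fun _ => ⟨facePt_mem_cell_iff hm hs ht, ?_⟩
  rintro rfl
  exact mem_cell_self (adjacent_facePt m hm hs).1

include hm in
theorem lv_eq_of_le_eq {f g : Tame k} {s : ℕ} (hs : s ≤ m + 1) (h : le m f s = le m g s) :
    lv m f s = lv m g s := by
  rw [le_eq_iff hm hs hs] at h
  exact (lv_eq_iff hm (by omega) (by omega)).2 ⟨rfl, pt_eq_pt_of_spec (adjacent_facePt m hm hs).1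
    (adjacent_edgePt m hm (by omega)).1 (spec_facePt_edgePt hm hs) h.2⟩

include hm in
theorem lv_succ_eq_of_le_eq {f g : Tame k} {s : ℕ} (hs : s ≤ m + 1) (h : le m f s = le m g s) :
    lv m f (s + 1) = lv m g (s + 1) := by
  rw [le_eq_iff hm hs hs] at h
  exact (lv_eq_iff hm (by omega) (by omega)).2 ⟨rfl, pt_eq_pt_of_spec (adjacent_facePt m hm hs).1
    (adjacent_edgePt m hm (by omega)).1 (spec_facePt_edgePt_succ hm hs) h.2⟩

include hm in
-- Uniqueness of the upward edge at positive height, which holds because the stabilizer of the edge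
-- s is contained in that of the face s.
theorem le_eq_of_lv_eq {f g : Tame k} {s : ℕ} (h1 : 1 ≤ s) (hs : s ≤ m + 1)
    (h : lv m f s = lv m g s) : le m f s = le m g s := by
  rw [lv_eq_iff hm (by omega) (by omega)] at h
  exact (le_eq_iff hm hs hs).2 ⟨rfl, pt_eq_pt_of_spec (adjacent_edgePt m hm (by omega)).1
    (adjacent_facePt m hm hs).1 (spec_edgePt_facePt hm h1 hs) h.2⟩

include hm in
-- At height 0 the upward edge is not unique, but agreement at height m+1 adds the missing
-- triangularity.
theorem le_zero_eq {f g : Tame k} (h0 : lv m f 0 = lv m g 0)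
    (h1 : lv m f (m + 1) = lv m g (m + 1)) : le m f 0 = le m g 0 := by
  rw [lv_eq_iff hm (by omega) (by omega)] at h0 h1
  refine (le_eq_iff hm (by omega) (by omega)).2 ⟨rfl, ?_⟩
  have a0 := (adjacent_edgePt m hm (s := 0) (by omega)).1
  have a1 := (adjacent_edgePt m hm (s := m + 1) (by omega)).1
  refine (pt_eq_pt_iff (adjacent_facePt m hm (by omega)).1).2
    (Fixes.of_forms (P := fun a => a = edgePt m 0 ∨ a = edgePt m (m + 1)) (.inl rfl) ?_
      fun σ p q h => form_facePt_zero_nonneg hm σ p q (h _ (.inl rfl)) (h _ (.inr rfl)))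
  rintro _ (rfl | rfl)
  · exact (pt_eq_pt_iff a0).1 h0.2
  · exact (pt_eq_pt_iff a1).1 h1.2

include hm in
/-- Equality of edges propagates upwards. -/
theorem le_eq_of_le_eq {f g : Tame k} {s t : ℕ} (hst : s ≤ t) (ht : t ≤ m + 1)
    (h : le m f s = le m g s) : le m f t = le m g t := by
  induction t, hst using Nat.le_induction with
  | base => exact h
  | succ t hst ih =>
    exact le_eq_of_lv_eq hm (by omega) ht (lv_succ_eq_of_le_eq hm (by omega) (ih (by omega)))

include hm in
theorem lv_eq_of_le_zero_eq {f g : Tame k} (h : le m f 0 = le m g 0) {s : ℕ} (hs : s ≤ m + 2) :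
    lv m f s = lv m g s := by
  rcases Nat.eq_zero_or_pos s with rfl | h0
  · exact lv_eq_of_le_eq hm (by omega) h
  · obtain ⟨t, rfl⟩ : ∃ t, s = t + 1 := ⟨s - 1, by omega⟩
    exact lv_succ_eq_of_le_eq hm (by omega) (le_eq_of_le_eq hm t.zero_le (by omega) h)

include hm in
theorem lv_eq_of_lv_eq {f g : Tame k} {s t : ℕ} (h1 : 1 ≤ s) (hst : s ≤ t) (ht : t ≤ m + 2)
    (h : lv m f s = lv m g s) : lv m f t = lv m g t := by
  rcases hst.eq_or_lt with rfl | hlt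
  · exact h
  · obtain ⟨t, rfl⟩ : ∃ r, t = r + 1 := ⟨t - 1, by omega⟩
    exact lv_succ_eq_of_le_eq hm (by omega) (le_eq_of_le_eq hm (by omega : s ≤ t) (by omega)
      (le_eq_of_lv_eq hm h1 (by omega) h))

variable {hm} {ν : X k}

theorem IsLinkVertex.exists_lv {h : Tame k} (hν : ν = pt h (weightM11 m hm)) {x : Set (X k)}
    (hx : IsLinkVertex ν x) : ∃ f, pt f (weightM11 m hm) = ν ∧ ∃ s ≤ m + 2, x = lv m f s := by
  obtain ⟨f, E, hE, rfl, a, ha, hfa⟩ := hx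
  obtain ⟨b, hb, -, -, hEb⟩ := hE.exists_cell
  obtain ⟨haw, -⟩ := eq_of_pt_eq_pt (closure_cell_subset_nablaPlus b (hEb ▸ ha))
    (weight_mem_nablaPlus m hm) (hfa.trans hν)
  obtain ⟨s, hs, rfl⟩ := hE.eq_cell_edgePt hm (haw ▸ ha)
  exact ⟨f, by rw [← haw, hfa], s, hs, rfl⟩

theorem IsLinkEdge.exists_le {h : Tame k} (hν : ν = pt h (weightM11 m hm)) {c : Set (X k)}
    (hc : IsLinkEdge ν c) : ∃ f, pt f (weightM11 m hm) = ν ∧ ∃ s ≤ m + 1, c = le m f s := by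
  obtain ⟨f, C, hC, rfl, a, ha, hfa⟩ := hc
  obtain ⟨b, hb, -, hCb⟩ := hC.exists_cell
  obtain ⟨haw, -⟩ := eq_of_pt_eq_pt (closure_cell_subset_nablaPlus b (hCb ▸ ha))
    (weight_mem_nablaPlus m hm) (hfa.trans hν)
  obtain ⟨s, hs, rfl⟩ := hC.eq_cell_facePt hm (haw ▸ ha)
  exact ⟨f, by rw [← haw, hfa], s, hs, rfl⟩

theorem LinkInc.isLinkVertex {c x : Set (X k)} (h : LinkInc ν c x) : IsLinkVertex ν x := by
  obtain ⟨f, C, E, hC, hE, hEC, rfl, rfl, hν⟩ := h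
  exact ⟨f, E, hE, rfl, hν⟩

theorem LinkInc.isLinkEdge {c x : Set (X k)} (h : LinkInc ν c x) : IsLinkEdge ν c := by
  obtain ⟨f, C, E, hC, hE, hEC, rfl, rfl, hν⟩ := h
  exact ⟨f, C, hC, rfl, Set.image_mono (closure_minimal hEC isClosed_closure) hν⟩

theorem LinkInc.exists_le {h : Tame k} (hν : ν = pt h (weightM11 m hm)) {c x : Set (X k)}
    (hcx : LinkInc ν c x) : ∃ f, pt f (weightM11 m hm) = ν ∧ ∃ s ≤ m + 1, c = le m f s ∧
      (x = lv m f s ∨ x = lv m f (s + 1)) := by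
  obtain ⟨f, C, E, hC, hE, hEC, rfl, rfl, a, ha, hfa⟩ := hcx
  obtain ⟨b, hb, -, -, hEb⟩ := hE.exists_cell
  obtain ⟨haw, -⟩ := eq_of_pt_eq_pt (closure_cell_subset_nablaPlus b (hEb ▸ ha))
    (weight_mem_nablaPlus m hm) (hfa.trans hν)
  subst haw
  obtain ⟨t, ht, rfl⟩ := hE.eq_cell_edgePt hm ha
  obtain ⟨s, hs, rfl⟩ := hC.eq_cell_facePt hm (closure_minimal hEC isClosed_closure ha)
  refine ⟨f, hfa, s, hs, rfl, ?_⟩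
  rcases eq_or_eq_succ_of_cell_subset_closure hm hs ht hEC with rfl | rfl
  · exact .inl rfl
  · exact .inr rfl

theorem LinkInc.eq_lv {h : Tame k} (hν : ν = pt h (weightM11 m hm)) {f : Tame k} {s : ℕ}
    (hs : s ≤ m + 1) {x : Set (X k)} (hcx : LinkInc ν (le m f s) x) :
    x = lv m f s ∨ x = lv m f (s + 1) := by
  obtain ⟨g, -, t, ht, hle, hx⟩ := hcx.exists_le hν
  obtain ⟨rfl, -⟩ := (le_eq_iff hm hs ht).1 hle
  rwa [lv_eq_of_le_eq hm hs hle, lv_succ_eq_of_le_eq hm hs hle]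

theorem subset_apartment_swap (f : Tame k) {S : Set WeightSpace} (hS : S ⊆ nablaPlus) :
    pt (swapTame k * f) '' S ⊆ apartment f := by
  rintro _ ⟨a, ha, rfl⟩
  exact (apartment_eq f).2 ⟨_, a, hS ha, rfl⟩

theorem mem_apartmentLink_verts {f : Tame k} (hf : pt f (weightM11 m hm) = ν) {x : Set (X k)} :
    x ∈ (apartmentLink ν f).verts ↔
      IsLinkVertex ν x ∧ ∃ s ≤ m + 2, x = lv m f s ∨ x = lv m (swapTame k * f) s := by
  refine and_congr_right fun hx => ⟨fun h => ?_, ?_⟩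
  · obtain ⟨g, hg, s, hs, rfl⟩ := hx.exists_lv hf.symm
    refine ⟨s, hs, ?_⟩
    have ha := adjacent_edgePt m hm hs
    rw [lv_eq_iff hm hs hs, lv_eq_iff hm hs hs]
    simpa using pt_eq_or_of_mem_apartment hm ha (hf.trans hg.symm)
      (h ⟨_, mem_cell_self ha.1, rfl⟩)
  · rintro ⟨s, hs, rfl | rfl⟩
    · rintro _ ⟨a, -, rfl⟩
      exact ⟨a, rfl⟩
    · exact subset_apartment_swap f fun a ha => ha.1

theorem mem_apartmentLink_edges {f : Tame k} (hf : pt f (weightM11 m hm) = ν) {c : Set (X k)} :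
    c ∈ (apartmentLink ν f).edges ↔
      IsLinkEdge ν c ∧ ∃ s ≤ m + 1, c = le m f s ∨ c = le m (swapTame k * f) s := by
  refine and_congr_right fun hc => ⟨fun h => ?_, ?_⟩
  · obtain ⟨g, hg, s, hs, rfl⟩ := hc.exists_le hf.symm
    refine ⟨s, hs, ?_⟩
    have ha := adjacent_facePt m hm hs
    rw [le_eq_iff hm hs hs, le_eq_iff hm hs hs]
    simpa using pt_eq_or_of_mem_apartment hm ha (hf.trans hg.symm)
      (h ⟨_, mem_cell_self ha.1, rfl⟩)
  · rintro ⟨s, hs, rfl | rfl⟩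
    · rintro _ ⟨a, -, rfl⟩
      exact ⟨a, rfl⟩
    · exact subset_apartment_swap f fun a ha => ha.1

variable (hm)

include hm in
theorem le_ne_le_swap (f : Tame k) {s : ℕ} (hs : s ≤ m + 1) :
    le m f s ≠ le m (swapTame k * f) s := by
  rw [Ne, le_eq_iff hm hs hs, pt_eq_pt_iff (adjacent_facePt m hm hs).1, mul_inv_cancel_right,
    fixes_swapTame_iff (adjacent_facePt m hm hs).1]
  exact fun h => py_facePt_ne_zero hm hs h.2

include hm in
-- The two halves of an apartment link meet only where y = 0, since the transposition fixes exactly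
-- those points.
theorem lv_eq_lv_swap_iff (f : Tame k) {s : ℕ} (hs : s ≤ m + 2) :
    lv m f s = lv m (swapTame k * f) s ↔ s = 0 ∨ s = m + 2 := by
  rw [lv_eq_iff hm hs hs, pt_eq_pt_iff (adjacent_edgePt m hm hs).1, mul_inv_cancel_right,
    fixes_swapTame_iff (adjacent_edgePt m hm hs).1, py_edgePt_eq_zero_iff hm hs]
  simp

end link

end TameX

namespace TameX
open Filter Topology MvPolynomial

/-! ### Two edges of the link at a common lowest vertex lie in an apartment -/

section bruhat

variable {k : Type*} [Field k]

/-- The algebra endomorphism `X₁ ↦ X₁ + c X₂`. -/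
noncomputable def shearHom (c : k) : Poly k →ₐ[k] Poly k :=
  aeval ![MvPolynomial.X 0, MvPolynomial.X 1 + C c * MvPolynomial.X 2, MvPolynomial.X 2]

theorem shearHom_comp (c d : k) (h : c + d = 0) :
    (shearHom c).comp (shearHom d) = AlgHom.id k (Poly k) := by
  refine MvPolynomial.algHom_ext fun i => ?_
  fin_cases i
  · simp [shearHom]
  · simp only [shearHom, AlgHom.comp_apply, Fin.mk_one, aeval_X, Matrix.cons_val_one,
      Matrix.cons_val_zero, map_add, map_mul, algHom_C, algebraMap_eq, Matrix.cons_val,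
      AlgHom.id_apply]
    rw [add_assoc, ← add_mul, ← C_add, h, C_0, zero_mul, add_zero]
  · simp [shearHom]

/-- The automorphism `X₁ ↦ X₁ + c X₂`. -/
noncomputable def shear (c : k) : Tame k :=
  ⟨AlgEquiv.ofAlgHom (shearHom c) (shearHom (-c)) (shearHom_comp c (-c) (add_neg_cancel c))
      (shearHom_comp (-c) c (neg_add_cancel c)), Subgroup.subset_closure (.inl fun i => by
    fin_cases i
    · simp [shearHom]
    · change (shearHom c (MvPolynomial.X 1)).totalDegree ≤ 1
      have h : shearHom c (MvPolynomial.X 1) = MvPolynomial.X 1 + C c * MvPolynomial.X 2 := by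
        simp [shearHom]
      rw [h]
      refine (totalDegree_add _ _).trans (max_le (totalDegree_X _).le ?_)
      exact (totalDegree_mul _ _).trans (by simp [totalDegree_X])
    · simp [shearHom])⟩

theorem shear_zero (c : k) : (shear c).1 (MvPolynomial.X 0) = MvPolynomial.X 0 := by
  simp [shear, shearHom]

theorem shear_one (c : k) :
    (shear c).1 (MvPolynomial.X 1) = MvPolynomial.X 1 + C c * MvPolynomial.X 2 := by
  simp [shear, shearHom]

theorem shear_two (c : k) : (shear c).1 (MvPolynomial.X 2) = MvPolynomial.X 2 := by
  simp [shear, shearHom]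

theorem shear_inv (c : k) : (shear c)⁻¹ = shear (-c) := by
  refine Subtype.ext (AlgEquiv.ext fun P => ?_)
  change shearHom (-c) P = shearHom (-c) P
  rfl

theorem fixes_shear (c : k) {a : WeightSpace} (ha : a ∈ nablaPlus) : Fixes (shear c) a := by
  have hy := py_nonneg ha
  intro i
  fin_cases i
  · exact (shear_zero c).symm ▸ (X_mem_filt_iff 0).2 le_rfl
  · change (shear c).1 (MvPolynomial.X 1) ∈ filt k a.rep (a.rep 1)
    rw [shear_one]
    refine Submodule.add_mem _ ((X_mem_filt_iff 1).2 le_rfl) ?_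
    have := filt_mul (C_mem_filt a.rep c) ((X_mem_filt_iff (k := k) (α := a.rep) 2).2 le_rfl)
    refine filt_mono ?_ this
    rw [py] at hy
    rw [rep_two]
    linarith
  · exact (shear_two c).symm ▸ (X_mem_filt_iff 2).2 le_rfl

variable {m : ℕ} (hm : 2 ≤ m)

include hm in
-- The big cell of GL₂. An element fixing edge 0 has no degree-m part in its first component, so it
-- can fail to fix face 0 only through a nonzero coefficient of X₁ in the image of X₂; a shear
-- followed by the transposition removes that coefficient.
theorem exists_bruhat {b : Tame k} (h0 : Fixes b (edgePt m 0)) (h1 : ¬Fixes b (facePt m 0)) :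
    ∃ u : Tame k, Fixes u (facePt m 0) ∧ Fixes (b * (swapTame k * u)⁻¹) (facePt m 0) := by
  have a0 := adjacent_edgePt m hm (s := 0) (by omega)
  have a1 := adjacent_facePt m hm (s := 0) (by omega)
  rw [fixes_iff hm a0] at h0
  obtain ⟨hx0, hx1, hx2⟩ := h0
  have hy1 := py_facePt_ne_zero hm (s := 0) (by omega)
  have hx0' : ∀ n ∈ (b.1 (MvPolynomial.X 0)).support, (n 0 = 1 ∧ n 1 = 0 ∧ n 2 = 0) ∨
      n 0 = 0 ∧ (n 1 + n 2 < m ∨ n 1 + n 2 = m ∧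
        0 ≤ px m (facePt m 0) - n 1 * py (facePt m 0)) := by
    intro n hn
    refine (hx0 n hn).imp_right (And.imp_right fun h => .inl (h.resolve_right ?_))
    rintro ⟨h, h'⟩
    rw [px_edgePt_nonneg_iff' hm (by omega) (by omega)] at h'
    omega
  set e : Fin 3 →₀ ℕ := Finsupp.single 1 1 with he
  have hlin (n : Fin 3 →₀ ℕ) (h : n 0 = 0 ∧ n 1 + n 2 ≤ 1) (h' : n 1 ≠ 0) : n = e := by
    ext i
    fin_cases i
    · simp [he, h.1]
    · simp [he]
      omega
    · simp [he]
      omega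
  have hγ : coeff e (b.1 (MvPolynomial.X 2)) ≠ 0 := by
    intro hγ
    refine h1 ((fixes_iff hm a1).2 ⟨hx0', hx1, fun n hn => ⟨(hx2 n hn).1, (hx2 n hn).2.1, ?_⟩⟩)
    by_contra hne
    push Not at hne
    rw [hlin n ⟨(hx2 n hn).1, (hx2 n hn).2.1⟩ hne.1] at hn
    exact mem_support_iff.1 hn hγ
  -- Chosen so that X₁ has coefficient zero in b(X₁) - c·b(X₂), which becomes the image of X₂ under
  -- the corrected automorphism.
  set c : k := coeff e (b.1 (MvPolynomial.X 1)) / coeff e (b.1 (MvPolynomial.X 2)) with hc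
  refine ⟨shear c, fixes_shear c a1.1, ?_⟩
  have hswap : (swapTame k)⁻¹ = swapTame k := inv_eq_of_mul_eq_one_left swapTame_mul_self
  rw [mul_inv_rev, hswap, shear_inv, fixes_iff hm a1]
  have hval (P : Poly k) : (b * (shear (-c) * swapTame k)).1 P =
      b.1 ((shear (-c)).1 ((swapTame k).1 P)) := rfl
  rw [hval, hval, hval, swapTame_zero, swapTame_one, swapTame_two, shear_zero, shear_one,
    shear_two]
  refine ⟨hx0', fun n hn => ⟨(hx2 n hn).1, (hx2 n hn).2.1⟩, fun n hn => ?_⟩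
  have hC : b.1 (C (-c)) = C (-c) := b.1.commutes (-c)
  rw [map_add, map_mul, hC] at hn
  have hn' : n 0 = 0 ∧ n 1 + n 2 ≤ 1 := by
    rcases Finset.mem_union.1 (support_add hn) with h | h
    · exact hx1 n h
    · rw [C_mul'] at h
      have := support_smul h
      exact ⟨(hx2 n this).1, (hx2 n this).2.1⟩
  refine ⟨hn'.1, hn'.2, .inl ?_⟩
  by_contra hne
  rw [hlin n hn' hne, mem_support_iff, coeff_add, coeff_C_mul, hc] at hn
  refine hn ?_
  field_simp
  ring

include hm in
theorem exists_apartment {f g : Tame k} (h0 : lv m f 0 = lv m g 0) (h1 : le m f 0 ≠ le m g 0) :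
    ∃ f' : Tame k, le m f 0 = le m f' 0 ∧ le m g 0 = le m (swapTame k * f') 0 := by
  have a0 := (adjacent_edgePt m hm (s := 0) (by omega)).1
  have a1 := (adjacent_facePt m hm (s := 0) (by omega)).1
  rw [lv_eq_iff hm (by omega) (by omega), pt_eq_pt_iff a0] at h0
  rw [Ne, le_eq_iff hm (by omega) (by omega), pt_eq_pt_iff a1] at h1
  obtain ⟨u, hu, hu'⟩ := exists_bruhat hm h0.2 fun h => h1 ⟨rfl, h⟩
  refine ⟨u * f, (le_eq_iff hm (by omega) (by omega)).2 ⟨rfl, ?_⟩,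
    (le_eq_iff hm (by omega) (by omega)).2 ⟨rfl, ?_⟩⟩
  · rwa [pt_eq_pt_iff a1, mul_inv_cancel_right]
  · rw [eq_comm, pt_eq_pt_iff a1]
    convert hu' using 1
    group

theorem pt_weight_eq_of_le_eq {f g : Tame k} {s : ℕ} (hs : s ≤ m + 1)
    (h : le m f s = le m g s) : pt f (weightM11 m hm) = pt g (weightM11 m hm) := by
  rw [le_eq_iff hm hs hs] at h
  have a1 := adjacent_facePt m hm hs
  exact pt_eq_pt_of_spec a1.1 (weight_mem_nablaPlus m hm) (spec_weight m hm a1) h.2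

end bruhat

end TameX

namespace TameX
open Filter Topology MvPolynomial

/-! ### Leading forms -/

section theta

variable {k : Type*} [Field k]

variable (k) in
/-- The substitution `X₀ ↦ 0`, `X₁ ↦ tT`, `X₂ ↦ T`. -/
noncomputable def theta : Poly k →ₐ[k] Polynomial (Polynomial k) :=
  aeval ![0, Polynomial.C Polynomial.X * Polynomial.X, Polynomial.X]

/-- The part of `P(0, x₁, x₂)` of degree `d`, dehomogenized. -/
noncomputable def leadForm (d : ℕ) (P : Poly k) : Polynomial k := (theta k P).coeff d

theorem theta_C (c : k) : theta k (C c) = Polynomial.C (Polynomial.C c) :=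
  (theta k).commutes c

theorem theta_monomial (n : Fin 3 →₀ ℕ) (c : k) : theta k (monomial n c) =
    if n 0 = 0 then Polynomial.monomial (n 1 + n 2) (Polynomial.monomial (n 1) c) else 0 := by
  rw [theta, aeval_monomial, Finsupp.prod_fintype _ _ fun i => by simp, Fin.prod_univ_three]
  simp only [Matrix.cons_val_zero, Matrix.cons_val_one, Matrix.cons_val]
  split_ifs with h
  · rw [h, pow_zero, one_mul, mul_pow, ← Polynomial.C_pow, mul_assoc, ← pow_add,
      ← Polynomial.C_mul_X_pow_eq_monomial, ← Polynomial.C_mul_X_pow_eq_monomial, Polynomial.C_mul,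
      mul_assoc]
    rfl
  · simp [h]

theorem leadForm_monomial (d : ℕ) (n : Fin 3 →₀ ℕ) (c : k) : leadForm d (monomial n c) =
    if n 0 = 0 ∧ n 1 + n 2 = d then Polynomial.monomial (n 1) c else 0 := by
  rw [leadForm, theta_monomial]
  split_ifs with h1 h2 h2
  · rw [h2.2, Polynomial.coeff_monomial_same]
  · exact Polynomial.coeff_monomial_of_ne _ fun h => h2 ⟨h1, h.symm⟩
  · exact absurd h2.1 h1
  · exact Polynomial.coeff_zero _

/-- The variable t records the exponent of X₁. A bound on that exponent becomes a bound on the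
degree, and a bound on the exponent of X₂ becomes divisibility by a power of t. -/
theorem coeff_leadForm (d j : ℕ) (P : Poly k) : (leadForm d P).coeff j =
    if j ≤ d then coeff (Finsupp.single 1 j + Finsupp.single 2 (d - j)) P else 0 := by
  induction P using MvPolynomial.induction_on' with
  | monomial n c =>
    rw [leadForm_monomial, coeff_monomial]
    by_cases h : j ≤ d ∧ n = Finsupp.single 1 j + Finsupp.single 2 (d - j)
    · obtain ⟨hj, rfl⟩ := h
      simp [hj]
    · have hr : (if j ≤ d then if n = Finsupp.single 1 j + Finsupp.single 2 (d - j) then c else 0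
          else 0) = 0 := by
        split_ifs <;> tauto
      rw [hr]
      split_ifs with h1
      · refine Polynomial.coeff_monomial_of_ne _ fun hj => h ⟨by omega, ?_⟩
        ext i
        fin_cases i <;> simp <;> omega
      · exact Polynomial.coeff_zero _
  | add P Q hP hQ =>
    rw [leadForm, map_add, Polynomial.coeff_add, Polynomial.coeff_add, ← leadForm, ← leadForm, hP, hQ]
    split_ifs <;> simp

theorem natDegree_leadForm_le (d : ℕ) (P : Poly k) : (leadForm d P).natDegree ≤ d :=
  Polynomial.natDegree_le_iff_coeff_eq_zero.2 fun j hj => by rw [coeff_leadForm, if_neg hj.not_ge]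

theorem natDegree_theta_le {P : Poly k} {d : ℕ} (h : ∀ n ∈ P.support, n 0 = 0 → n 1 + n 2 ≤ d) :
    (theta k P).natDegree ≤ d := by
  rw [P.as_sum, map_sum]
  refine Polynomial.natDegree_sum_le_of_forall_le _ _ fun n hn => ?_
  rw [theta_monomial]
  split_ifs with h0
  · exact (Polynomial.natDegree_monomial_le _).trans (h n hn h0)
  · simp

/-- Leading forms under composition with an automorphism that is affine in the last coordinates. -/
theorem dvd_leadForm_sub {d : ℕ} {u : Poly k ≃ₐ[k] Poly k}
    (h1 : (theta k (u (MvPolynomial.X 1))).natDegree ≤ 1)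
    (h2 : (theta k (u (MvPolynomial.X 2))).natDegree ≤ 1) {P : Poly k} {D : Polynomial k}
    (hP : ∀ n ∈ P.support, (n 0 = 1 ∧ n 1 = 0 ∧ n 2 = 0) ∨ n 0 = 0 ∧ (n 1 + n 2 < d ∨
      n 1 + n 2 = d ∧ D ∣ leadForm 1 (u (MvPolynomial.X 1)) ^ n 1 *
        leadForm 1 (u (MvPolynomial.X 2)) ^ n 2)) :
    D ∣ leadForm d (u P) - Polynomial.C (coeff (Finsupp.single 0 1) P) *
      leadForm d (u (MvPolynomial.X 0)) := by
  set e : Fin 3 →₀ ℕ := Finsupp.single 0 1 with he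
  set Q := P - monomial e (coeff e P) with hQ
  have hsub : leadForm d (u P) - Polynomial.C (coeff e P) * leadForm d (u (MvPolynomial.X 0)) =
      leadForm d (u Q) := by
    have hm : u (monomial e (coeff e P)) = C (coeff e P) * u (MvPolynomial.X 0) := by
      rw [algEquiv_monomial, he, Fin.prod_univ_three]
      simp
    rw [hQ, map_sub, hm, leadForm, leadForm, leadForm, map_sub, map_mul, theta_C, Polynomial.coeff_sub,
      Polynomial.coeff_C_mul]
  -- Monomial by monomial: the images of X₁ and X₂ have degree at most 1 in T, so monomials of
  -- degree below d do not reach T^d, and those of degree d contribute a scalar times a product of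
  -- the leading linear forms.
  rw [hsub, Q.as_sum, map_sum, leadForm, map_sum, Polynomial.finsetSum_coeff]
  refine Finset.dvd_sum fun n hn => ?_
  have hne : n ≠ e := by
    rintro rfl
    rw [mem_support_iff, hQ, coeff_sub, coeff_monomial, if_pos rfl, sub_self] at hn
    exact hn rfl
  have hnP : n ∈ P.support := by
    rw [mem_support_iff, hQ, coeff_sub, coeff_monomial, if_neg hne.symm, sub_zero] at hn
    exact mem_support_iff.2 hn
  rw [algEquiv_monomial, map_mul, theta_C, Polynomial.coeff_C_mul, Fin.prod_univ_three]
  refine Dvd.dvd.mul_left ?_ _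
  rcases hP n hnP with h | ⟨h0, h⟩
  · refine absurd ?_ hne
    ext i
    fin_cases i
    · simp [he, h.1]
    · simp [he, h.2.1]
    · simp [he, h.2.2]
  · rw [h0, pow_zero, one_mul, map_mul, map_pow, map_pow]
    have e1 := Polynomial.natDegree_pow_le_of_le (n 1) h1
    have e2 := Polynomial.natDegree_pow_le_of_le (n 2) h2
    rw [mul_one] at e1 e2
    rcases h with h | ⟨h, hD⟩
    · rw [Polynomial.coeff_eq_zero_of_natDegree_lt]
      · exact dvd_zero _
      · exact (Polynomial.natDegree_mul_le_of_le e1 e2).trans_lt h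
    · subst h
      rw [Polynomial.coeff_mul_add_eq_of_natDegree_le e1 e2]
      have c1 := Polynomial.coeff_pow_of_natDegree_le (m := n 1) h1
      have c2 := Polynomial.coeff_pow_of_natDegree_le (m := n 2) h2
      rw [mul_one] at c1 c2
      rw [c1, c2]
      exact hD

end theta

/-! ### A degree bound for three polynomials with sum zero -/

section abc

open Polynomial

/-- A bound of Mason–Stothers type. -/
theorem eq_zero_of_pow_dvd {k : Type*} [Field k] [CharZero k] {m i₁ i₂ i₃ : ℕ}
    (hsum : i₁ + i₂ + i₃ + 1 < m) {A B Λ : k[X]} (hA : A.natDegree ≤ i₁) (hB : B.natDegree ≤ m)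
    (hXB : Polynomial.X ^ (m - i₂) ∣ B) (h0 : Λ.coeff 0 ≠ 0) (h1 : Λ.natDegree = 1)
    (hΛ : Λ ^ (m - i₃) ∣ A - B) : A = 0 := by
  -- Differentiating i₁+1 times kills A, so the derivative of B inherits high powers of both X and
  -- Λ. The count (m-i₂-i₁-1) + (m-i₃-i₁-1) > m-i₁-1 is exactly `hsum`, so this derivative vanishes.
  have hDA : derivative^[i₁ + 1] A = 0 := iterate_derivative_eq_zero (by omega)
  have hd1 : Polynomial.X ^ (m - i₂ - (i₁ + 1)) ∣ derivative^[i₁ + 1] B :=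
    pow_sub_dvd_iterate_derivative_of_pow_dvd _ hXB
  have hd2 : Λ ^ (m - i₃ - (i₁ + 1)) ∣ derivative^[i₁ + 1] B := by
    have := pow_sub_dvd_iterate_derivative_of_pow_dvd (i₁ + 1) hΛ
    rwa [iterate_derivative_sub, hDA, zero_sub, dvd_neg] at this
  have hcop : IsCoprime (Polynomial.X : k[X]) Λ :=
    Polynomial.irreducible_X.coprime_iff_not_dvd.2 fun h => h0 (X_dvd_iff.1 h)
  have hΛ0 : Λ ≠ 0 := by
    rintro rfl
    exact h0 (Polynomial.coeff_zero 0)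
  have hdeg (a b : ℕ) : (Polynomial.X ^ a * Λ ^ b : k[X]).natDegree = a + b := by
    rw [natDegree_mul (pow_ne_zero _ Polynomial.X_ne_zero) (pow_ne_zero _ hΛ0), natDegree_X_pow,
      natDegree_pow, h1, mul_one]
  have hDB : derivative^[i₁ + 1] B = 0 := by
    refine eq_zero_of_dvd_of_natDegree_lt (hcop.pow.mul_dvd hd1 hd2) ?_
    rw [hdeg]
    exact (natDegree_iterate_derivative B _).trans_lt (by omega)
  -- Characteristic zero enters here: the falling factorials produced by the derivatives are nonzero
  -- in k.
  have hB1 : B.natDegree ≤ i₁ := by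
    refine natDegree_le_iff_coeff_eq_zero.2 fun j hj => ?_
    have := congrArg (fun p => p.coeff (j - (i₁ + 1))) hDB
    simp only [coeff_iterate_derivative, Polynomial.coeff_zero] at this
    rw [Nat.sub_add_cancel hj, nsmul_eq_mul, mul_eq_zero] at this
    refine this.resolve_left ?_
    rw [Nat.cast_eq_zero, Nat.descFactorial_eq_zero_iff_lt]
    omega
  have hB0 : B = 0 := by
    refine eq_zero_of_dvd_of_natDegree_lt hXB ?_
    rw [natDegree_X_pow]
    omega
  rw [hB0, sub_zero] at hΛ
  refine eq_zero_of_dvd_of_natDegree_lt hΛ ?_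
  rw [natDegree_pow, h1, mul_one]
  omega

end abc

/-! ### Three mountains and the sum of their heights -/

section heights

variable {k : Type*} [Field k] {m : ℕ} (hm : 2 ≤ m)

theorem adjacent_weight : Adjacent m hm (weightM11 m hm) :=
  ⟨weight_mem_nablaPlus m hm, fun _ _ _ => ⟨id, id⟩⟩

theorem Fixes.natDegree_theta_le {u : Tame k} (hu : Fixes u (weightM11 m hm)) {i : Fin 3}
    (hi : i = 1 ∨ i = 2) : (theta k (u.1 (MvPolynomial.X i))).natDegree ≤ 1 := by
  obtain ⟨-, h1, h2⟩ := (fixes_iff hm (adjacent_weight hm)).1 hu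
  rcases hi with rfl | rfl
  · exact TameX.natDegree_theta_le fun n hn _ => (h1 n hn).2
  · exact TameX.natDegree_theta_le fun n hn _ => (h2 n hn).2.1

theorem Fixes.weight {u : Tame k} {a : WeightSpace} (ha : Adjacent m hm a) (hu : Fixes u a) :
    Fixes u (weightM11 m hm) := hu.of_spec (spec_weight m hm ha)

/-- At height m+1 all monomials of degree m are allowed, so triangularity is the only condition left
to check. -/
theorem Fixes.edgePt_of_coeff_eq_zero {u : Tame k} (hu : Fixes u (weightM11 m hm))
    (h : coeff (Finsupp.single 1 1) (u.1 (MvPolynomial.X 2)) = 0) :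
    Fixes u (edgePt m (m + 1)) := by
  obtain ⟨h0, h1, h2⟩ := (fixes_iff hm (adjacent_weight hm)).1 hu
  refine (fixes_iff hm (adjacent_edgePt m hm (by omega))).2 ⟨fun n hn => ?_, h1, fun n hn => ?_⟩
  · refine (h0 n hn).imp_right (And.imp_right (Or.imp_right fun h => ⟨h.1, ?_⟩))
    rw [px_edgePt_nonneg_iff' hm (by omega) (by omega)]
    omega
  · refine ⟨(h2 n hn).1, (h2 n hn).2.1, .inl ?_⟩
    by_contra hne
    have : n = Finsupp.single 1 1 := by
      have := (h2 n hn).2.1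
      ext i
      fin_cases i
      · simp [(h2 n hn).1]
      · simp
        omega
      · simp
        omega
    rw [this] at hn
    exact mem_support_iff.1 hn h

theorem coeff_swapTame (P : Poly k) (a b : ℕ) :
    coeff (Finsupp.single 1 a + Finsupp.single 2 b) ((swapTame k).1 P) =
      coeff (Finsupp.single 1 b + Finsupp.single 2 a) P := by
  have := coeff_rename_mapDomain (Equiv.swap 1 2) (Equiv.swap (1 : Fin 3) 2).injective P
    (Finsupp.single 1 b + Finsupp.single 2 a)
  rw [Finsupp.mapDomain_add, Finsupp.mapDomain_single, Finsupp.mapDomain_single,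
    Equiv.swap_apply_left, Equiv.swap_apply_right, add_comm (Finsupp.single 2 b)] at this
  exact this

include hm in
theorem Fixes.lt_of_coeff_ne_zero {u : Tame k} {s : ℕ} (hs : s ≤ m + 2)
    (hu : Fixes u (edgePt m s)) {j : ℕ} (hj : j ≤ m)
    (h : coeff (Finsupp.single 1 j + Finsupp.single 2 (m - j)) (u.1 (MvPolynomial.X 0)) ≠ 0) :
    j < s := by
  have := ((fixes_iff hm (adjacent_edgePt m hm hs)).1 hu).1 _ (mem_support_iff.2 h)
  rw [← px_edgePt_nonneg_iff' hm hs hj]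
  simp at this
  rcases this with h | h
  · omega
  · exact sub_nonneg.2 h.2

/-- At height 0 there is no triangularity condition; only the degree-m part of the first component
is an obstruction. -/
theorem Fixes.edgePt_zero_of_leadForm {u : Tame k} (hu : Fixes u (weightM11 m hm))
    (h : leadForm m (u.1 (MvPolynomial.X 0)) = 0) : Fixes u (edgePt m 0) := by
  obtain ⟨h0, h1, h2⟩ := (fixes_iff hm (adjacent_weight hm)).1 hu
  refine (fixes_iff hm (adjacent_edgePt m hm (by omega))).2
    ⟨fun n hn => ?_, h1, fun n hn => ⟨(h2 n hn).1, (h2 n hn).2.1, .inr ?_⟩⟩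
  · refine (h0 n hn).imp_right fun ⟨hn0, h'⟩ => ⟨hn0, .inl (h'.resolve_right fun hn' => ?_)⟩
    have hc := congrArg (fun p => p.coeff (n 1)) h
    simp only [coeff_leadForm, Polynomial.coeff_zero] at hc
    rw [if_pos (by omega)] at hc
    have : Finsupp.single 1 (n 1) + Finsupp.single 2 (m - n 1) = n := by
      ext i
      fin_cases i
      · simp [hn0]
      · simp
      · simp
        omega
    rw [this] at hc
    exact mem_support_iff.1 hn hc
  · exact (py_edgePt_eq_zero_iff hm (by omega)).2 (.inl rfl)

include hm in
theorem fixes_of_lv_eq {f g : Tame k} {s : ℕ} (hs : s ≤ m + 2) (h : lv m f s = lv m g s) :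
    Fixes (g * f⁻¹) (edgePt m s) :=
  (pt_eq_pt_iff (adjacent_edgePt m hm hs).1).1 ((lv_eq_iff hm hs hs).1 h).2

include hm in
theorem lv_eq_of_fixes {f g : Tame k} {s : ℕ} (hs : s ≤ m + 2)
    (h : Fixes (g * f⁻¹) (edgePt m s)) : lv m f s = lv m g s :=
  (lv_eq_iff hm hs hs).2 ⟨rfl, (pt_eq_pt_iff (adjacent_edgePt m hm hs).1).2 h⟩

include hm in
/-- A cycle with three peaks cannot have three low peaks. -/
theorem add_two_le_sum_heights [CharZero k] {f₁ g₁ f₂ g₂ f₃ g₃ : Tame k} {s₁ s₂ s₃ : ℕ}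
    (p₁ : 1 ≤ s₁) (p₂ : 1 ≤ s₂) (p₃ : 1 ≤ s₃) (q₁ : s₁ ≤ m + 1) (q₂ : s₂ ≤ m + 1) (q₃ : s₃ ≤ m + 1)
    (e₁ : lv m f₁ s₁ = lv m g₁ s₁) (e₂ : lv m f₂ s₂ = lv m g₂ s₂) (e₃ : lv m f₃ s₃ = lv m g₃ s₃)
    (b₁ : lv m g₁ 0 = lv m f₂ 0) (b₂ : lv m g₂ 0 = lv m f₃ 0) (b₃ : lv m g₃ 0 = lv m f₁ 0)
    (d₁ : le m g₁ 0 ≠ le m f₂ 0) (d₂ : le m g₂ 0 ≠ le m f₃ 0) (d₃ : le m g₃ 0 ≠ le m f₁ 0)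
    (hne : lv m f₁ 0 ≠ lv m g₁ 0) : m + 2 ≤ s₁ + s₂ + s₃ := by
  -- An apartment through the valley between the first two mountains serves as coordinate system. In
  -- it the first mountain gives a form of low degree in X₁, and the second, lying in the transposed
  -- half, one of low degree in X₂.
  obtain ⟨f, hf₁, hf₂⟩ := exists_apartment hm b₁ d₁
  set τ := swapTame k with hτ
  have fu₁ : Fixes (f * f₁⁻¹) (edgePt m s₁) :=
    fixes_of_lv_eq hm (by omega) (e₁.trans (lv_eq_of_le_zero_eq hm hf₁ (by omega)))
  have fu₃ : Fixes (τ * f * g₂⁻¹) (edgePt m s₂) :=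
    fixes_of_lv_eq hm (by omega) (e₂.symm.trans (lv_eq_of_le_zero_eq hm hf₂ (by omega)))
  have fb : Fixes (f₃ * g₃⁻¹) (edgePt m s₃) := fixes_of_lv_eq hm (by omega) e₃.symm
  have fc₁ : Fixes (g₃ * f₁⁻¹) (edgePt m 0) := fixes_of_lv_eq hm (by omega) b₃.symm
  have fc₂ : Fixes (g₂ * f₃⁻¹) (edgePt m 0) := fixes_of_lv_eq hm (by omega) b₂.symm
  have hττ : τ * τ = 1 := swapTame_mul_self
  have hτw : Fixes τ (weightM11 m hm) := by
    rw [hτ, fixes_swapTame_iff (weight_mem_nablaPlus m hm), py, rep_weight_one, sub_self]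
  have a0 := adjacent_edgePt m hm (s := 0) (by omega)
  have wu₃ := fu₃.weight hm (adjacent_edgePt m hm (by omega))
  have wb := fb.weight hm (adjacent_edgePt m hm (by omega))
  have wv : Fixes (τ * (τ * f * g₂⁻¹)) (weightM11 m hm) := hτw.mul wu₃
  have hz : f * f₃⁻¹ = τ * (τ * f * g₂⁻¹) * (g₂ * f₃⁻¹) := by
    calc f * f₃⁻¹ = τ * τ * f * f₃⁻¹ := by rw [hττ, one_mul]
      _ = _ := by group
  have wz : Fixes (f * f₃⁻¹) (weightM11 m hm) := by
    rw [hz]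
    exact wv.mul (fc₂.weight hm a0)
  have hzb : f * g₃⁻¹ = f * f₃⁻¹ * (f₃ * g₃⁻¹) := by group
  have hu₁ : f * f₁⁻¹ = f * g₃⁻¹ * (g₃ * f₁⁻¹) := by group
  have wzb : Fixes (f * g₃⁻¹) (weightM11 m hm) := hzb ▸ wz.mul wb
  have hdvd {v b : Tame k} (hv : Fixes v (weightM11 m hm)) {s : ℕ} (hs : s ≤ m + 1)
      (hb : Fixes b (edgePt m s)) {D : Polynomial k}
      (hD : ∀ j, j < s → j ≤ m → D ∣ leadForm 1 (v.1 (MvPolynomial.X 1)) ^ j *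
        leadForm 1 (v.1 (MvPolynomial.X 2)) ^ (m - j)) :
      D ∣ leadForm m ((v * b).1 (MvPolynomial.X 0)) -
        Polynomial.C (coeff (Finsupp.single 0 1) (b.1 (MvPolynomial.X 0))) *
          leadForm m (v.1 (MvPolynomial.X 0)) := by
    refine dvd_leadForm_sub (hv.natDegree_theta_le hm (.inl rfl))
      (hv.natDegree_theta_le hm (.inr rfl)) fun n hn => ?_
    refine (((fixes_iff hm (adjacent_edgePt m hm (by omega))).1 hb).1 n hn).imp_right
      (And.imp_right (Or.imp_right fun h => ⟨h.1, ?_⟩))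
    have hlt := h.2
    rw [px_edgePt_nonneg_iff' hm (by omega) (by omega)] at hlt
    rw [show n 2 = m - n 1 by omega]
    exact hD _ hlt (by omega)
  -- No monomial of degree m is allowed at height 0, so `D = 0` is permitted and the divisibility
  -- becomes an equality: passing through a valley only multiplies the leading form by a scalar.
  have k₁ := hdvd wzb (by omega) fc₁ (D := 0) fun j hj => absurd hj j.not_lt_zero
  have k₂ := hdvd wv (by omega) fc₂ (D := 0) fun j hj => absurd hj j.not_lt_zero
  -- The linear form attached to the third mountain. Its element `f₃ * g₃⁻¹` has only monomials X₁^j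
  -- X₂^(m-j) with j < s₃ in degree m, and substitution turns X₂ into Λ.
  set Λ := leadForm 1 ((f * f₃⁻¹).1 (MvPolynomial.X 2)) with hΛ
  have k₃ := hdvd wz q₃ fb (D := Λ ^ (m - (s₃ - 1))) fun j hj hjm =>
    Dvd.dvd.mul_left (pow_dvd_pow _ (by omega)) _
  rw [zero_dvd_iff, sub_eq_zero] at k₁ k₂
  rw [← hu₁] at k₁
  rw [← hz] at k₂
  rw [← hzb, k₂] at k₃
  have hl₁ : lv m f₁ (m + 1) = lv m f (m + 1) :=
    (lv_eq_of_lv_eq hm p₁ q₁ (by omega) e₁).trans (lv_eq_of_le_zero_eq hm hf₁ (by omega))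
  have hl₂ : lv m g₂ (m + 1) = lv m (τ * f) (m + 1) :=
    (lv_eq_of_lv_eq hm p₂ q₂ (by omega) e₂).symm.trans (lv_eq_of_le_zero_eq hm hf₂ (by omega))
  have hl₃ : lv m f₃ (m + 1) = lv m g₃ (m + 1) := lv_eq_of_lv_eq hm p₃ q₃ (by omega) e₃
  -- If Λ were proportional to one of the two coordinate forms, the third mountain would agree at
  -- height m+1 with one of its neighbours, and by `le_zero_eq` they would share the edge at their
  -- common valley: a backtracking.
  have hc1 : Λ.coeff 1 ≠ 0 := by
    rw [hΛ, coeff_leadForm, if_pos le_rfl]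
    intro h
    simp only [Nat.sub_self, Finsupp.single_zero, add_zero] at h
    have := lv_eq_of_fixes hm (by omega) (wz.edgePt_of_coeff_eq_zero hm h)
    exact d₃ (le_zero_eq hm b₃ (hl₃.symm.trans (this.trans hl₁.symm)))
  have hc0 : Λ.coeff 0 ≠ 0 := by
    rw [hΛ, coeff_leadForm, if_pos zero_le_one, ← coeff_swapTame]
    intro h
    simp only [Nat.sub_zero, Finsupp.single_zero, add_zero] at h
    have hw : Fixes (τ * f * f₃⁻¹) (weightM11 m hm) := by
      rw [mul_assoc]
      exact hτw.mul wz
    have := lv_eq_of_fixes hm (by omega) (hw.edgePt_of_coeff_eq_zero hm (by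
      rw [mul_assoc]
      exact h))
    exact d₂ (le_zero_eq hm b₂ (hl₂.trans this.symm))
  have hdeg : Λ.natDegree = 1 :=
    le_antisymm (natDegree_leadForm_le _ _) (Polynomial.le_natDegree_of_ne_zero hc1)
  by_contra hlt
  set B := leadForm m ((τ * (τ * f * g₂⁻¹)).1 (MvPolynomial.X 0))
  set A := leadForm m ((f * f₁⁻¹).1 (MvPolynomial.X 0)) with hA
  have hAB := Dvd.dvd.mul_left k₃
    (Polynomial.C (coeff (Finsupp.single 0 1) ((g₃ * f₁⁻¹).1 (MvPolynomial.X 0))))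
  rw [mul_sub, ← k₁, ← mul_assoc, ← mul_assoc, ← Polynomial.C_mul, ← Polynomial.C_mul] at hAB
  -- The exponents of X₁ in A are below s₁. The transposition turns the same kind of bound for the
  -- second mountain into divisibility of B by X^(m-s₂+1). The negation of the claim is the
  -- numerical hypothesis for i = s - 1.
  have hA0 : A = 0 := by
    refine eq_zero_of_pow_dvd (i₁ := s₁ - 1) (i₂ := s₂ - 1) (i₃ := s₃ - 1) (by omega) ?_
      ((Polynomial.natDegree_C_mul_le _ _).trans (natDegree_leadForm_le m _)) ?_ hc0 hdeg hAB
    · refine Polynomial.natDegree_le_iff_coeff_eq_zero.2 fun j hj => ?_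
      rw [hA, coeff_leadForm]
      split_ifs with hjm
      · by_contra hcj
        have := fu₁.lt_of_coeff_ne_zero hm (by omega) hjm hcj
        omega
      · rfl
    · refine Dvd.dvd.mul_left (Polynomial.X_pow_dvd_iff.2 fun j hj => ?_) _
      rw [coeff_leadForm, if_pos (by omega)]
      have := coeff_swapTame ((τ * f * g₂⁻¹).1 (MvPolynomial.X 0)) j (m - j)
      refine this.trans ?_
      by_contra hcj
      have := fu₃.lt_of_coeff_ne_zero hm (j := m - j) (by omega) (by omega) (by
        rwa [show m - (m - j) = j by omega])
      omega
  -- Once A vanishes, `f * f₁⁻¹` fixes height 0, so the first mountain would end where it starts.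
  refine hne ((lv_eq_of_fixes hm (by omega) (Fixes.edgePt_zero_of_leadForm hm
    (fu₁.weight hm (adjacent_edgePt m hm (by omega))) hA0)).trans
    (lv_eq_of_le_eq hm (by omega) hf₁).symm)

end heights

end TameX

namespace TameX
open Filter Topology

/-! ### Walks in the link -/

variable {k : Type*} [Field k] {m : ℕ} (hm : 2 ≤ m) {ν : X k}

/-- An infinite walk without backtracking in the link. -/
structure LinkWalk (ν : X k) where
  /-- the vertices -/
  vert : ℕ → Set (X k)
  /-- the edges -/
  edge : ℕ → Set (X k)
  inc_left : ∀ j, LinkInc ν (edge j) (vert j)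
  inc_right : ∀ j, LinkInc ν (edge j) (vert (j + 1))
  vert_ne : ∀ j, vert j ≠ vert (j + 1)
  edge_ne : ∀ j, edge j ≠ edge (j + 1)

variable (m) in
/-- From time `p` on the walk climbs in the chamber of `f` from height `0` to height `s`, and then
descends in the chamber of `g` to height `0`. -/
structure Mountain (W : LinkWalk ν) (p : ℕ) (f g : Tame k) (s : ℕ) : Prop where
  one_le : 1 ≤ s
  le_top : s ≤ m + 2
  peak : lv m f s = lv m g s
  edge_up : ∀ j < s, W.edge (p + j) = le m f j
  vert_up : ∀ j ≤ s, W.vert (p + j) = lv m f j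
  edge_down : ∀ j < s, W.edge (p + s + j) = le m g (s - 1 - j)
  vert_down : ∀ j ≤ s, W.vert (p + s + j) = lv m g (s - j)

variable {hm}

theorem LinkInc.exists_ends {h : Tame k} (hν : ν = pt h (weightM11 m hm)) {c x y : Set (X k)}
    (hx : LinkInc ν c x) (hy : LinkInc ν c y) (hxy : x ≠ y) :
    ∃ f, pt f (weightM11 m hm) = ν ∧ ∃ s ≤ m + 1, c = le m f s ∧
      ((x = lv m f s ∧ y = lv m f (s + 1)) ∨ (x = lv m f (s + 1) ∧ y = lv m f s)) := by
  obtain ⟨f, hf, s, hs, rfl, h⟩ := hx.exists_le hν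
  refine ⟨f, hf, s, hs, rfl, ?_⟩
  rcases h with rfl | rfl <;> rcases hy.eq_lv hν hs with rfl | rfl
  · exact absurd rfl hxy
  · exact .inl ⟨rfl, rfl⟩
  · exact .inr ⟨rfl, rfl⟩
  · exact absurd rfl hxy

theorem LinkWalk.vert_of_edge_down {h : Tame k} (hν : ν = pt h (weightM11 m hm)) (W : LinkWalk ν)
    {q s n : ℕ} {g : Tame k} (hn : n ≤ s) (hs : s ≤ m + 2) (h0 : W.vert q = lv m g s)
    (he : ∀ j < n, W.edge (q + j) = le m g (s - 1 - j)) :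
    ∀ j ≤ n, W.vert (q + j) = lv m g (s - j) := by
  intro j
  induction j with
  | zero => exact fun _ => h0
  | succ j ih =>
    intro hj
    have h1 := ih (by omega)
    have h2 := W.inc_right (q + j)
    rw [he j (by omega)] at h2
    rcases h2.eq_lv hν (by omega) with h3 | h3
    · rw [← add_assoc, h3]
      congr 1
      omega
    · rw [show s - 1 - j + 1 = s - j by omega, ← h1] at h3
      exact absurd h3.symm (W.vert_ne _)

/-- While climbing, the only alternative to the next face of the same chamber is to turn down, since
the upward edge is unique. After the turn, going up again would mean taking the previous edge back,
so the descent continues to height 0. -/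
theorem LinkWalk.exists_mountain {h : Tame k} (hν : ν = pt h (weightM11 m hm)) (W : LinkWalk ν)
    {p : ℕ} {f₀ : Tame k} (hp : W.vert p = lv m f₀ 0) :
    ∃ f g s, pt f (weightM11 m hm) = ν ∧ pt g (weightM11 m hm) = ν ∧ Mountain m W p f g s := by
  classical
  obtain ⟨f, hf, r, hr, hedge, hends⟩ := (W.inc_left p).exists_ends hν (W.inc_right p) (W.vert_ne p)
  have hr0 : r = 0 ∧ W.vert p = lv m f 0 := by
    rcases hends with ⟨h1, -⟩ | ⟨h1, -⟩
    · have := ((lv_eq_iff hm (by omega) (by omega)).1 (hp.symm.trans h1)).1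
      subst this
      exact ⟨rfl, h1⟩
    · have := ((lv_eq_iff hm (by omega) (by omega)).1 (hp.symm.trans h1)).1
      omega
  obtain ⟨rfl, hx0⟩ := hr0
  -- The peak is the first time at which the walk leaves the faces of the chamber of `f`; the bound
  -- m+2 makes it exist even if the walk climbs to the top.
  have hex : ∃ s, ¬(s < m + 2 ∧ W.edge (p + s) = le m f s) := ⟨m + 2, fun h => lt_irrefl _ h.1⟩
  obtain ⟨s, hs, hmin⟩ : ∃ s, ¬(s < m + 2 ∧ W.edge (p + s) = le m f s) ∧
      ∀ j < s, j < m + 2 ∧ W.edge (p + j) = le m f j :=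
    ⟨Nat.find hex, Nat.find_spec hex, fun j hj => not_not.1 (Nat.find_min hex hj)⟩
  have hs1 : 1 ≤ s := by
    by_contra h0
    obtain rfl : s = 0 := by omega
    exact hs ⟨by omega, hedge⟩
  have hs2 : s ≤ m + 2 := by
    have := (hmin (s - 1) (by omega)).1
    omega
  have hvert : ∀ j ≤ s, W.vert (p + j) = lv m f j := by
    intro j
    induction j with
    | zero => exact fun _ => hx0
    | succ j ih =>
      intro hj
      have h1 := ih (by omega)
      have h2 := W.inc_right (p + j)
      rw [(hmin j (by omega)).2] at h2
      rcases h2.eq_lv hν (by omega) with h3 | h3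
      · exact absurd (h1.trans h3.symm) (W.vert_ne _)
      · exact h3
  -- The chamber is replaced at each step down. A lower vertex determines everything above it, so
  -- the new chamber also accounts for the part of the descent already made.
  have hdown : ∀ i < s, ∃ g, pt g (weightM11 m hm) = ν ∧ lv m f s = lv m g s ∧
      ∀ j ≤ i, W.edge (p + s + j) = le m g (s - 1 - j) := by
    intro i
    induction i with
    | zero =>
      intro _
      obtain ⟨g, hg, r, hr, hedge', hends'⟩ :=
        (W.inc_left (p + s)).exists_ends hν (W.inc_right (p + s)) (W.vert_ne (p + s))
      rw [hvert s le_rfl] at hends'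
      rcases hends' with ⟨h1, -⟩ | ⟨h1, -⟩
      · obtain rfl := ((lv_eq_iff hm (by omega) (by omega)).1 h1).1
        exact absurd ⟨by omega, hedge'.trans (le_eq_of_lv_eq hm hs1 hr h1).symm⟩ hs
      · obtain rfl := ((lv_eq_iff hm (by omega) (by omega)).1 h1).1
        refine ⟨g, hg, h1, fun j hj => ?_⟩
        obtain rfl : j = 0 := by omega
        exact hedge'
    | succ i ih =>
      intro hi
      obtain ⟨g, hg, hpeak, he⟩ := ih (by omega)
      have hv := W.vert_of_edge_down hν (q := p + s) (n := i + 1) (g := g) (by omega) hs2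
        ((hvert s le_rfl).trans hpeak) (fun j hj => he j (by omega)) (i + 1) le_rfl
      obtain ⟨g', hg', r, hr, hedge', hends'⟩ := (W.inc_left (p + s + (i + 1))).exists_ends hν
        (W.inc_right (p + s + (i + 1))) (W.vert_ne (p + s + (i + 1)))
      rw [hv] at hends'
      rcases hends' with ⟨h1, -⟩ | ⟨h1, -⟩
      · obtain rfl := ((lv_eq_iff hm (by omega) (by omega)).1 h1).1
        have h2 := le_eq_of_lv_eq hm (by omega) hr h1
        have h3 := he i le_rfl
        rw [show s - 1 - i = s - (i + 1) by omega, h2, ← hedge'] at h3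
        exact absurd h3 (W.edge_ne _)
      · have hr' := ((lv_eq_iff hm (by omega) (by omega)).1 h1).1
        rw [← hr'] at h1
        refine ⟨g', hg', hpeak.trans (lv_eq_of_lv_eq hm (by omega) (by omega) hs2 h1),
          fun j hj => ?_⟩
        rcases hj.eq_or_lt with rfl | hj
        · rw [hedge']
          congr 1
          omega
        · rw [he j (by omega)]
          exact le_eq_of_le_eq hm (by omega : s - (i + 1) ≤ s - 1 - j) (by omega)
            (le_eq_of_lv_eq hm (by omega) (by omega) h1)
  obtain ⟨g, hg, hpeak, he⟩ := hdown (s - 1) (by omega)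
  exact ⟨f, g, s, hf, hg, hs1, hs2, hpeak, fun j hj => (hmin j hj).2, hvert,
    fun j hj => he j (by omega), W.vert_of_edge_down hν (q := p + s) le_rfl hs2
      ((hvert s le_rfl).trans hpeak) fun j hj => he j (by omega)⟩

theorem Mountain.vert_end {W : LinkWalk ν} {p : ℕ} {f g : Tame k} {s : ℕ}
    (M : Mountain m W p f g s) : W.vert (p + 2 * s) = lv m g 0 := by
  have := M.vert_down s le_rfl
  rwa [add_assoc, ← two_mul, Nat.sub_self] at this

theorem Mountain.vert_start {W : LinkWalk ν} {p : ℕ} {f g : Tame k} {s : ℕ}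
    (M : Mountain m W p f g s) : W.vert p = lv m f 0 := M.vert_up 0 s.zero_le

theorem Mountain.edge_start {W : LinkWalk ν} {p : ℕ} {f g : Tame k} {s : ℕ}
    (M : Mountain m W p f g s) : W.edge p = le m f 0 := M.edge_up 0 M.one_le

theorem Mountain.edge_end_ne {W : LinkWalk ν} {p : ℕ} {f g : Tame k} {s : ℕ}
    (M : Mountain m W p f g s) : le m g 0 ≠ W.edge (p + 2 * s) := by
  have h1 := M.one_le
  have := M.edge_down (s - 1) (by omega)
  rw [Nat.sub_self] at this
  rw [← this, show p + 2 * s = p + s + (s - 1) + 1 by omega]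
  exact W.edge_ne _

include hm in
-- Height 0 is attained only at the two ends of a mountain, so the end of the period cannot fall
-- strictly inside one.
theorem Mountain.le_of_vert_eq {W : LinkWalk ν} {p : ℕ} {f g f₀ : Tame k} {s : ℕ}
    (M : Mountain m W p f g s) {N : ℕ} (hp : p < N) (hN : W.vert N = lv m f₀ 0) :
    p + 2 * s ≤ N := by
  have := M.le_top
  by_contra hlt
  rcases le_or_gt N (p + s) with h1 | h1
  · have h2 := M.vert_up (N - p) (by omega)
    rw [show p + (N - p) = N by omega, hN] at h2
    have := ((lv_eq_iff hm (by omega) (by omega)).1 h2).1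
    omega
  · have h2 := M.vert_down (N - p - s) (by omega)
    rw [show p + s + (N - p - s) = N by omega, hN] at h2
    have := ((lv_eq_iff hm (by omega) (by omega)).1 h2).1
    omega

/-! ### Lengths -/

open InnerProductGeometry

theorem angle_le_angleX_lv {f : Tame k} (hf : pt f (weightM11 m hm) = ν) {s t : ℕ}
    (hs : s ≤ m + 2) (ht : t ≤ m + 2) :
    angle (tangent m s) (tangent m t) ≤ angleX ν (lv m f s) (lv m f t) :=
  hf ▸ angle_le_angleX m hm f hs ht

theorem LinkWalk.angleX_nonneg {h : Tame k} (hν : ν = pt h (weightM11 m hm)) (W : LinkWalk ν)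
    (j : ℕ) : 0 ≤ angleX ν (W.vert j) (W.vert (j + 1)) := by
  obtain ⟨f, hf, s, hs, -, ⟨h1, h2⟩ | ⟨h1, h2⟩⟩ :=
    (W.inc_left j).exists_ends hν (W.inc_right j) (W.vert_ne j)
  · rw [h1, h2]
    exact (angle_nonneg _ _).trans (angle_le_angleX_lv hf (by omega) (by omega))
  · rw [h1, h2]
    exact (angle_nonneg _ _).trans (angle_le_angleX_lv hf (by omega) (by omega))

/-- The length of the walk up to time `p`. -/
noncomputable def LinkWalk.len (W : LinkWalk ν) (p : ℕ) : ℝ :=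
  ∑ j ∈ Finset.range p, angleX ν (W.vert j) (W.vert (j + 1))

theorem LinkWalk.len_mono {h : Tame k} (hν : ν = pt h (weightM11 m hm)) (W : LinkWalk ν) {p q : ℕ}
    (hpq : p ≤ q) : W.len p ≤ W.len q :=
  Finset.sum_le_sum_of_subset_of_nonneg (Finset.range_mono hpq) fun j _ _ => W.angleX_nonneg hν j

/-- Each edge is at least as long as the angle between its two tangent directions; the triangle
inequality for angles adds these up separately on the ascent and on the descent. -/
theorem Mountain.len_le {W : LinkWalk ν} {p : ℕ} {f g : Tame k} {s : ℕ}
    (hf : pt f (weightM11 m hm) = ν) (hg : pt g (weightM11 m hm) = ν) (M : Mountain m W p f g s) :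
    W.len p + 2 * angle (tangent m 0) (tangent m s) ≤ W.len (p + 2 * s) := by
  have hs := M.le_top
  have hup : ∀ j ≤ s, W.len p + angle (tangent m 0) (tangent m j) ≤ W.len (p + j) := by
    intro j
    induction j with
    | zero => simp [angle_self (tangent_ne_zero m hm (Nat.zero_le _))]
    | succ j ih =>
      intro hj
      have h1 := ih (by omega)
      have h2 : W.len (p + (j + 1)) = W.len (p + j) +
          angleX ν (W.vert (p + j)) (W.vert (p + (j + 1))) := Finset.sum_range_succ _ _
      rw [M.vert_up j (by omega), M.vert_up (j + 1) hj] at h2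
      have h3 := angle_le_angleX_lv hf (s := j) (t := j + 1) (by omega) (by omega)
      have h4 := angle_le_angle_add_angle (tangent m 0) (tangent m j) (tangent m (j + 1))
      linarith
  have hdown : ∀ j ≤ s, W.len (p + s) + angle (tangent m s) (tangent m (s - j)) ≤
      W.len (p + s + j) := by
    intro j
    induction j with
    | zero => simp [angle_self (tangent_ne_zero m hm hs)]
    | succ j ih =>
      intro hj
      have h1 := ih (by omega)
      have h2 : W.len (p + s + (j + 1)) = W.len (p + s + j) +
          angleX ν (W.vert (p + s + j)) (W.vert (p + s + (j + 1))) := Finset.sum_range_succ _ _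
      rw [M.vert_down j (by omega), M.vert_down (j + 1) hj] at h2
      have h3 := angle_le_angleX_lv hg (s := s - j) (t := s - (j + 1)) (by omega) (by omega)
      have h4 := angle_le_angle_add_angle (tangent m s) (tangent m (s - j))
        (tangent m (s - (j + 1)))
      linarith
  have h1 := hup s le_rfl
  have h2 := hdown s le_rfl
  rw [Nat.sub_self, angle_comm] at h2
  rw [two_mul s, ← add_assoc]
  linarith

/-! ### Cycles -/

open scoped Fin.CommRing

/-- The periodic walk along a cycle. -/
def LinkCycle.walk (γ : LinkCycle ν) (i : Fin (γ.n + 2)) : LinkWalk ν where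
  vert j := γ.vert (i + (j : Fin (γ.n + 2)))
  edge j := γ.edge (i + (j : Fin (γ.n + 2)))
  inc_left _ := γ.inc_left _
  inc_right j := by
    have := γ.inc_right (i + (j : Fin (γ.n + 2)))
    rwa [add_assoc, ← Nat.cast_succ] at this
  vert_ne j h := by
    have := γ.vert_injective h
    rw [Nat.cast_succ, ← add_assoc] at this
    simp at this
  edge_ne j h := by
    have := γ.edge_injective h
    rw [Nat.cast_succ, ← add_assoc] at this
    simp at this

theorem LinkCycle.walk_vert_period (γ : LinkCycle ν) (i : Fin (γ.n + 2)) :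
    (γ.walk i).vert (γ.n + 2) = (γ.walk i).vert 0 := by
  simp only [walk]
  rw [Fin.natCast_self, Nat.cast_zero]

theorem LinkCycle.walk_edge_period (γ : LinkCycle ν) (i : Fin (γ.n + 2)) :
    (γ.walk i).edge (γ.n + 2) = (γ.walk i).edge 0 := by
  simp only [walk]
  rw [Fin.natCast_self, Nat.cast_zero]

theorem LinkCycle.natCast_injOn (γ : LinkCycle ν) (i : Fin (γ.n + 2)) {a b : ℕ} (ha : a < γ.n + 2)
    (hb : b < γ.n + 2) (h : i + (a : Fin (γ.n + 2)) = i + (b : Fin (γ.n + 2))) : a = b := by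
  have := congrArg Fin.val (add_left_cancel h)
  rwa [Fin.val_natCast, Fin.val_natCast, Nat.mod_eq_of_lt ha, Nat.mod_eq_of_lt hb] at this

theorem LinkCycle.walk_vert_inj (γ : LinkCycle ν) (i : Fin (γ.n + 2)) {a b : ℕ} (ha : a < γ.n + 2)
    (hb : b < γ.n + 2) (h : (γ.walk i).vert a = (γ.walk i).vert b) : a = b :=
  γ.natCast_injOn i ha hb (γ.vert_injective h)

theorem LinkCycle.walk_edge_inj (γ : LinkCycle ν) (i : Fin (γ.n + 2)) {a b : ℕ} (ha : a < γ.n + 2)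
    (hb : b < γ.n + 2) (h : (γ.walk i).edge a = (γ.walk i).edge b) : a = b :=
  γ.natCast_injOn i ha hb (γ.edge_injective h)

theorem LinkCycle.exists_walk_eq (γ : LinkCycle ν) (i i' : Fin (γ.n + 2)) :
    ∃ j < γ.n + 2, γ.vert i' = (γ.walk i).vert j ∧ γ.edge i' = (γ.walk i).edge j := by
  refine ⟨(i' - i).val, (i' - i).isLt, ?_⟩
  simp [walk]

theorem LinkCycle.length_eq (γ : LinkCycle ν) (i : Fin (γ.n + 2)) :
    γ.length = (γ.walk i).len (γ.n + 2) := by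
  rw [LinkCycle.length, ← Equiv.sum_comp (Equiv.addLeft i), LinkWalk.len, Finset.sum_range]
  refine Finset.sum_congr rfl fun j _ => ?_
  simp only [walk, Equiv.coe_addLeft, Nat.cast_succ, Fin.cast_val_eq_self, add_assoc]

/-- At a vertex of minimal height both edges of the cycle go up. If that height were positive, the
upward edge would be unique and the two edges would coincide. -/
theorem LinkCycle.exists_low {h : Tame k} (hν : ν = pt h (weightM11 m hm)) (γ : LinkCycle ν) :
    ∃ i f, γ.vert i = lv m f 0 := by
  have hex (i : Fin (γ.n + 2)) := (γ.inc_left i).isLinkVertex.exists_lv hν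
  choose f hf s hs hv using hex
  obtain ⟨i, hi⟩ := Finite.exists_min s
  by_cases h0 : s i = 0
  · exact ⟨i, f i, h0 ▸ hv i⟩
  exfalso
  have key : ∀ (c : Set (X k)) (i' : Fin (γ.n + 2)), LinkInc ν c (γ.vert i) →
      LinkInc ν c (γ.vert i') → i ≠ i' → c = le m (f i) (s i) := by
    intro c i' h1 h2 hne
    obtain ⟨g, -, r, hr, hc, ⟨e1, e2⟩ | ⟨e1, e2⟩⟩ :=
      h1.exists_ends hν h2 fun h => hne (γ.vert_injective h)
    · rw [hv i] at e1
      obtain rfl := ((lv_eq_iff hm (hs i) (by omega)).1 e1).1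
      rw [hc, le_eq_of_lv_eq hm (by omega) hr e1]
    · rw [hv] at e1 e2
      have h3 := ((lv_eq_iff hm (hs i) (by omega)).1 e1).1
      have h4 := ((lv_eq_iff hm (hs i') (by omega)).1 e2).1
      have := hi i'
      omega
  have h1 := key (γ.edge i) (i + 1) (γ.inc_left i) (γ.inc_right i) (by simp)
  have h2 := key (γ.edge (i - 1)) (i - 1) (by simpa using γ.inc_right (i - 1))
    (γ.inc_left (i - 1)) (by simp [eq_sub_iff_add_eq])
  have := γ.edge_injective (h1.trans h2.symm)
  simp [eq_sub_iff_add_eq] at this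

end TameX

namespace TameX
open Filter Topology InnerProductGeometry

/-! ### Short cycles -/

variable {k : Type*} [Field k] {m : ℕ} {hm : 2 ≤ m} {ν : X k}

/-- The first and last edges meet at the valley and differ, so they are opposite in some apartment,
and both slopes follow its two halves. These meet again only at height m+2, which must be the peak.
-/
theorem LinkCycle.toSubLink_of_one_mountain {γ : LinkCycle ν} {i : Fin (γ.n + 2)} {f g : Tame k}
    {s : ℕ} (hf : pt f (weightM11 m hm) = ν) (M : Mountain m (γ.walk i) 0 f g s)
    (hN : 2 * s = γ.n + 2) :
    ∃ f, pt f (weightM11 m hm) = ν ∧ γ.toSubLink = apartmentLink ν f := by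
  have hs1 := M.one_le
  have hs2 := M.le_top
  have hend := M.vert_end
  have hedge := M.edge_end_ne
  rw [zero_add, hN] at hend hedge
  rw [γ.walk_vert_period, M.vert_start] at hend
  rw [γ.walk_edge_period, M.edge_start] at hedge
  obtain ⟨f', h1, h2⟩ := exists_apartment hm hend hedge.symm
  have hf' : pt f' (weightM11 m hm) = ν :=
    (pt_weight_eq_of_le_eq hm (by omega) h1).symm.trans hf
  have v1 {j : ℕ} (hj : j ≤ m + 2) := lv_eq_of_le_zero_eq hm h1 hj
  have v2 {j : ℕ} (hj : j ≤ m + 2) := lv_eq_of_le_zero_eq hm h2 hj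
  have e1 {j : ℕ} (hj : j ≤ m + 1) := le_eq_of_le_eq hm j.zero_le hj h1
  have e2 {j : ℕ} (hj : j ≤ m + 1) := le_eq_of_le_eq hm j.zero_le hj h2
  have hs : s = m + 2 := by
    have h3 := M.peak
    rw [v1 hs2, v2 hs2, lv_eq_lv_swap_iff hm f' hs2] at h3
    omega
  subst hs
  refine ⟨f', hf', SubLink.ext ?_ ?_⟩
  · ext x
    rw [mem_apartmentLink_verts hf']
    constructor
    · rintro ⟨i', rfl⟩
      refine ⟨(γ.inc_left i').isLinkVertex, ?_⟩
      obtain ⟨j, hj, hx, -⟩ := γ.exists_walk_eq i i'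
      rw [hx]
      rcases le_or_gt j (m + 2) with h | h
      · exact ⟨j, h, .inl (by have := M.vert_up j h; rwa [zero_add, v1 h] at this)⟩
      · refine ⟨m + 2 - (j - (m + 2)), by omega, .inr ?_⟩
        have := M.vert_down (j - (m + 2)) (by omega)
        rwa [show 0 + (m + 2) + (j - (m + 2)) = j by omega, v2 (by omega)] at this
    · rintro ⟨-, j, hj, rfl | rfl⟩
      · rw [← v1 hj, ← M.vert_up j hj]
        exact ⟨_, rfl⟩
      · have := M.vert_down (m + 2 - j) (by omega)
        rw [show m + 2 - (m + 2 - j) = j by omega] at this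
        rw [← v2 hj, ← this]
        exact ⟨_, rfl⟩
  · ext c
    rw [mem_apartmentLink_edges hf']
    constructor
    · rintro ⟨i', rfl⟩
      refine ⟨(γ.inc_left i').isLinkEdge, ?_⟩
      obtain ⟨j, hj, -, hx⟩ := γ.exists_walk_eq i i'
      rw [hx]
      rcases lt_or_ge j (m + 2) with h | h
      · exact ⟨j, by omega, .inl (by have := M.edge_up j h; rwa [zero_add, e1 (by omega)] at this)⟩
      · refine ⟨m + 2 - 1 - (j - (m + 2)), by omega, .inr ?_⟩
        have := M.edge_down (j - (m + 2)) (by omega)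
        rwa [show 0 + (m + 2) + (j - (m + 2)) = j by omega, e2 (by omega)] at this
    · rintro ⟨-, j, hj, rfl | rfl⟩
      · rw [← e1 hj, ← M.edge_up j (by omega)]
        exact ⟨_, rfl⟩
      · have := M.edge_down (m + 1 - j) (by omega)
        rw [show m + 2 - 1 - (m + 1 - j) = j by omega] at this
        rw [← e2 hj, ← this]
        exact ⟨_, rfl⟩

theorem LinkCycle.eq_or_of_linkInc {γ : LinkCycle ν} {h : Tame k}
    (hν : ν = pt h (weightM11 m hm)) {i : Fin (γ.n + 2)} {x : Set (X k)}
    (hx : LinkInc ν (γ.edge i) x) : x = γ.vert i ∨ x = γ.vert (i + 1) := by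
  obtain ⟨f, -, s, hs, hc, h⟩ := (γ.inc_left i).exists_ends hν (γ.inc_right i)
    fun h => by simpa using γ.vert_injective h
  rw [hc] at hx
  rcases hx.eq_lv hν hs with rfl | rfl <;> rcases h with ⟨h1, h2⟩ | ⟨h1, h2⟩ <;> simp [h1, h2]

/-- The closure of the symmetric difference of two apartments that share the two upper arcs from
heights `s` and `t` on. -/
theorem LinkCycle.toSubLink_of_two_arcs {γ : LinkCycle ν} {f g : Tame k} {s t : ℕ}
    (hf : pt f (weightM11 m hm) = ν) (hg : pt g (weightM11 m hm) = ν)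
    (hs1 : 1 ≤ s) (ht1 : 1 ≤ t) (hs : s ≤ m + 1) (ht : t ≤ m + 1)
    (hps : lv m f s = lv m g s) (hpt : lv m (swapTame k * f) t = lv m (swapTame k * g) t)
    (hne₁ : ∀ j < s, le m f j ≠ le m g j)
    (hne₂ : ∀ j < t, le m (swapTame k * f) j ≠ le m (swapTame k * g) j)
    (hv₁ : ∀ j < s, lv m f j ∈ Set.range γ.vert ∧ lv m g j ∈ Set.range γ.vert)
    (hv₂ : ∀ j < t, lv m (swapTame k * f) j ∈ Set.range γ.vert ∧
      lv m (swapTame k * g) j ∈ Set.range γ.vert)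
    (he₁ : ∀ j < s, le m f j ∈ Set.range γ.edge ∧ le m g j ∈ Set.range γ.edge)
    (he₂ : ∀ j < t, le m (swapTame k * f) j ∈ Set.range γ.edge ∧
      le m (swapTame k * g) j ∈ Set.range γ.edge)
    (hγ : ∀ c ∈ Set.range γ.edge, (∃ j < s, c = le m f j ∨ c = le m g j) ∨
      ∃ j < t, c = le m (swapTame k * f) j ∨ c = le m (swapTame k * g) j) :
    γ.toSubLink = closureSymmDiff ν (apartmentLink ν f) (apartmentLink ν g) := by
  have eqs {j : ℕ} (h1 : s ≤ j) (h2 : j ≤ m + 1) : le m f j = le m g j :=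
    le_eq_of_le_eq hm h1 h2 (le_eq_of_lv_eq hm hs1 hs hps)
  have eqt {j : ℕ} (h1 : t ≤ j) (h2 : j ≤ m + 1) :
      le m (swapTame k * f) j = le m (swapTame k * g) j :=
    le_eq_of_le_eq hm h1 h2 (le_eq_of_lv_eq hm ht1 ht hpt)
  -- An equality between faces of opposite halves would propagate up to face m+1. There the halves
  -- of `g` and `f` already coincide, while the two halves of a single apartment differ.
  have cross₁ {j i : ℕ} (hj : j ≤ m + 1) (hi : i ≤ m + 1) :
      le m f j ≠ le m (swapTame k * g) i := by
    intro h
    obtain rfl := ((le_eq_iff hm hj hi).1 h).1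
    exact le_ne_le_swap hm f le_rfl ((le_eq_of_le_eq hm hj le_rfl h).trans (eqt ht le_rfl).symm)
  have cross₂ {j i : ℕ} (hj : j ≤ m + 1) (hi : i ≤ m + 1) :
      le m g j ≠ le m (swapTame k * f) i := by
    intro h
    obtain rfl := ((le_eq_iff hm hj hi).1 h).1
    exact le_ne_le_swap hm g le_rfl ((le_eq_of_le_eq hm hj le_rfl h).trans (eqt ht le_rfl))
  have ht' {j i : ℕ} {f g : Tame k} (hj : j ≤ m + 1) (hi : i ≤ m + 1)
      (h : le m f j = le m g i) : j = i := ((le_eq_iff hm hj hi).1 h).1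
  have hedges : (closureSymmDiff ν (apartmentLink ν f) (apartmentLink ν g)).edges =
      Set.range γ.edge := by
    ext c
    change c ∈ (_ ∪ _) \ (_ ∩ _) ↔ _
    rw [Set.mem_sdiff, Set.mem_union, Set.mem_inter_iff, mem_apartmentLink_edges hf,
      mem_apartmentLink_edges hg]
    constructor
    · rintro ⟨⟨hc, j, hj, rfl | rfl⟩ | ⟨hc, j, hj, rfl | rfl⟩, hnot⟩
      · by_contra hmem
        have hsj : s ≤ j := not_lt.1 fun h => hmem (he₁ j h).1
        exact hnot ⟨⟨hc, j, hj, .inl rfl⟩, hc, j, hj, .inl (eqs hsj hj)⟩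
      · by_contra hmem
        have htj : t ≤ j := not_lt.1 fun h => hmem (he₂ j h).1
        exact hnot ⟨⟨hc, j, hj, .inr rfl⟩, hc, j, hj, .inr (eqt htj hj)⟩
      · by_contra hmem
        have hsj : s ≤ j := not_lt.1 fun h => hmem (he₁ j h).2
        exact hnot ⟨⟨hc, j, hj, .inl (eqs hsj hj).symm⟩, hc, j, hj, .inl rfl⟩
      · by_contra hmem
        have htj : t ≤ j := not_lt.1 fun h => hmem (he₂ j h).2
        exact hnot ⟨⟨hc, j, hj, .inr (eqt htj hj).symm⟩, hc, j, hj, .inr rfl⟩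
    · intro hc
      have hle : IsLinkEdge ν c := by
        obtain ⟨i, rfl⟩ := hc
        exact (γ.inc_left i).isLinkEdge
      rcases hγ c hc with ⟨j, hj, rfl | rfl⟩ | ⟨j, hj, rfl | rfl⟩
      · refine ⟨.inl ⟨hle, j, by omega, .inl rfl⟩, ?_⟩
        rintro ⟨-, -, i, hi, h | h⟩
        · obtain rfl := ht' (by omega) hi h
          exact hne₁ j hj h
        · exact cross₁ (by omega) hi h
      · refine ⟨.inr ⟨hle, j, by omega, .inl rfl⟩, ?_⟩
        rintro ⟨⟨-, i, hi, h | h⟩, -⟩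
        · obtain rfl := ht' (by omega) hi h
          exact hne₁ j hj h.symm
        · exact cross₂ (by omega) hi h
      · refine ⟨.inl ⟨hle, j, by omega, .inr rfl⟩, ?_⟩
        rintro ⟨-, -, i, hi, h | h⟩
        · exact cross₂ hi (by omega) h.symm
        · obtain rfl := ht' (by omega) hi h
          exact hne₂ j hj h
      · refine ⟨.inr ⟨hle, j, by omega, .inr rfl⟩, ?_⟩
        rintro ⟨⟨-, i, hi, h | h⟩, -⟩
        · exact cross₁ hi (by omega) h.symm
        · obtain rfl := ht' (by omega) hi h
          exact hne₂ j hj h.symm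
  refine SubLink.ext ?_ hedges.symm
  ext x
  constructor
  · rintro ⟨i, rfl⟩
    exact .inr ⟨γ.edge i, hedges.ge ⟨i, rfl⟩, γ.inc_left i⟩
  · rintro (⟨hx, hnot⟩ | ⟨c, hc, hx⟩)
    · rw [Set.mem_union, mem_apartmentLink_verts hf, mem_apartmentLink_verts hg] at hx
      rw [Set.mem_inter_iff, mem_apartmentLink_verts hf, mem_apartmentLink_verts hg] at hnot
      rcases hx with ⟨hc, j, hj, rfl | rfl⟩ | ⟨hc, j, hj, rfl | rfl⟩
      · by_contra hmem
        have hsj : s ≤ j := not_lt.1 fun h => hmem (hv₁ j h).1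
        exact hnot ⟨⟨hc, j, hj, .inl rfl⟩, hc, j, hj, .inl (lv_eq_of_lv_eq hm hs1 hsj hj hps)⟩
      · by_contra hmem
        have htj : t ≤ j := not_lt.1 fun h => hmem (hv₂ j h).1
        exact hnot ⟨⟨hc, j, hj, .inr rfl⟩, hc, j, hj, .inr (lv_eq_of_lv_eq hm ht1 htj hj hpt)⟩
      · by_contra hmem
        have hsj : s ≤ j := not_lt.1 fun h => hmem (hv₁ j h).2
        exact hnot
          ⟨⟨hc, j, hj, .inl (lv_eq_of_lv_eq hm hs1 hsj hj hps).symm⟩, hc, j, hj, .inl rfl⟩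
      · by_contra hmem
        have htj : t ≤ j := not_lt.1 fun h => hmem (hv₂ j h).2
        exact hnot
          ⟨⟨hc, j, hj, .inr (lv_eq_of_lv_eq hm ht1 htj hj hpt).symm⟩, hc, j, hj, .inr rfl⟩
    · obtain ⟨i, rfl⟩ := hedges.le hc
      rcases γ.eq_or_of_linkInc hf.symm hx with rfl | rfl
      · exact ⟨_, rfl⟩
      · exact ⟨_, rfl⟩

theorem Mountain.edge_mem {γ : LinkCycle ν} {i : Fin (γ.n + 2)} {p : ℕ} {f g : Tame k} {s : ℕ}
    (M : Mountain m (γ.walk i) p f g s) {j : ℕ} (hj : j < s) :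
    le m f j ∈ Set.range γ.edge ∧ le m g j ∈ Set.range γ.edge := by
  refine ⟨⟨_, M.edge_up j hj⟩, ⟨_, (M.edge_down (s - 1 - j) (by omega)).trans ?_⟩⟩
  congr 1
  omega

theorem Mountain.vert_mem {γ : LinkCycle ν} {i : Fin (γ.n + 2)} {p : ℕ} {f g : Tame k} {s : ℕ}
    (M : Mountain m (γ.walk i) p f g s) {j : ℕ} (hj : j ≤ s) :
    lv m f j ∈ Set.range γ.vert ∧ lv m g j ∈ Set.range γ.vert := by
  refine ⟨⟨_, M.vert_up j hj⟩, ⟨_, (M.vert_down (s - j) (by omega)).trans ?_⟩⟩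
  congr 1
  omega

theorem Mountain.le_ne {γ : LinkCycle ν} {i : Fin (γ.n + 2)} {p : ℕ} {f g : Tame k} {s : ℕ}
    (M : Mountain m (γ.walk i) p f g s) (hN : p + 2 * s ≤ γ.n + 2) {j : ℕ} (hj : j < s) :
    le m f j ≠ le m g j := by
  intro h
  have h1 := M.edge_up j hj
  have h2 := M.edge_down (s - 1 - j) (by omega)
  rw [show s - 1 - (s - 1 - j) = j by omega, ← h, ← h1] at h2
  have := γ.walk_edge_inj i (by omega) (by omega) h2
  omega

theorem Mountain.exists_edge_eq {W : LinkWalk ν} {p : ℕ} {f g : Tame k} {s : ℕ}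
    (M : Mountain m W p f g s) {j : ℕ} (h1 : p ≤ j) (h2 : j < p + 2 * s) :
    ∃ r < s, W.edge j = le m f r ∨ W.edge j = le m g r := by
  rcases lt_or_ge j (p + s) with h | h
  · refine ⟨j - p, by omega, .inl ?_⟩
    rw [← M.edge_up (j - p) (by omega)]
    congr 1
    omega
  · refine ⟨s - 1 - (j - p - s), by omega, .inr ?_⟩
    rw [← M.edge_down (j - p - s) (by omega)]
    congr 1
    omega

/-- Each of the two valleys spans an apartment by `exists_apartment`. Each mountain has one slope in
either apartment; above its peak the two apartments agree, so the four slopes are exactly what is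
not shared. -/
theorem LinkCycle.toSubLink_of_two_mountains {γ : LinkCycle ν} {i : Fin (γ.n + 2)}
    {f₁ g₁ f₂ g₂ : Tame k} {s t : ℕ} (hf₁ : pt f₁ (weightM11 m hm) = ν)
    (hg₁ : pt g₁ (weightM11 m hm) = ν) (M₁ : Mountain m (γ.walk i) 0 f₁ g₁ s)
    (M₂ : Mountain m (γ.walk i) (2 * s) f₂ g₂ t) (hs : s ≤ m + 1) (ht : t ≤ m + 1)
    (hN : 2 * s + 2 * t = γ.n + 2) :
    ∃ f g, pt f (weightM11 m hm) = ν ∧ pt g (weightM11 m hm) = ν ∧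
      γ.toSubLink = closureSymmDiff ν (apartmentLink ν f) (apartmentLink ν g) := by
  have hs1 := M₁.one_le
  have ht1 := M₂.one_le
  have b₁ := M₁.vert_end
  have d₁ := M₁.edge_end_ne
  rw [zero_add, M₂.vert_start] at b₁
  rw [zero_add, M₂.edge_start] at d₁
  have b₂ := M₂.vert_end
  have d₂ := M₂.edge_end_ne
  rw [hN, γ.walk_vert_period, M₁.vert_start] at b₂
  rw [hN, γ.walk_edge_period, M₁.edge_start] at d₂
  obtain ⟨f, e1, e2⟩ := exists_apartment hm b₂ d₂.symm
  obtain ⟨g, e3, e4⟩ := exists_apartment hm b₁.symm d₁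
  have v {u u' : Tame k} (h : le m u 0 = le m u' 0) {j : ℕ} (hj : j ≤ m + 2) :=
    lv_eq_of_le_zero_eq hm h hj
  have e {u u' : Tame k} (h : le m u 0 = le m u' 0) {j : ℕ} (hj : j ≤ m + 1) :=
    le_eq_of_le_eq hm j.zero_le hj h
  have hf : pt f (weightM11 m hm) = ν := (pt_weight_eq_of_le_eq hm (by omega) e1).symm.trans hf₁
  have hg : pt g (weightM11 m hm) = ν := (pt_weight_eq_of_le_eq hm (by omega) e3).symm.trans hg₁
  refine ⟨f, g, hf, hg, LinkCycle.toSubLink_of_two_arcs (s := s) (t := t) hf hg hs1 ht1 hs ht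
    ?_ ?_ (fun j hj => ?_) (fun j hj => ?_) (fun j hj => ?_) (fun j hj => ?_) (fun j hj => ?_)
    (fun j hj => ?_) ?_⟩
  · rw [← v e1 (by omega), ← v e3 (by omega), M₁.peak]
  · rw [← v e2 (by omega), ← v e4 (by omega), M₂.peak]
  · rw [← e e1 (by omega), ← e e3 (by omega)]
    exact M₁.le_ne (by omega) hj
  · rw [← e e2 (by omega), ← e e4 (by omega)]
    exact (M₂.le_ne (by omega) hj).symm
  · rw [← v e1 (by omega), ← v e3 (by omega)]
    exact M₁.vert_mem hj.le
  · rw [← v e2 (by omega), ← v e4 (by omega)]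
    exact (M₂.vert_mem hj.le).symm
  · rw [← e e1 (by omega), ← e e3 (by omega)]
    exact M₁.edge_mem hj
  · rw [← e e2 (by omega), ← e e4 (by omega)]
    exact (M₂.edge_mem hj).symm
  · rintro _ ⟨i', rfl⟩
    obtain ⟨j, hj, -, hx⟩ := γ.exists_walk_eq i i'
    rw [hx]
    rcases lt_or_ge j (2 * s) with h | h
    · obtain ⟨r, hr, hx⟩ := M₁.exists_edge_eq j.zero_le (by omega)
      rw [e e1 (by omega), e e3 (by omega)] at hx
      exact .inl ⟨r, hr, hx⟩
    · obtain ⟨r, hr, hx⟩ := M₂.exists_edge_eq h (by omega)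
      rw [e e2 (by omega), e e4 (by omega)] at hx
      exact .inr ⟨r, hr, hx.symm⟩

/-- Mountains are peeled off the periodic walk until the period is used up. Since arccos(2/5) ≤ π/2,
the allowed length is at most 2π + π/3, which is below the 8π/3 needed for four mountains or for a
peak m+2 next to another mountain. -/
theorem LinkCycle.eq_of_length_lt [CharZero k] {h : Tame k} (hν : ν = pt h (weightM11 m hm))
    (γ : LinkCycle ν)
    (hγ : γ.length < 2 * Real.pi + 2 * (Real.arccos (2 / 5) - Real.pi / 3)) :
    (∃ f, pt f (weightM11 m hm) = ν ∧ γ.toSubLink = apartmentLink ν f) ∨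
    (∃ f g, pt f (weightM11 m hm) = ν ∧ pt g (weightM11 m hm) = ν ∧
      γ.toSubLink = closureSymmDiff ν (apartmentLink ν f) (apartmentLink ν g)) := by
  obtain ⟨i, f₀, h0⟩ := γ.exists_low hν
  set W := γ.walk i with hW
  have hlow : W.vert 0 = lv m f₀ 0 := by
    rw [← h0, hW]
    simp [walk]
  have hlowN : W.vert (γ.n + 2) = lv m f₀ 0 := (γ.walk_vert_period i).trans hlow
  rw [γ.length_eq i, ← hW] at hγ
  have hpi := Real.pi_pos
  have hacos : Real.arccos (2 / 5) ≤ Real.pi / 2 := Real.arccos_le_pi_div_two.2 (by norm_num)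
  have hmin {s : ℕ} (h1 : 1 ≤ s) (h2 : s ≤ m + 2) := pi_div_three_le_angle m hm h1 h2
  have htop {s : ℕ} (h2 : s ≤ m + 2) (h3 : ¬s ≤ m + 1) :
      angle (tangent m 0) (tangent m s) = Real.pi := by
    obtain rfl : s = m + 2 := by omega
    exact angle_tangent_zero_top m hm
  have hlen0 : W.len 0 = 0 := rfl
  obtain ⟨f₁, g₁, s₁, hf₁, hg₁, M₁⟩ := W.exists_mountain hν hlow
  have l₁ := M₁.len_le hf₁ hg₁
  have n₁ := M₁.le_of_vert_eq (hm := hm) (by omega) hlowN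
  have a₁ := hmin M₁.one_le M₁.le_top
  rw [zero_add] at l₁ n₁
  rcases n₁.eq_or_lt with n₁ | n₁
  · exact .inl (LinkCycle.toSubLink_of_one_mountain hf₁ M₁ n₁)
  have end₁ := M₁.vert_end
  rw [zero_add] at end₁
  obtain ⟨f₂, g₂, s₂, hf₂, hg₂, M₂⟩ := W.exists_mountain hν end₁
  have l₂ := M₂.len_le hf₂ hg₂
  have n₂ := M₂.le_of_vert_eq (hm := hm) n₁ hlowN
  have a₂ := hmin M₂.one_le M₂.le_top
  have mono₂ := W.len_mono hν n₂
  have t₁ : s₁ ≤ m + 1 := by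
    by_contra h3
    rw [htop M₁.le_top h3] at l₁
    linarith
  have t₂ : s₂ ≤ m + 1 := by
    by_contra h3
    rw [htop M₂.le_top h3] at l₂
    linarith
  rcases n₂.eq_or_lt with n₂ | n₂
  · exact .inr (LinkCycle.toSubLink_of_two_mountains hf₁ hg₁ M₁ M₂ t₁ t₂ n₂)
  exfalso
  obtain ⟨f₃, g₃, s₃, hf₃, hg₃, M₃⟩ := W.exists_mountain hν M₂.vert_end
  have l₃ := M₃.len_le hf₃ hg₃
  have n₃ := M₃.le_of_vert_eq (hm := hm) n₂ hlowN
  have a₃ := hmin M₃.one_le M₃.le_top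
  have mono₃ := W.len_mono hν n₃
  have t₃ : s₃ ≤ m + 1 := by
    by_contra h3
    rw [htop M₃.le_top h3] at l₃
    linarith
  rcases n₃.eq_or_lt with n₃ | n₃
  · have b₁ := M₁.vert_end
    have d₁ := M₁.edge_end_ne
    rw [zero_add, M₂.vert_start] at b₁
    rw [zero_add, M₂.edge_start] at d₁
    have b₂ := M₂.vert_end
    have d₂ := M₂.edge_end_ne
    rw [M₃.vert_start] at b₂
    rw [M₃.edge_start] at d₂
    have b₃ := M₃.vert_end
    have d₃ := M₃.edge_end_ne
    rw [n₃, γ.walk_vert_period, M₁.vert_start] at b₃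
    rw [n₃, γ.walk_edge_period, M₁.edge_start] at d₃
    have p₁ := M₁.one_le
    have p₂ := M₂.one_le
    have p₃ := M₃.one_le
    have hne : lv m f₁ 0 ≠ lv m g₁ 0 := by
      rw [← b₁, ← M₁.vert_start, ← M₂.vert_start]
      intro h
      have := γ.walk_vert_inj i (by omega) (by omega) h
      omega
    have hsum := add_two_le_sum_heights hm p₁ p₂ p₃ t₁ t₂ t₃ M₁.peak M₂.peak M₃.peak b₁.symm
      b₂.symm b₃.symm d₁ d₂ d₃ hne
    have hbig {s : ℕ} (h1 : 1 ≤ s) (h2 : s ≤ m + 1) (h3 : m ≤ 6 * (s - 1)) :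
        Real.arccos (2 / 5) ≤ angle (tangent m 0) (tangent m s) := by
      have := arccos_two_fifths_le_angle m hm h3 (by omega)
      rwa [Nat.sub_add_cancel h1] at this
    -- The numbers s - 1 add up to at least m - 1, so the largest is at least (m-1)/3, and this is
    -- at least m/6 as m ≥ 2.
    have hcases : m ≤ 6 * (s₁ - 1) ∨ m ≤ 6 * (s₂ - 1) ∨ m ≤ 6 * (s₃ - 1) := by omega
    rcases hcases with h | h | h
    · have := hbig p₁ t₁ h
      linarith
    · have := hbig p₂ t₂ h
      linarith
    · have := hbig p₃ t₃ h
      linarith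
  · obtain ⟨f₄, g₄, s₄, hf₄, hg₄, M₄⟩ := W.exists_mountain hν M₃.vert_end
    have l₄ := M₄.len_le hf₄ hg₄
    have n₄ := M₄.le_of_vert_eq (hm := hm) n₃ hlowN
    have a₄ := hmin M₄.one_le M₄.le_top
    have mono₄ := W.len_mono hν n₄
    linarith

end TameX

theorem mainTheorem8 (k : Type*) [Field k] [CharZero k] :
    ∃ ε₀ : ℝ, 0 < ε₀ ∧
      ∀ (m : ℕ) (hm : 2 ≤ m) (ν : TameX.X k),
        (∃ h : TameX.Tame k, ν = TameX.pt h (TameX.weightM11 m hm)) →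
        ∀ γ : TameX.LinkCycle ν, γ.length < 2 * Real.pi + ε₀ →
          (∃ f : TameX.Tame k, TameX.pt f (TameX.weightM11 m hm) = ν ∧
            γ.toSubLink = TameX.apartmentLink ν f) ∨
          (∃ f g : TameX.Tame k, TameX.pt f (TameX.weightM11 m hm) = ν ∧
            TameX.pt g (TameX.weightM11 m hm) = ν ∧
            γ.toSubLink = TameX.closureSymmDiff ν
              (TameX.apartmentLink ν f) (TameX.apartmentLink ν g)) :=
  ⟨2 * (Real.arccos (2 / 5) - Real.pi / 3), by linarith [TameX.pi_div_three_lt_arccos],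
    fun _ _ _ ⟨_, hν⟩ γ hγ => TameX.LinkCycle.eq_of_length_lt hν γ hγ⟩
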